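/- **Setting.** Let $d\ge 1$, $U=B(z,r)\subset\mathbb R^d$ an open ball ($r>0$), $\psi(x)=r^2-\|x-z\|^2$, $\pi_U$ the uniform distribution on $U$, $\varkappa$ the Bernoulli law on $\{0,1\}$ with $\varkappa\{1\}=\alpha\in(0,1)$, $\nu$ a probability measure on $\mathbb R^d$, and $\theta_n:(\mathbb R^d)^n\to[0,1]$, $n\ge1$, measurable. For $n\ge 1$ let $\Omega^n=(\mathbb R^d\times\{0,1\}\times\mathbb R^d)^n$ with $P^n=(\pi_U\times\varkappa\times\nu)^{n}$; write $\omega=(\eta,\varepsilon,\zeta)$ and $E$ for expectation under $P^n$. Let $H=\mathbb R^{d\times n}$ with canonical basis $e_{kr}$. Let $\mathcal C$ be the set of measurable $u:\Omega^n\to\mathbb R$ that are $C^\infty$ in $\eta$ and $P^n$-essentially bounded together with all their $\eta$-derivatives, and put $$Du(\eta,\varepsilon,\zeta)=\theta_n(\zeta)\sum_{k,r}\psi(\eta_k)\,\frac{\partial u}{\partial\eta_{kr}}(\eta,\varepsilon,\zeta)\,e_{kr},\qquad D^{j+1}u=D(D^ju)\in H^{\otimes (j+1)}.$$ The Sobolev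 class $W_p^m$ is the closure of $\mathcal C$ in the norm $\big[\sum_{j\le m}E\|D^ju\|_{H^{\otimes j}}^p\big]^{1/p}$ (the operators $D^j$ are extended to it by closability); $W_p^m(\mathbb R^d)$ consists of the $\mathbb R^d$-valued functionals with coordinates in $W_p^m$. For $f=(f_1,\dots,f_d)$ let $\sigma^f=\big((Df_i,Df_j)_H\big)_{i,j}$ and, for a set $\Xi\in\sigma(\varepsilon,\zeta)$ on which $\det\sigma^f>0$ a.s., let $\varrho^{f,\Xi}=(\sigma^f)^{-1}$ on $\Xi$ and $\varrho^{f,\Xi}=0$ off $\Xi$. Put $\|A\|_{\mathcal M}=\max_{i,j}|A_{ij}|$ and, for $q\in\{d,d+1\}$ and a constant $L_q>0$, $$N_q(f)=\max_{1\le i\le d}\ \max_{1\le m\le (q+1)^2}\Big[E\|D^mf_i\|_{H^{\otimes m}}^{2(q+1)(q+2)}\Big]^{\frac1{2(q+1)(q+2)}},$$ $$K_q(f,\Xi)=L_q\sum_{M=0}^{q}N_q(f)^{q+2M}\Big[E\|\varrho^{f,\Xi}\|_{\mathcal M}^{4(M+q)}\Big]^{1/4}.$$ Write $P_\Xi=P^n(\cdot\cap\Xi)$.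 **Theorem.** There are constants $L_d,L_{d+1}>0$, depending only on $d$ and $\psi$, such that for all $\alpha,\nu,(\theta_n)$ as above the following holds. Let $f^n:\Omega^n\to\mathbb R^d$ be random vectors and $\Xi_n\in\sigma(\varepsilon,\zeta)$ sets ($n\ge1$) with $\det\sigma^{f^n}>0$ a.s. on $\Xi_n$, and suppose (C1) $f^n\in W_{2(d+2)(d+3)}^{(d+2)^2}(\mathbb R^d)$ for every $n$, and $\sup_nK_{d+1}(f^n,\Xi_n)<\infty$. Then the law of $f^n$ under $P_{\Xi_n}$ has a density $p_n$ such that, for all $n\ge 1$, (a) $p_n(y)\le K_d(f^n,\Xi_n)\,P_{\Xi_n}(\|f^n\|\ge\|y\|)^{1/2}$ for all $y\in\mathbb R^d$; (b) $p_n$ is Lipschitz with constant $d\cdot\sup_kK_{d+1}(f^k,\Xi_k)$. If, in addition, (C2) $f^n$ converges in distribution to some random vector $f$, and (C3) $P^n(\Xi_n)\to1$ as $n\to\infty$, then the law of $f$ has a density $p$ and (c) $\sup_{y\in\mathbb R^d}|p_n(y)-p(y)|\to0$ as $n\to\infty$. -/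

import Mathlib

open MeasureTheory ProbabilityTheory Filter Topology
open scoped ENNReal NNReal

namespace PartialMalliavin

/-- The Euclidean space `ℝ^d`. -/
abbrev E (d : ℕ) : Type := EuclideanSpace ℝ (Fin d)

/-- The sample space: points are triples `ω = (η, ε, ζ)` with `η, ζ ∈ (ℝ^d)^n`, `ε ∈ {0,1}^n`. -/
abbrev Omega (d n : ℕ) : Type := (Fin n → E d) × (Fin n → Bool) × (Fin n → E d)

/-- Index set `{(k, r) : k = 1, …, n, r = 1, …, d}` of the canonical basis of `H = ℝ^{d × n}`. -/
abbrev Idx (d n : ℕ) : Type := Fin n × Fin d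

/-- The tensor power `H^{⊗ j}` in coordinates; its Euclidean norm is the Hilbert-Schmidt norm. -/
abbrev HTensor (d n j : ℕ) : Type := EuclideanSpace ℝ (Fin j → Idx d n)

/-- The uniform distribution `π_U` on the open ball `U = B(z, r)`. -/
noncomputable def uniformBall {d : ℕ} (z : E d) (r : ℝ) : Measure (E d) :=
  ProbabilityTheory.cond volume (Metric.ball z r)

/-- The Bernoulli distribution on `{0,1}` which charges `1` with mass `α`. -/
noncomputable def bernoulliLaw (α : unitInterval) : Measure Bool :=
  ENNReal.ofReal (α : ℝ) • Measure.dirac true + ENNReal.ofReal (1 - (α : ℝ)) • Measure.dirac false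

/-- The law `P^n` of `(η, ε, ζ)`: all coordinates are independent, `η_k ∼ π_U`,
`ε_k` is Bernoulli with parameter `α`, and `ζ_k ∼ ν`. -/
noncomputable def law {d : ℕ} (z : E d) (r : ℝ) (α : unitInterval) (ν : Measure (E d)) (n : ℕ) :
    Measure (Omega d n) :=
  (Measure.pi fun _ : Fin n => uniformBall z r).prod
    ((Measure.pi fun _ : Fin n => bernoulliLaw α).prod (Measure.pi fun _ : Fin n => ν))

instance isProbabilityMeasure_uniformBall {d : ℕ} (z : E d) (r : ℝ) [hr : Fact (0 < r)] :
    IsProbabilityMeasure (uniformBall z r) :=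
  ProbabilityTheory.cond_isProbabilityMeasure_of_finite
    (Metric.measure_ball_pos volume z hr.out).ne' measure_ball_lt_top.ne

instance isProbabilityMeasure_bernoulliLaw (α : unitInterval) :
    IsProbabilityMeasure (bernoulliLaw α) := by
  constructor
  simp only [bernoulliLaw, Measure.coe_add, Measure.coe_smul, Pi.add_apply, Pi.smul_apply,
    measure_univ, smul_eq_mul, mul_one]
  rw [← ENNReal.ofReal_add α.2.1 (sub_nonneg.2 α.2.2)]
  simp

instance isProbabilityMeasure_law {d : ℕ} (z : E d) (r : ℝ) [Fact (0 < r)] (α : unitInterval)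
    (ν : Measure (E d)) [IsProbabilityMeasure ν] (n : ℕ) :
    IsProbabilityMeasure (law z r α ν n) := by
  unfold law
  infer_instance

/-- The weight `ψ(x) = r² - ‖x - z‖²`, which vanishes on the boundary of `B(z, r)`. -/
noncomputable def psi {d : ℕ} (z : E d) (r : ℝ) (x : E d) : ℝ := r ^ 2 - ‖x - z‖ ^ 2

/-- The `σ`-algebra on the sample space generated by `(ε, ζ)`. -/
abbrev sigmaEpsZeta (d n : ℕ) : MeasurableSpace (Omega d n) :=
  MeasurableSpace.comap (fun ω : Omega d n => ω.2) inferInstance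

section Derivative

variable {d n : ℕ}

/-- The `(k, r)` coordinate `θ(ζ) ψ(η_k) ∂u/∂η_{kr}` of the stochastic gradient `D u`. -/
noncomputable def gradCoord (ψ : E d → ℝ) (θ : (Fin n → E d) → ℝ) (a : Idx d n)
    (u : Omega d n → ℝ) (ω : Omega d n) : ℝ :=
  θ ω.2.2 * ψ (ω.1 a.1) *
    fderiv ℝ (fun η : Fin n → E d => u (η, ω.2)) ω.1 (Pi.single a.1 (EuclideanSpace.single a.2 1))

/-- The iterated stochastic gradient `D^j u`, with values in `H^{⊗ j}`, of a function that is
smooth in `η`. -/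
noncomputable def iterGrad (ψ : E d → ℝ) (θ : (Fin n → E d) → ℝ) (u : Omega d n → ℝ) :
    (j : ℕ) → Omega d n → HTensor d n j
  | 0, ω => WithLp.toLp 2 fun _ => u ω
  | j + 1, ω => WithLp.toLp 2 fun I =>
      gradCoord ψ θ (I 0) (fun ω' => iterGrad ψ θ u j ω' fun i => I i.succ) ω

/-- The class `𝒞` of test functionals: measurable, `C^∞` in `η`, and essentially bounded together
with all derivatives in `η`. -/
structure IsTest (P : Measure (Omega d n)) (u : Omega d n → ℝ) : Prop where
  measurable : Measurable u
  smooth : ∀ e : (Fin n → Bool) × (Fin n → E d), ContDiff ℝ ((⊤ : ℕ∞) : WithTop ℕ∞) fun η : Fin n → E d => u (η, e)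
  bounded : ∀ j : ℕ, ∃ C : ℝ, ∀ᵐ ω ∂P,
    ‖iteratedFDeriv ℝ j (fun η : Fin n → E d => u (η, ω.2)) ω.1‖ ≤ C

/-- `f` lies in the closure of `𝒞` for the Sobolev norm of order `m` and exponent `p`, and
`G j` is (a version of) `D^j f` for `j ≤ m`. -/
structure HasSobolevDerivs (P : Measure (Omega d n)) (ψ : E d → ℝ) (θ : (Fin n → E d) → ℝ)
    (p : ℝ≥0∞) (m : ℕ) (f : Omega d n → ℝ) (G : (j : ℕ) → Omega d n → HTensor d n j) :
    Prop where
  zero : ∀ᵐ ω ∂P, ∀ I, G 0 ω I = f ω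
  memLp : ∀ j ≤ m, MemLp (G j) p P
  approx : ∃ u : ℕ → Omega d n → ℝ, (∀ k, IsTest P (u k)) ∧
    ∀ j ≤ m, Tendsto (fun k => eLpNorm (iterGrad ψ θ (u k) j - G j) p P) atTop (𝓝 0)

/-- Membership in the Sobolev class `W_p^m`. -/
def MemSobolev (P : Measure (Omega d n)) (ψ : E d → ℝ) (θ : (Fin n → E d) → ℝ)
    (p : ℝ≥0∞) (m : ℕ) (f : Omega d n → ℝ) : Prop :=
  ∃ G, HasSobolevDerivs P ψ θ p m f G

open Classical in
/-- The derivatives `D^j f`, `j ≤ m`, of `f ∈ W_p^m`. They are determined up to null sets because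
`D` is closable. -/
noncomputable def sobolevDeriv (P : Measure (Omega d n)) (ψ : E d → ℝ) (θ : (Fin n → E d) → ℝ)
    (p : ℝ≥0∞) (m : ℕ) (f : Omega d n → ℝ) : (j : ℕ) → Omega d n → HTensor d n j :=
  if h : MemSobolev P ψ θ p m f then h.choose else fun _ _ => 0

/-- Membership in `W_p^m(ℝ^d)`, with exponent `p = 2(d+2)(d+3)` and order `m = (d+2)²`, of an
`ℝ^d`-valued functional (equivalently, of each of its coordinates). -/
def MemSobolevVec (P : Measure (Omega d n)) (ψ : E d → ℝ) (θ : (Fin n → E d) → ℝ)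
    (f : Omega d n → E d) : Prop :=
  ∀ i : Fin d, MemSobolev P ψ θ ((2 * (d + 2) * (d + 3) : ℕ) : ℝ≥0∞) ((d + 2) ^ 2) fun ω => f ω i

/-- The derivatives of the coordinates of `f`: `derivs P ψ θ f i j` is `D^j f_i`. -/
noncomputable def derivs (P : Measure (Omega d n)) (ψ : E d → ℝ) (θ : (Fin n → E d) → ℝ)
    (f : Omega d n → E d) (i : Fin d) : (j : ℕ) → Omega d n → HTensor d n j :=
  sobolevDeriv P ψ θ ((2 * (d + 2) * (d + 3) : ℕ) : ℝ≥0∞) ((d + 2) ^ 2) fun ω => f ω i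

/-- The Malliavin matrix `σ_{ij} = (D f_i, D f_j)_H`. -/
noncomputable def malliavinMatrix (P : Measure (Omega d n)) (ψ : E d → ℝ)
    (θ : (Fin n → E d) → ℝ) (f : Omega d n → E d) (ω : Omega d n) : Matrix (Fin d) (Fin d) ℝ :=
  Matrix.of fun i j => inner ℝ (derivs P ψ θ f i 1 ω) (derivs P ψ θ f j 1 ω)

open Classical in
/-- The matrix `ϱ`: the inverse of the Malliavin matrix on `Ξ`, and zero off `Ξ`. -/
noncomputable def rho (P : Measure (Omega d n)) (ψ : E d → ℝ) (θ : (Fin n → E d) → ℝ)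
    (f : Omega d n → E d) (Ξ : Set (Omega d n)) (ω : Omega d n) : Matrix (Fin d) (Fin d) ℝ :=
  if ω ∈ Ξ then (malliavinMatrix P ψ θ f ω)⁻¹ else 0

/-- The norm `max_{i,j} |A_{ij}|` of a matrix. -/
noncomputable def maxNorm (A : Matrix (Fin d) (Fin d) ℝ) : ℝ≥0∞ :=
  ⨆ (i : Fin d) (j : Fin d), ‖A i j‖ₑ

/-- `N_q(f) = max_{i ≤ d} max_{1 ≤ m ≤ (q+1)²} (E ‖D^m f_i‖^{2(q+1)(q+2)})^{1/(2(q+1)(q+2))}`. -/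
noncomputable def sobolevMax (P : Measure (Omega d n)) (ψ : E d → ℝ) (θ : (Fin n → E d) → ℝ)
    (f : Omega d n → E d) (q : ℕ) : ℝ≥0∞ :=
  ⨆ (i : Fin d), ⨆ m ∈ Finset.Icc 1 ((q + 1) ^ 2),
    eLpNorm (derivs P ψ θ f i m) ((2 * (q + 1) * (q + 2) : ℕ) : ℝ≥0∞) P

/-- `K_q(f, Ξ) = L ∑_{M=0}^{q} N_q(f)^{q+2M} (E max_{i,j} |ϱ_{ij}|^{4(M+q)})^{1/4}`, used for
`q = d` and `q = d + 1`. -/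
noncomputable def K (P : Measure (Omega d n)) (ψ : E d → ℝ) (θ : (Fin n → E d) → ℝ) (L : ℝ≥0)
    (q : ℕ) (f : Omega d n → E d) (Ξ : Set (Omega d n)) : ℝ≥0∞ :=
  L * ∑ M ∈ Finset.range (q + 1), sobolevMax P ψ θ f q ^ (q + 2 * M) *
    (∫⁻ ω, maxNorm (rho P ψ θ f Ξ ω) ^ (4 * (M + q)) ∂P) ^ (1 / 4 : ℝ)

end Derivative

end PartialMalliavin

open PartialMalliavin

universe u

/-! The proof is a Malliavin calculus in the variable η alone, with the Bernoulli variables and ζ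
frozen, in which no constant sees n. It is followed by a direct passage from integration by parts
inequalities to densities.

With (ε, ζ) frozen, D_{kr} = θψ(η_k)∂_{kr} is a derivation of the algebra of smooth functions of η.
Since ψ vanishes on the sphere, it has an adjoint without boundary term (`integral_gradDer_mul`).
The D_{kr} do not commute, but the defect couples only coordinates of one block η_k
(`gradDer_comm`), so commuting D with the divergence δ costs constants that depend on d and ψ only
(`exists_sum_nsq_divComm_le`). Starting from E δ(S)² = E⟨S, Dδ(S)⟩, this bounds δ and its
derivatives in L², uniformly in n.

If ϱ inverts the Malliavin matrix σ and h_i = ∑_j ϱ_ij Df_j, then ⟨h_i, Dφ(f)⟩ = ∂_iφ(f). Iterating,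
E ∂_Iφ(f) = E φ(f)W_I with W_{i::I} = δ(W_I h_i). Put R = |ϱ|² and F = ∑|D^m f_i|². Then |D^a h_i|²
is of order RF(1 + RF²)^a, so that E W_I² is of order E(RF(1 + RF²))^{|I|}
(`exists_integral_weight_sq_le`). The binomial formula and the Cauchy–Schwarz inequality turn this
into K_q.

Approximating test functionals may be degenerate, so σ is replaced by σ + ε for a number ε > 0, at
the price of an error governed by ε|(σ + ε)⁻¹|. The approximation is removed first, at fixed ε,
where the inverse is bounded; then ε → 0, using nondegeneracy on Ξ. As Ξ lies in σ(ε, ζ),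
restriction to Ξ does not disturb the law of η.

On ℝ^d this leaves |∫∂_Iφ dμ| ≤ K_q (∫φ² dμ)^{1/2} for q = d, d + 1 (`IbpBound`). Let φ be a product
of smooth steps, so that ∂_1⋯∂_dφ is a mollifier. Order d bounds the mollified density; choosing φ
to vanish off an orthant that points away from the origin gives (a). Order d + 1 bounds its gradient
and gives (b). Finally, Lipschitz densities of weakly close laws are uniformly close
(`exists_density_close`); this removes the mollifier and also gives (c). -/

namespace PartialMalliavin

open Finset.HasAntidiagonal (antidiagonal)

/-! ### Hilbert–Schmidt norms of iterated derivations and the Leibniz inequality. -/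

section SquareNorms

variable {ι X : Type*} [Fintype ι] {A : Subalgebra ℝ (X → ℝ)} (D : ι → Derivation ℝ A A)

/-- The squared Hilbert–Schmidt norm `∑_{|I| = j} (D_I F)²` of the `j`-th derivative of `F`
with respect to a finite family of derivations of an algebra of functions. -/
def nsq : ℕ → A → X → ℝ
  | 0, F, x => F.1 x ^ 2
  | j + 1, F, x => ∑ a, nsq j (D a F) x

lemma nsq_zero (F : A) (x : X) : nsq D 0 F x = F.1 x ^ 2 := rfl

lemma nsq_succ (j : ℕ) (F : A) (x : X) : nsq D (j + 1) F x = ∑ a, nsq D j (D a F) x := rfl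

lemma nsq_nonneg (j : ℕ) (F : A) (x : X) : 0 ≤ nsq D j F x := by
  induction j generalizing F with
  | zero => exact sq_nonneg _
  | succ j ih => exact Finset.sum_nonneg fun a _ => ih _

lemma nsq_smul (j : ℕ) (c : ℝ) (F : A) (x : X) : nsq D j (c • F) x = c ^ 2 * nsq D j F x := by
  induction j generalizing F with
  | zero => simp [nsq_zero, mul_pow]
  | succ j ih => simp only [nsq_succ, Derivation.map_smul, ih, Finset.mul_sum]

lemma nsq_neg (j : ℕ) (F : A) (x : X) : nsq D j (-F) x = nsq D j F x := by
  have := nsq_smul D j (-1) F x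
  simpa using this

lemma nsq_map_zero (j : ℕ) (x : X) : nsq D j 0 x = 0 := by
  have := nsq_smul D j 0 0 x
  simpa using this

lemma nsq_one_succ (j : ℕ) (x : X) : nsq D (j + 1) 1 x = 0 := by
  simp [nsq_succ, nsq_map_zero]

lemma nsq_add_le (j : ℕ) (F G : A) (x : X) :
    nsq D j (F + G) x ≤ 2 * (nsq D j F x + nsq D j G x) := by
  induction j generalizing F G with
  | zero =>
    simp only [nsq_zero, Subalgebra.coe_add, Pi.add_apply]
    nlinarith [sq_nonneg (F.1 x - G.1 x)]
  | succ j ih =>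
    simp only [nsq_succ, map_add]
    calc _ ≤ ∑ a, 2 * (nsq D j (D a F) x + nsq D j (D a G) x) :=
          Finset.sum_le_sum fun a _ => ih _ _
      _ = _ := by rw [← Finset.mul_sum, Finset.sum_add_distrib]

lemma nsq_sub_le (j : ℕ) (F G : A) (x : X) :
    nsq D j (F - G) x ≤ 2 * (nsq D j F x + nsq D j G x) := by
  simpa [sub_eq_add_neg, nsq_neg] using nsq_add_le D j F (-G) x

lemma nsq_sum_le {κ : Type*} (s : Finset κ) (j : ℕ) (F : κ → A) (x : X) :
    nsq D j (∑ k ∈ s, F k) x ≤ s.card * ∑ k ∈ s, nsq D j (F k) x := by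
  induction j generalizing F with
  | zero =>
    simp only [nsq_zero]
    rw [show (∑ k ∈ s, F k).1 x = ∑ k ∈ s, (F k).1 x by
      rw [AddSubmonoidClass.coe_finsetSum, Finset.sum_apply]]
    exact sq_sum_le_card_mul_sum_sq
  | succ j ih =>
    simp only [nsq_succ, map_sum]
    calc _ ≤ ∑ a, s.card * ∑ k ∈ s, nsq D j (D a (F k)) x := Finset.sum_le_sum fun a _ => ih _
      _ = _ := by rw [← Finset.mul_sum, Finset.sum_comm]

lemma sum_antidiagonal_fst_succ_le (j : ℕ) (f : ℕ × ℕ → ℝ) (hf : ∀ p, 0 ≤ f p) :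
    ∑ p ∈ antidiagonal j, f (p.1 + 1, p.2) ≤ ∑ p ∈ antidiagonal (j + 1), f p := by
  rw [Finset.Nat.sum_antidiagonal_succ]
  linarith [hf (0, j + 1)]

lemma sum_antidiagonal_snd_succ_le (j : ℕ) (f : ℕ × ℕ → ℝ) (hf : ∀ p, 0 ≤ f p) :
    ∑ p ∈ antidiagonal j, f (p.1, p.2 + 1) ≤ ∑ p ∈ antidiagonal (j + 1), f p := by
  rw [Finset.Nat.sum_antidiagonal_succ']
  linarith [hf (j + 1, 0)]

/-- The Leibniz rule and the Cauchy–Schwarz inequality for the derivatives of `∑ F_k G_k`. -/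
lemma nsq_sum_mul_le {κ : Type*} (s : Finset κ) (j : ℕ) (F G : κ → A) (x : X) :
    nsq D j (∑ k ∈ s, F k * G k) x ≤ 4 ^ j * ∑ p ∈ antidiagonal j,
      (∑ k ∈ s, nsq D p.1 (F k) x) * ∑ k ∈ s, nsq D p.2 (G k) x := by
  induction j generalizing F G with
  | zero =>
    simp only [nsq_zero, Finset.Nat.antidiagonal_zero, Finset.sum_singleton, pow_zero, one_mul]
    rw [show (∑ k ∈ s, F k * G k).1 x = ∑ k ∈ s, (F k).1 x * (G k).1 x by
      rw [AddSubmonoidClass.coe_finsetSum, Finset.sum_apply]; rfl]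
    exact Finset.sum_mul_sq_le_sq_mul_sq s _ _
  | succ j ih =>
    have hS : ∀ (p : ℕ) (F : κ → A), 0 ≤ ∑ k ∈ s, nsq D p (F k) x :=
      fun p F => Finset.sum_nonneg fun k _ => nsq_nonneg D _ _ _
    have hD : ∀ (p : ℕ) (F : κ → A), ∑ a, ∑ k ∈ s, nsq D p (D a (F k)) x
        = ∑ k ∈ s, nsq D (p + 1) (F k) x := fun p F => by rw [Finset.sum_comm]; rfl
    set f : ℕ × ℕ → ℝ := fun p => (∑ k ∈ s, nsq D p.1 (F k) x) * ∑ k ∈ s, nsq D p.2 (G k) x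
    have hf : ∀ p, 0 ≤ f p := fun p => mul_nonneg (hS _ _) (hS _ _)
    rw [nsq_succ]
    have h1 : ∀ a, nsq D j (D a (∑ k ∈ s, F k * G k)) x ≤
        2 * (4 ^ j * (∑ p ∈ antidiagonal j,
          (∑ k ∈ s, nsq D p.1 (F k) x) * ∑ k ∈ s, nsq D p.2 (D a (G k)) x) +
        4 ^ j * ∑ p ∈ antidiagonal j,
          (∑ k ∈ s, nsq D p.1 (D a (F k)) x) * ∑ k ∈ s, nsq D p.2 (G k) x) := by
      intro a
      have : D a (∑ k ∈ s, F k * G k) = (∑ k ∈ s, F k * D a (G k)) + ∑ k ∈ s, D a (F k) * G k := by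
        rw [map_sum, ← Finset.sum_add_distrib]
        refine Finset.sum_congr rfl fun k _ => ?_
        rw [Derivation.leibniz, smul_eq_mul, smul_eq_mul]
        ring
      rw [this]
      refine (nsq_add_le D j _ _ x).trans ?_
      gcongr
      · exact ih _ _
      · exact ih _ _
    calc _ ≤ _ := Finset.sum_le_sum fun a _ => h1 a
      _ = 2 * 4 ^ j * ((∑ p ∈ antidiagonal j, f (p.1, p.2 + 1)) +
          ∑ p ∈ antidiagonal j, f (p.1 + 1, p.2)) := by
        have e1 : ∑ a, ∑ p ∈ antidiagonal j, (∑ k ∈ s, nsq D p.1 (F k) x) *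
            ∑ k ∈ s, nsq D p.2 (D a (G k)) x = ∑ p ∈ antidiagonal j, f (p.1, p.2 + 1) := by
          rw [Finset.sum_comm]
          refine Finset.sum_congr rfl fun p _ => ?_
          rw [← Finset.mul_sum, hD]
        have e2 : ∑ a, ∑ p ∈ antidiagonal j, (∑ k ∈ s, nsq D p.1 (D a (F k)) x) *
            ∑ k ∈ s, nsq D p.2 (G k) x = ∑ p ∈ antidiagonal j, f (p.1 + 1, p.2) := by
          rw [Finset.sum_comm]
          refine Finset.sum_congr rfl fun p _ => ?_
          rw [← Finset.sum_mul, hD]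
        rw [← Finset.mul_sum, Finset.sum_add_distrib, ← Finset.mul_sum, ← Finset.mul_sum, e1, e2]
        ring
      -- Each shifted sum is at most the full sum of level j + 1; together with the 2 from
      -- `nsq_add_le` this costs a factor 4 per derivative. No commutation of the derivations is
      -- needed.
      _ ≤ 2 * 4 ^ j * ((∑ p ∈ antidiagonal (j + 1), f p) +
          ∑ p ∈ antidiagonal (j + 1), f p) := by
        gcongr
        · exact sum_antidiagonal_snd_succ_le j f hf
        · exact sum_antidiagonal_fst_succ_le j f hf
      _ = _ := by ring

lemma nsq_mul_le (j : ℕ) (F G : A) (x : X) :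
    nsq D j (F * G) x ≤ 4 ^ j * ∑ p ∈ antidiagonal j, nsq D p.1 F x * nsq D p.2 G x := by
  simpa using nsq_sum_mul_le D (Finset.univ : Finset Unit) j (fun _ => F) (fun _ => G) x

end SquareNorms

/-! ### The derivations D_{kr}, their formal adjoints and their commutators. -/

section Calculus

variable {d n : ℕ}

/-- The algebra of smooth functions of `η ∈ (ℝ^d)^n`. -/
def smoothAlg (d n : ℕ) : Subalgebra ℝ ((Fin n → E d) → ℝ) where
  carrier := {F | ContDiff ℝ ((⊤ : ℕ∞) : WithTop ℕ∞) F}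
  mul_mem' {F G} hF hG := by
    change ContDiff ℝ ((⊤ : ℕ∞) : WithTop ℕ∞) fun x => F x * G x
    exact ContDiff.mul hF hG
  add_mem' {F G} hF hG := by
    change ContDiff ℝ ((⊤ : ℕ∞) : WithTop ℕ∞) fun x => F x + G x
    exact ContDiff.add hF hG
  algebraMap_mem' c := by
    change ContDiff ℝ ((⊤ : ℕ∞) : WithTop ℕ∞) fun _ => c
    exact contDiff_const

lemma contDiff_coe (F : smoothAlg d n) : ContDiff ℝ ((⊤ : ℕ∞) : WithTop ℕ∞) F.1 := F.2

lemma continuous_coe (F : smoothAlg d n) : Continuous F.1 := (contDiff_coe F).continuous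

lemma differentiable_coe (F : smoothAlg d n) : Differentiable ℝ F.1 :=
  (contDiff_coe F).differentiable (by simp)

/-- The canonical basis of `(ℝ^d)^n`. -/
noncomputable def basisVec (a : Idx d n) : Fin n → E d :=
  Pi.single a.1 (EuclideanSpace.single a.2 1)

/-- The partial derivative with respect to `η_{kr}`. -/
noncomputable def partialDer (a : Idx d n) : Derivation ℝ (smoothAlg d n) (smoothAlg d n) :=
  Derivation.mk'
    { toFun := fun F => ⟨fun η => fderiv ℝ F.1 η (basisVec a),
        ((contDiff_coe F).fderiv_right (m := ((⊤ : ℕ∞) : WithTop ℕ∞)) (by simp)).clm_apply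
          contDiff_const⟩
      map_add' := fun F G => by
        ext η
        change fderiv ℝ (F.1 + G.1) η _ = _
        rw [fderiv_add (differentiable_coe F η) (differentiable_coe G η)]
        rfl
      map_smul' := fun c F => by
        ext η
        change fderiv ℝ (c • F.1) η _ = _
        rw [fderiv_const_smul (differentiable_coe F η)]
        rfl }
    (fun F G => by
      ext η
      change fderiv ℝ (F.1 * G.1) η _ = _
      rw [fderiv_mul (differentiable_coe F η) (differentiable_coe G η)]
      rfl)

lemma partialDer_apply (a : Idx d n) (F : smoothAlg d n) (η : Fin n → E d) :
    (partialDer a F).1 η = fderiv ℝ F.1 η (basisVec a) := rfl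

lemma partialDer_comm (a c : Idx d n) (F : smoothAlg d n) :
    partialDer a (partialDer c F) = partialDer c (partialDer a F) := by
  ext η
  have hsymm : IsSymmSndFDerivAt ℝ F.1 η :=
    (contDiff_coe F).contDiffAt.isSymmSndFDerivAt (by
      rw [minSmoothness_of_isRCLikeNormedField]; exact WithTop.coe_le_coe.2 (le_top : (2 : ℕ∞) ≤ ⊤))
  have hd : Differentiable ℝ (fderiv ℝ F.1) :=
    ((contDiff_coe F).fderiv_right (m := ((⊤ : ℕ∞) : WithTop ℕ∞)) (by simp)).differentiable
      (by simp)
  have key : ∀ a c : Idx d n, (partialDer a (partialDer c F)).1 η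
      = fderiv ℝ (fderiv ℝ F.1) η (basisVec a) (basisVec c) := by
    intro a c
    rw [partialDer_apply]
    change fderiv ℝ (fun y => fderiv ℝ F.1 y (basisVec c)) η (basisVec a) = _
    rw [fderiv_clm_apply (hd η) (differentiableAt_const _)]
    simp
  rw [key, key]
  exact hsymm _ _

variable (z : E d) (r t : ℝ)

/-- A smooth function of the single variable `η_k`. -/
def liftCoord (k : Fin n) (g : E d → ℝ) (hg : ContDiff ℝ ((⊤ : ℕ∞) : WithTop ℕ∞) g) :
    smoothAlg d n :=
  ⟨fun η => g (η k), hg.comp (contDiff_apply ℝ (E d) k)⟩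

lemma partialDer_liftCoord (a : Idx d n) (k : Fin n) (g : E d → ℝ)
    (hg : ContDiff ℝ ((⊤ : ℕ∞) : WithTop ℕ∞) g) (η : Fin n → E d) :
    (partialDer a (liftCoord k g hg)).1 η =
      if a.1 = k then fderiv ℝ g (η k) (EuclideanSpace.single a.2 1) else 0 := by
  rw [partialDer_apply]
  change fderiv ℝ (fun η : Fin n → E d => g (η k)) η (basisVec a) = _
  have h1 : HasFDerivAt (fun η : Fin n → E d => g (η k))
      ((fderiv ℝ g (η k)).comp (ContinuousLinearMap.proj k)) η :=
    ((hg.differentiable (by simp)) (η k)).hasFDerivAt.comp η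
      (ContinuousLinearMap.proj (R := ℝ) (φ := fun _ : Fin n => E d) k).hasFDerivAt
  rw [h1.fderiv]
  simp only [ContinuousLinearMap.comp_apply, ContinuousLinearMap.proj_apply, basisVec]
  split_ifs with h
  · subst h; simp
  · rw [Pi.single_eq_of_ne (Ne.symm h)]; simp

lemma contDiff_psi : ContDiff ℝ ((⊤ : ℕ∞) : WithTop ℕ∞) (psi z r) :=
  contDiff_const.sub ((contDiff_id.sub contDiff_const).norm_sq ℝ)

lemma hasFDerivAt_psi (x : E d) :
    HasFDerivAt (psi z r) (-(2 • (innerSL ℝ (x - z)))) x := by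
  have h := ((hasFDerivAt_id (𝕜 := ℝ) x).sub_const z).norm_sq
  have h2 : HasFDerivAt (psi z r) _ x := h.const_sub (r ^ 2)
  refine h2.congr_fderiv ?_
  ext v
  simp

lemma fderiv_psi_single (x : E d) (s : Fin d) :
    fderiv ℝ (psi z r) x (EuclideanSpace.single s 1) = -2 * (x - z) s := by
  rw [(hasFDerivAt_psi z r x).fderiv]
  simp [EuclideanSpace.inner_single_right]

/-- The coefficient `θ ψ(η_k)` of the stochastic gradient. -/
noncomputable def weight (a : Idx d n) : smoothAlg d n :=
  liftCoord a.1 (fun x => t * psi z r x) (contDiff_const.mul (contDiff_psi z r))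

/-- The coordinate derivation `D_{kr} = θ ψ(η_k) ∂/∂η_{kr}`. -/
noncomputable def gradDer (a : Idx d n) : Derivation ℝ (smoothAlg d n) (smoothAlg d n) :=
  weight z r t a • partialDer a

lemma contDiff_coord (s : Fin d) :
    ContDiff ℝ ((⊤ : ℕ∞) : WithTop ℕ∞) (fun x : E d => t * (-2 * (x - z) s)) := by
  refine contDiff_const.mul (contDiff_const.mul ?_)
  exact (EuclideanSpace.proj s : E d →L[ℝ] ℝ).contDiff.comp
    (contDiff_id.sub contDiff_const)

/-- The drift `θ ∂ψ/∂x_r (η_k)` of the integration by parts formula. -/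
noncomputable def drift (a : Idx d n) : smoothAlg d n :=
  liftCoord a.1 (fun x => t * (-2 * (x - z) a.2)) (contDiff_coord z t a.2)

/-- The function `2 θ² ψ(η_k)`. -/
noncomputable def curv (a : Idx d n) : smoothAlg d n :=
  liftCoord a.1 (fun x => (2 * t ^ 2) * psi z r x) (contDiff_const.mul (contDiff_psi z r))

lemma gradDer_apply (a : Idx d n) (F : smoothAlg d n) :
    gradDer z r t a F = weight z r t a * partialDer a F := rfl

lemma weight_congr {a c : Idx d n} (h : a.1 = c.1) : weight z r t a = weight z r t c := by
  unfold weight; rw [h]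

lemma partialDer_weight (a c : Idx d n) :
    partialDer a (weight z r t c) = if a.1 = c.1 then drift z t a else 0 := by
  ext η
  unfold weight
  rw [partialDer_liftCoord]
  have : fderiv ℝ (fun x => t * psi z r x) (η c.1) (EuclideanSpace.single a.2 1)
      = t * (-2 * (η c.1 - z) a.2) := by
    rw [fderiv_const_mul ((contDiff_psi z r).differentiable (by simp) _)]
    simp [fderiv_psi_single]
  split_ifs with h
  · rw [this, ← h]; rfl
  · rfl

/-- Since ψ is quadratic, its Hessian is −2 times the identity. Hence differentiating the drift
produces a single diagonal term, `curv`. -/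
lemma partialDer_drift (a c : Idx d n) :
    partialDer a (drift z t c) = if a = c then algebraMap ℝ _ (-2 * t) else 0 := by
  ext η
  unfold drift
  rw [partialDer_liftCoord]
  have hd : HasFDerivAt (fun x : E d => t * (-2 * (x - z) c.2))
      (t • (-2 : ℝ) • (EuclideanSpace.proj c.2 : E d →L[ℝ] ℝ)) (η c.1) := by
    have h1 := (((EuclideanSpace.proj c.2 : E d →L[ℝ] ℝ)).hasFDerivAt
      (x := η c.1 - z)).comp (η c.1) ((hasFDerivAt_id (𝕜 := ℝ) (η c.1)).sub_const z)
    simpa using (h1.const_mul (-2)).const_mul t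
  rw [hd.fderiv]
  obtain ⟨k, s⟩ := a
  obtain ⟨l, u⟩ := c
  by_cases h : k = l
  · by_cases h' : s = u
    · subst h h'
      simp [mul_comm]
    · simp [h, h', Ne.symm h']
  · simp [h]

lemma gradDer_drift (a c : Idx d n) :
    gradDer z r t a (drift z t c) = if a = c then -curv z r t a else 0 := by
  rw [gradDer_apply, partialDer_drift]
  split_ifs
  · ext η
    change t * psi z r (η a.1) * (-2 * t) = -((2 * t ^ 2) * psi z r (η a.1))
    ring
  · simp

/-- The coefficient of D_{kr} depends on η_k only, so different blocks commute. Within a block the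
two coefficients coincide, the second derivatives of F cancel, and only the derivatives of the
coefficient remain. -/
lemma gradDer_comm (a c : Idx d n) (F : smoothAlg d n) :
    gradDer z r t a (gradDer z r t c F) = gradDer z r t c (gradDer z r t a F) +
      if a.1 = c.1 then drift z t a * gradDer z r t c F - drift z t c * gradDer z r t a F
      else 0 := by
  simp only [gradDer_apply, Derivation.leibniz, smul_eq_mul, partialDer_weight,
    partialDer_comm a c]
  by_cases h : a.1 = c.1
  · rw [if_pos h, if_pos h.symm, if_pos h, weight_congr z r t h]
    ring
  · rw [if_neg h, if_neg (Ne.symm h), if_neg h]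
    ring

/-- The formal adjoint of `D_{kr}`. -/
noncomputable def adj (a : Idx d n) (F : smoothAlg d n) : smoothAlg d n :=
  -(gradDer z r t a F + drift z t a * F)

/-- The divergence, the formal adjoint of the stochastic gradient. -/
noncomputable def diverg (S : Idx d n → smoothAlg d n) : smoothAlg d n :=
  ∑ a, adj z r t a (S a)

/-- The commutator of the stochastic gradient with the divergence. -/
noncomputable def divComm (a : Idx d n) (S : Idx d n → smoothAlg d n) : smoothAlg d n :=
  (∑ s : Fin d, (drift z t (a.1, s) * gradDer z r t a (S (a.1, s)) -
    drift z t a * gradDer z r t (a.1, s) (S (a.1, s)))) + curv z r t a * S a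

/-- The point is that the correction `divComm` involves only the d coordinates of the block of `a`
and at most one derivative of S; a sum over all blocks would make the later constants depend on n.
-/
lemma gradDer_diverg (a : Idx d n) (S : Idx d n → smoothAlg d n) :
    gradDer z r t a (diverg z r t S) =
      diverg z r t (fun c => gradDer z r t a (S c)) + divComm z r t a S := by
  have key : ∀ c, gradDer z r t a (adj z r t c (S c)) = adj z r t c (gradDer z r t a (S c)) +
      ((if a.1 = c.1 then drift z t c * gradDer z r t a (S c) -
        drift z t a * gradDer z r t c (S c) else 0) + if a = c then curv z r t a * S a else 0) := by
    intro c
    unfold adj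
    rw [map_neg, map_add, Derivation.leibniz, gradDer_comm, gradDer_drift]
    by_cases h : a = c
    · subst h; simp only [if_true, smul_eq_mul]; ring
    · by_cases h' : a.1 = c.1
      · simp only [h, h', if_true, if_false, smul_eq_mul]; ring
      · simp only [h, h', if_false, smul_eq_mul]; ring
  unfold diverg divComm
  rw [map_sum, Finset.sum_congr rfl fun c _ => key c, Finset.sum_add_distrib,
    Finset.sum_add_distrib, Fintype.sum_prod_type
      (f := fun c : Idx d n => if a.1 = c.1 then drift z t c * gradDer z r t a (S c) -
        drift z t a * gradDer z r t c (S c) else 0)]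
  congr 2
  · rw [Finset.sum_comm]
    refine Finset.sum_congr rfl fun s _ => ?_
    simp
  · simp

lemma adj_mul (a : Idx d n) (F G : smoothAlg d n) :
    adj z r t a (F * G) = adj z r t a F * G - F * gradDer z r t a G := by
  unfold adj
  rw [Derivation.leibniz, smul_eq_mul, smul_eq_mul]
  ring

lemma diverg_mul (S : Idx d n → smoothAlg d n) (G : smoothAlg d n) :
    diverg z r t S * G = diverg z r t (fun a => S a * G) + ∑ a, S a * gradDer z r t a G := by
  unfold diverg
  simp only [adj_mul, Finset.sum_sub_distrib, Finset.sum_mul]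
  ring

end Calculus

/-! ### Integration by parts on the ball and on its powers. -/

section IntegrationByParts

variable {d : ℕ} (z : E d) (r : ℝ)

/-- Extended by zero outside the ball, ψg is no longer differentiable on the sphere, but it stays
Lipschitz because ψ vanishes there. This is enough for integration by parts on the whole space,
where no boundary appears. -/
lemma exists_lipschitzWith_psi_mul (hr : 0 < r) (g : E d → ℝ)
    (hg : ContDiff ℝ ((⊤ : ℕ∞) : WithTop ℕ∞) g) :
    ∃ C : ℝ≥0, LipschitzWith C (fun x => max (psi z r x) 0 * g x) := by
  have hK : IsCompact (Metric.closedBall z r) := isCompact_closedBall z r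
  obtain ⟨L, hL⟩ := ((hg.of_le (by simp)).locallyLipschitz).locallyLipschitzOn
    (s := Metric.closedBall z r) |>.exists_lipschitzOnWith_of_compact hK
  obtain ⟨M, hM⟩ := hK.exists_bound_of_continuousOn hg.continuous.continuousOn
  have hM0 : 0 ≤ M := (norm_nonneg _).trans (hM z (Metric.mem_closedBall_self hr.le))
  have hin : ∀ x ∈ Metric.closedBall z r, ‖x - z‖ ≤ r := fun x hx => by
    simpa [dist_eq_norm] using hx
  have hout : ∀ x, x ∉ Metric.closedBall z r → max (psi z r x) 0 = 0 := fun x hx => by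
    rw [max_eq_right]
    have : r < ‖x - z‖ := by simpa [dist_eq_norm] using hx
    unfold psi; nlinarith
  -- In this form the positive part of ψ is a function of the 1-Lipschitz quantity min(‖x − z‖, r) ∈
  -- [0, r], hence 2r-Lipschitz.
  have heq : ∀ x, max (psi z r x) 0 = r ^ 2 - (min ‖x - z‖ r) ^ 2 := fun x => by
    unfold psi
    rcases le_total ‖x - z‖ r with h | h
    · rw [min_eq_left h, max_eq_left]; nlinarith [norm_nonneg (x - z)]
    · rw [min_eq_right h, max_eq_right]
      · ring
      · nlinarith
  have hle : ∀ x, |max (psi z r x) 0| ≤ r ^ 2 := fun x => by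
    rw [heq, abs_le]
    have h0 : 0 ≤ min ‖x - z‖ r := le_min (norm_nonneg _) hr.le
    have h1 : min ‖x - z‖ r ≤ r := min_le_right _ _
    constructor <;> nlinarith
  have hlip : ∀ x y, |max (psi z r x) 0 - max (psi z r y) 0| ≤ 2 * r * ‖x - y‖ := fun x y => by
    rw [heq, heq]
    have h0 : ∀ x : E d, 0 ≤ min ‖x - z‖ r := fun x => le_min (norm_nonneg _) hr.le
    have h1 : ∀ x : E d, min ‖x - z‖ r ≤ r := fun x => min_le_right _ _
    have h2 : |min ‖y - z‖ r - min ‖x - z‖ r| ≤ ‖x - y‖ := by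
      refine (abs_min_sub_min_le_max _ _ _ _).trans ?_
      simp only [sub_self, abs_zero, abs_nonneg, sup_of_le_left]
      refine (abs_norm_sub_norm_le _ _).trans_eq ?_
      rw [sub_sub_sub_cancel_right, norm_sub_rev]
    rw [show r ^ 2 - (min ‖x - z‖ r) ^ 2 - (r ^ 2 - (min ‖y - z‖ r) ^ 2)
      = (min ‖y - z‖ r + min ‖x - z‖ r) * (min ‖y - z‖ r - min ‖x - z‖ r) by ring, abs_mul]
    have h3 : |min ‖y - z‖ r + min ‖x - z‖ r| ≤ 2 * r := by
      rw [abs_of_nonneg (add_nonneg (h0 _) (h0 _))]; linarith [h1 x, h1 y]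
    exact mul_le_mul h3 h2 (abs_nonneg _) (by linarith)
  -- With y outside the ball, ψ⁺(x) = ψ⁺(x) − ψ⁺(y) is itself at most 2r‖x − y‖, so no control of g
  -- at y is needed.
  have hone : ∀ x ∈ Metric.closedBall z r, ∀ y ∉ Metric.closedBall z r,
      |max (psi z r x) 0 * g x - max (psi z r y) 0 * g y| ≤ 2 * r * M * ‖x - y‖ := by
    intro x hx y hy
    rw [hout y hy, zero_mul, sub_zero, abs_mul]
    have h1 := hlip x y
    rw [hout y hy, sub_zero] at h1
    calc _ ≤ (2 * r * ‖x - y‖) * M :=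
          mul_le_mul h1 (hM x hx) (abs_nonneg _) (by positivity)
      _ = _ := by ring
  refine ⟨NNReal.mk (2 * r * M + r ^ 2 * L) (by positivity), LipschitzWith.of_dist_le_mul fun x y => ?_⟩
  rw [Real.dist_eq, dist_eq_norm, NNReal.coe_mk]
  have hext : 0 ≤ r ^ 2 * (L : ℝ) * ‖x - y‖ := by positivity
  by_cases hx : x ∈ Metric.closedBall z r <;> by_cases hy : y ∈ Metric.closedBall z r
  · have h2 := hL.dist_le_mul x hx y hy
    rw [Real.dist_eq, dist_eq_norm] at h2
    rw [show max (psi z r x) 0 * g x - max (psi z r y) 0 * g y =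
      (max (psi z r x) 0 - max (psi z r y) 0) * g x + max (psi z r y) 0 * (g x - g y) by ring]
    refine (abs_add_le _ _).trans ?_
    rw [abs_mul, abs_mul]
    have h3 : |max (psi z r x) 0 - max (psi z r y) 0| * |g x| ≤ (2 * r * ‖x - y‖) * M :=
      mul_le_mul (hlip x y) (hM x hx) (abs_nonneg _) (by positivity)
    have h4 : |max (psi z r y) 0| * |g x - g y| ≤ r ^ 2 * (L * ‖x - y‖) :=
      mul_le_mul (hle y) h2 (abs_nonneg _) (by positivity)
    linarith
  · linarith [hone x hx y hy]
  · have := hone y hy x hx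
    rw [abs_sub_comm, norm_sub_rev] at this
    linarith
  · rw [hout x hx, hout y hy]
    simp only [zero_mul, sub_zero, abs_zero]
    positivity

/-- The divergence theorem for a function that vanishes on the boundary. It is obtained on the whole
space from the Lipschitz compactly supported extension. -/
lemma integral_fderiv_psi_mul [hr : Fact (0 < r)] (g : E d → ℝ)
    (hg : ContDiff ℝ ((⊤ : ℕ∞) : WithTop ℕ∞) g) (v : E d) :
    ∫ x, fderiv ℝ (fun y => psi z r y * g y) x v ∂(uniformBall z r) = 0 := by
  obtain ⟨C, hC⟩ := exists_lipschitzWith_psi_mul z r hr.out g hg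
  set G : E d → ℝ := fun x => max (psi z r x) 0 * g x with hG
  have hout : ∀ x, x ∉ Metric.closedBall z r → G x = 0 := fun x hx => by
    have : r < ‖x - z‖ := by simpa [dist_eq_norm] using hx
    have h2 : max (psi z r x) 0 = 0 := by
      rw [max_eq_right]; unfold psi; nlinarith [hr.out]
    simp [hG, h2]
  have hcs : HasCompactSupport G :=
    HasCompactSupport.intro (isCompact_closedBall z r) fun x hx => hout x hx
  -- Integration by parts against the constant function 1, whose derivative is zero.
  have h0 := LipschitzWith.integral_lineDeriv_mul_eq (μ := (volume : Measure (E d)))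
    (LipschitzWith.const (1 : ℝ)) hC hcs (-v)
  have hd0 : ∀ x : E d, lineDeriv ℝ (fun _ : E d => (1 : ℝ)) x (-v) = 0 := fun x => by
    simp [lineDeriv]
  simp only [hd0, zero_mul, integral_zero, mul_one, neg_neg] at h0
  have hae : (fun x => lineDeriv ℝ G x v) =ᵐ[volume]
      (Metric.ball z r).indicator (fun x => fderiv ℝ (fun y => psi z r y * g y) x v) := by
    have hs : volume (Metric.sphere z r) = 0 :=
      Measure.addHaar_sphere_of_ne_zero volume z hr.out.ne'
    have hs' : ∀ᵐ x : E d, x ∉ Metric.sphere z r := measure_eq_zero_iff_ae_notMem.1 hs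
    filter_upwards [hs'] with x hx
    by_cases hxb : x ∈ Metric.ball z r
    · rw [Set.indicator_of_mem hxb]
      have heq : G =ᶠ[𝓝 x] fun y => psi z r y * g y := by
        filter_upwards [Metric.isOpen_ball.mem_nhds hxb] with y hy
        have : ‖y - z‖ < r := by simpa [dist_eq_norm] using hy
        have h2 : max (psi z r y) 0 = psi z r y := by
          rw [max_eq_left]; unfold psi; nlinarith [hr.out, norm_nonneg (y - z)]
        simp [hG, h2]
      rw [heq.lineDeriv_eq]
      exact ((((contDiff_psi z r).mul hg).differentiable (by simp)) x).lineDeriv_eq_fderiv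
    · rw [Set.indicator_of_notMem hxb]
      have hx' : x ∉ Metric.closedBall z r := fun h => by
        rcases (Metric.mem_closedBall.1 h).lt_or_eq with h | h
        · exact hxb h
        · exact hx h
      have heq : G =ᶠ[𝓝 x] fun _ => (0 : ℝ) := by
        filter_upwards [Metric.isClosed_closedBall.isOpen_compl.mem_nhds hx'] with y hy
        exact hout y hy
      rw [heq.lineDeriv_eq]
      simp [lineDeriv]
  unfold uniformBall ProbabilityTheory.cond
  rw [integral_smul_measure, ← integral_indicator Metric.isOpen_ball.measurableSet,
    ← integral_congr_ae hae, ← h0, smul_zero]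

variable (n : ℕ)

/-- The law of `η`: the product of uniform distributions. -/
noncomputable abbrev etaLaw : Measure (Fin n → E d) := Measure.pi fun _ : Fin n => uniformBall z r

/-- The closed set that carries `etaLaw`. -/
def cube : Set (Fin n → E d) := Set.univ.pi fun _ => Metric.closedBall z r

lemma isCompact_cube : IsCompact (cube z r n) :=
  isCompact_univ_pi fun _ => isCompact_closedBall z r

variable {n}

lemma ae_mem_cube [hr : Fact (0 < r)] : ∀ᵐ η ∂(etaLaw z r n), η ∈ cube z r n := by
  have h1 : ∀ᵐ x ∂(uniformBall z r), x ∈ Metric.closedBall z r := by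
    have := ProbabilityTheory.ae_cond_mem (μ := (volume : Measure (E d)))
      (Metric.isOpen_ball (x := z) (ε := r)).measurableSet
    filter_upwards [this] with x hx using Metric.ball_subset_closedBall hx
  have h2 : ∀ k : Fin n, ∀ᵐ η ∂(etaLaw z r n), η k ∈ Metric.closedBall z r := fun k =>
    (measurePreserving_eval (fun _ : Fin n => uniformBall z r) k).quasiMeasurePreserving.ae h1
  filter_upwards [ae_all_iff.2 h2] with η hη k _ using hη k

lemma integrable_of_continuous [hr : Fact (0 < r)] {F : (Fin n → E d) → ℝ} (hF : Continuous F) :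
    Integrable F (etaLaw z r n) := by
  obtain ⟨M, hM⟩ := (isCompact_cube z r n).exists_bound_of_continuousOn hF.continuousOn
  refine Integrable.of_bound hF.aestronglyMeasurable M ?_
  filter_upwards [ae_mem_cube z r] with η hη using hM η hη

/-- The coefficients of the calculus are bounded only on the compact set that carries the law of η,
so pointwise inequalities are required only there. -/
lemma integral_mono_cube [hr : Fact (0 < r)] {F G : (Fin n → E d) → ℝ} (hF : Continuous F)
    (hG : Continuous G) (h : ∀ η ∈ cube z r n, F η ≤ G η) :
    ∫ η, F η ∂(etaLaw z r n) ≤ ∫ η, G η ∂(etaLaw z r n) := by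
  refine integral_mono_ae (integrable_of_continuous z r hF) (integrable_of_continuous z r hG) ?_
  filter_upwards [ae_mem_cube z r] with η hη using h η hη

/-- By Fubini it suffices to integrate over the block `a.1` with the other blocks fixed, where the
one-ball formula applies. -/
lemma integral_partialDer_psi_mul [hr : Fact (0 < r)] (a : Idx d n) (F : smoothAlg d n) :
    ∫ η, fderiv ℝ (fun η : Fin n → E d => psi z r (η a.1) * F.1 η) η (basisVec a)
      ∂(etaLaw z r n) = 0 := by
  obtain ⟨k, s⟩ := a
  cases n with
  | zero => exact k.elim0
  | succ m =>
    have hsm : ContDiff ℝ ((⊤ : ℕ∞) : WithTop ℕ∞)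
        (fun η : Fin (m + 1) → E d => psi z r (η k) * F.1 η) :=
      ((contDiff_psi z r).comp (contDiff_apply ℝ (E d) k)).mul (contDiff_coe F)
    set H : (Fin (m + 1) → E d) → ℝ := fun η => psi z r (η k) * F.1 η with hH
    have hcont : Continuous fun η => fderiv ℝ H η (basisVec (k, s)) :=
      (hsm.continuous_fderiv (by simp)).clm_apply continuous_const
    have hmp := measurePreserving_piFinSuccAbove (fun _ : Fin (m + 1) => uniformBall z r) k
    have hint := integrable_of_continuous z r hcont
    rw [← hmp.symm.integral_comp' (g := fun η => fderiv ℝ H η (basisVec (k, s)))]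
    rw [← hmp.symm.integrable_comp_emb (MeasurableEquiv.measurableEmbedding _)] at hint
    refine (integral_prod_symm _ hint).trans ?_
    -- The inner integral vanishes for every value `y` of the remaining blocks.
    refine integral_eq_zero_of_ae (Eventually.of_forall fun y => ?_)
    simp only [Pi.zero_apply]
    have hins : ∀ x : E d, (MeasurableEquiv.piFinSuccAbove (fun _ : Fin (m + 1) => E d) k).symm
        (x, y) = Function.update (k.insertNth (α := fun _ => E d) 0 y) k x := fun x => by
      rw [Fin.update_insertNth]; rfl
    have hup : ContDiff ℝ ((⊤ : ℕ∞) : WithTop ℕ∞)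
        (fun x : E d => Function.update (k.insertNth (α := fun _ => E d) 0 y) k x) :=
      contDiff_pi.2 fun j => by
        rcases eq_or_ne j k with rfl | hj
        · simpa using! contDiff_id
        · simpa [hj] using contDiff_const
    have hg : ContDiff ℝ ((⊤ : ℕ∞) : WithTop ℕ∞)
        (fun x : E d => F.1 (Function.update (k.insertNth (α := fun _ => E d) 0 y) k x)) :=
      (contDiff_coe F).comp hup
    rw [← integral_fderiv_psi_mul z r _ hg (EuclideanSpace.single s 1)]
    refine integral_congr_ae (Eventually.of_forall fun x => ?_)
    have h1 : HasFDerivAt (fun y' : E d => H (Function.update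
        (k.insertNth (α := fun _ => E d) 0 y) k y')) _ x :=
      ((hsm.differentiable (by simp)) (Function.update (k.insertNth (α := fun _ => E d) 0 y)
        k x)).hasFDerivAt.comp x (hasFDerivAt_update (E := fun _ => E d) _ (i := k) x)
    have h2 : (fun y' : E d => H (Function.update
        (k.insertNth (α := fun _ => E d) 0 y) k y')) = fun y' => psi z r y' *
          F.1 (Function.update (k.insertNth (α := fun _ => E d) 0 y) k y') := by
      ext y'; simp [hH]
    rw [h2] at h1
    refine (congrArg (fun w => fderiv ℝ H w (basisVec (k, s))) (hins x)).trans ?_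
    refine Eq.trans ?_ (congrArg (fun T : E d →L[ℝ] ℝ => T (EuclideanSpace.single s 1))
      h1.fderiv).symm
    simp only [ContinuousLinearMap.comp_apply, basisVec]
    congr 1
    ext j
    rcases eq_or_ne j k with rfl | hj
    · simp
    · simp [hj]

/-- Integration by parts for the stochastic gradient. -/
lemma integral_gradDer [hr : Fact (0 < r)] (t : ℝ) (a : Idx d n) (F : smoothAlg d n) :
    ∫ η, (gradDer z r t a F).1 η ∂(etaLaw z r n) =
      -∫ η, (drift z t a * F : smoothAlg d n).1 η ∂(etaLaw z r n) := by
  have h := integral_partialDer_psi_mul z r a F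
  have h2 : ∀ η : Fin n → E d, t * fderiv ℝ (fun η : Fin n → E d => psi z r (η a.1) * F.1 η) η
      (basisVec a) = (gradDer z r t a F).1 η + (drift z t a * F : smoothAlg d n).1 η := by
    intro η
    -- The Leibniz rule ∂(θψF) = θψ ∂F + θ(∂ψ)F: the drift is the term that comes from the weight.
    have e1 : partialDer a (weight z r t a * F) =
        gradDer z r t a F + drift z t a * F := by
      rw [Derivation.leibniz, partialDer_weight, gradDer_apply, if_pos rfl]
      simp only [smul_eq_mul]; ring
    have e2 := congrArg (fun G : smoothAlg d n => G.1 η) e1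
    simp only [partialDer_apply] at e2
    change fderiv ℝ (fun η : Fin n → E d => t * psi z r (η a.1) * F.1 η) η (basisVec a) = _ at e2
    refine Eq.trans ?_ e2
    have hd : DifferentiableAt ℝ (fun η : Fin n → E d => psi z r (η a.1) * F.1 η) η :=
      ((((contDiff_psi z r).comp (contDiff_apply ℝ (E d) a.1)).mul
        (contDiff_coe F)).differentiable (by simp)) η
    simp_rw [mul_assoc]
    rw [fderiv_const_mul hd]
    simp
  have h3 : ∫ η, ((gradDer z r t a F).1 η + (drift z t a * F : smoothAlg d n).1 η)
      ∂(etaLaw z r n) = 0 := by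
    rw [← integral_congr_ae (Eventually.of_forall h2), integral_const_mul, h, mul_zero]
  rw [integral_add (integrable_of_continuous z r (continuous_coe _))
    (integrable_of_continuous z r (continuous_coe _))] at h3
  linarith

lemma integral_gradDer_mul [hr : Fact (0 < r)] (t : ℝ) (a : Idx d n) (F G : smoothAlg d n) :
    ∫ η, (gradDer z r t a F * G : smoothAlg d n).1 η ∂(etaLaw z r n) =
      ∫ η, (F * adj z r t a G : smoothAlg d n).1 η ∂(etaLaw z r n) := by
  have h := integral_gradDer z r t a (F * G)
  have e1 : gradDer z r t a F * G = gradDer z r t a (F * G) - F * gradDer z r t a G := by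
    rw [Derivation.leibniz]; simp only [smul_eq_mul]; ring
  have e2 : F * adj z r t a G = -(drift z t a * (F * G)) - F * gradDer z r t a G := by
    unfold adj; ring
  have i := fun H : smoothAlg d n => integrable_of_continuous z r (continuous_coe H)
  rw [e1, e2]
  change ∫ η, ((gradDer z r t a (F * G)).1 η - (F * gradDer z r t a G).1 η) ∂(etaLaw z r n) =
    ∫ η, ((-(drift z t a * (F * G)) : smoothAlg d n).1 η - (F * gradDer z r t a G).1 η)
      ∂(etaLaw z r n)
  rw [integral_sub (i _) (i _), integral_sub (i _) (i _), h]
  change _ = ∫ η, -((drift z t a * (F * G)).1 η) ∂(etaLaw z r n) - _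
  rw [integral_neg]

end IntegrationByParts

/-! ### L² bounds for the divergence, uniform in n. -/

section DivergenceEstimates

variable {d n : ℕ} (z : E d) (r t : ℝ)

lemma continuous_nsq (j : ℕ) (F : smoothAlg d n) : Continuous (nsq (gradDer z r t) j F) := by
  induction j generalizing F with
  | zero => exact (continuous_coe F).pow 2
  | succ j ih => exact continuous_finsetSum _ fun a _ => ih _

lemma gradDer_liftCoord (a : Idx d n) (k : Fin n) (g : E d → ℝ)
    (hg : ContDiff ℝ ((⊤ : ℕ∞) : WithTop ℕ∞) g) :
    gradDer z r t a (liftCoord k g hg) = if a.1 = k then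
      t • liftCoord k (fun x => psi z r x * fderiv ℝ g x (EuclideanSpace.single a.2 1))
        ((contDiff_psi z r).mul ((hg.fderiv_right (m := ((⊤ : ℕ∞) : WithTop ℕ∞))
          (by simp)).clm_apply contDiff_const)) else 0 := by
  ext η
  have h1 : (gradDer z r t a (liftCoord k g hg)).1 η =
      t * psi z r (η a.1) * (partialDer a (liftCoord k g hg)).1 η := rfl
  rw [h1, partialDer_liftCoord]
  split_ifs with h
  · subst h
    change _ = t * (psi z r (η a.1) * fderiv ℝ g (η a.1) (EuclideanSpace.single a.2 1))
    ring
  · simp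

/-- A function of one block has nonzero derivatives in d directions only, and these are again θ
times functions of that block. Hence the bound is independent of n, of the block and of θ ∈ [0, 1].
-/
lemma exists_nsq_liftCoord_le (j : ℕ) (g : E d → ℝ)
    (hg : ContDiff ℝ ((⊤ : ℕ∞) : WithTop ℕ∞) g) :
    ∃ C : ℝ, 0 ≤ C ∧ ∀ (n : ℕ) (t : ℝ), 0 ≤ t → t ≤ 1 → ∀ (k : Fin n), ∀ η ∈ cube z r n,
      nsq (gradDer z r t) j (liftCoord k g hg) η ≤ C := by
  induction j generalizing g with
  | zero =>
    obtain ⟨M, hM⟩ := (isCompact_closedBall z r).exists_bound_of_continuousOn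
      hg.continuous.continuousOn
    refine ⟨M ^ 2, sq_nonneg _, fun n t _ _ k η hη => ?_⟩
    have h := hM (η k) (hη k (Set.mem_univ _))
    change g (η k) ^ 2 ≤ M ^ 2
    rw [← sq_abs]
    exact pow_le_pow_left₀ (abs_nonneg _) h 2
  | succ j ih =>
    choose C hC0 hC using fun s : Fin d => ih
      (fun x => psi z r x * fderiv ℝ g x (EuclideanSpace.single s 1))
      ((contDiff_psi z r).mul ((hg.fderiv_right (m := ((⊤ : ℕ∞) : WithTop ℕ∞))
          (by simp)).clm_apply contDiff_const))
    refine ⟨∑ s, C s, Finset.sum_nonneg fun s _ => hC0 s, fun n t h0 h1 k η hη => ?_⟩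
    rw [nsq_succ, Fintype.sum_prod_type, Finset.sum_comm]
    refine Finset.sum_le_sum fun s _ => ?_
    -- The sum over the n blocks collapses to the block on which the function depends.
    rw [Finset.sum_eq_single k]
    · rw [gradDer_liftCoord, if_pos rfl, nsq_smul]
      have h2 := hC s n t h0 h1 k η hη
      have h3 : t ^ 2 ≤ 1 := pow_le_one₀ h0 h1
      have h4 := nsq_nonneg (gradDer z r t) j (liftCoord k _ ((contDiff_psi z r).mul
        ((hg.fderiv_right (m := ((⊤ : ℕ∞) : WithTop ℕ∞)) (by simp)).clm_apply
          (contDiff_const (c := EuclideanSpace.single s 1))))) η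
      nlinarith
    · intro l _ hl
      rw [gradDer_liftCoord, if_neg hl, nsq_map_zero]
    · simp

lemma exists_nsq_coeff_le (j : ℕ) :
    ∃ C : ℝ, 0 ≤ C ∧ ∀ (n : ℕ) (t : ℝ), 0 ≤ t → t ≤ 1 → ∀ (a : Idx d n), ∀ i ≤ j,
      ∀ η ∈ cube z r n, nsq (gradDer z r t) i (drift z t a) η ≤ C ∧
        nsq (gradDer z r t) i (curv z r t a) η ≤ C := by
  choose B hB0 hB using fun (i : ℕ) (s : Fin d) =>
    exists_nsq_liftCoord_le z r i _ (contDiff_coord z 1 s)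
  choose B' hB0' hB' using fun i : ℕ => exists_nsq_liftCoord_le z r i _ (contDiff_psi z r)
  -- The sum over s covers the drifts in all d directions; the 4 bounds (2θ²)², the square of the
  -- factor in front of ψ in `curv`.
  have hp : ∀ i, 0 ≤ (∑ s, B i s) + 4 * B' i := fun i =>
    add_nonneg (Finset.sum_nonneg fun s _ => hB0 i s) (mul_nonneg (by norm_num) (hB0' i))
  refine ⟨∑ i ∈ Finset.range (j + 1), ((∑ s, B i s) + 4 * B' i),
    Finset.sum_nonneg fun i _ => hp i, fun n t h0 h1 a i hi η hη => ?_⟩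
  have hmem : (∑ s, B i s) + 4 * B' i ≤
      ∑ i ∈ Finset.range (j + 1), ((∑ s, B i s) + 4 * B' i) :=
    Finset.single_le_sum (f := fun i => (∑ s, B i s) + 4 * B' i) (fun i _ => hp i)
      (Finset.mem_range.2 (by omega))
  have ht2 : t ^ 2 ≤ 1 := pow_le_one₀ h0 h1
  have hsB : B i a.2 ≤ ∑ s, B i s :=
    Finset.single_le_sum (f := fun s => B i s) (fun s _ => hB0 i s) (Finset.mem_univ _)
  have hs0 : 0 ≤ ∑ s, B i s := Finset.sum_nonneg fun s _ => hB0 i s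
  constructor
  · have e : drift z t a = t • liftCoord a.1 _ (contDiff_coord z 1 a.2) := by
      ext η
      change t * (-2 * (η a.1 - z) a.2) = t * (1 * (-2 * (η a.1 - z) a.2))
      ring
    rw [e, nsq_smul]
    have h2 := hB i a.2 n t h0 h1 a.1 η hη
    have h3 := nsq_nonneg (gradDer z r t) i (liftCoord a.1 _ (contDiff_coord z 1 a.2)) η
    have h4 := hB0' i
    nlinarith
  · have e : curv z r t a = (2 * t ^ 2) • liftCoord a.1 _ (contDiff_psi z r) := by
      ext η
      rfl
    rw [e, nsq_smul]
    have h2 := hB' i n t h0 h1 a.1 η hη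
    have h3 := nsq_nonneg (gradDer z r t) i (liftCoord a.1 _ (contDiff_psi z r)) η
    have h4 : (2 * t ^ 2) ^ 2 ≤ 4 := by nlinarith [sq_nonneg t]
    have h5 : (2 * t ^ 2) ^ 2 * nsq (gradDer z r t) i (liftCoord a.1 _ (contDiff_psi z r)) η ≤
      4 * B' i := mul_le_mul h4 h2 h3 (by norm_num)
    linarith

lemma sum_antidiagonal_snd (j : ℕ) (f : ℕ → ℝ) :
    ∑ p ∈ antidiagonal j, f p.2 = ∑ i ∈ Finset.range (j + 1), f i := by
  rw [← Finset.Nat.sum_antidiagonal_swap]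
  exact Finset.Nat.sum_antidiagonal_eq_sum_range_succ (fun i _ => f i) j

/-- Multiplication by a function whose derivatives are bounded. -/
lemma nsq_mul_le_of_bound (j : ℕ) (B : ℝ) (F G : smoothAlg d n) (η : Fin n → E d)
    (hB : ∀ i ≤ j, nsq (gradDer z r t) i F η ≤ B) :
    nsq (gradDer z r t) j (F * G) η ≤
      4 ^ j * B * ∑ i ∈ Finset.range (j + 1), nsq (gradDer z r t) i G η := by
  refine (nsq_mul_le _ j F G η).trans ?_
  rw [mul_assoc]
  gcongr
  rw [Finset.mul_sum, ← sum_antidiagonal_snd j (fun i => B * nsq (gradDer z r t) i G η)]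
  refine Finset.sum_le_sum fun p hp => ?_
  have := Finset.HasAntidiagonal.mem_antidiagonal.1 hp
  exact mul_le_mul_of_nonneg_right (hB _ (by omega)) (nsq_nonneg _ _ _ _)

/-- `∑_{i ≤ m} ∑_c |D^i S_c|²`. -/
noncomputable def famSq (m : ℕ) (S : Idx d n → smoothAlg d n) (η : Fin n → E d) : ℝ :=
  ∑ i ∈ Finset.range (m + 1), ∑ c, nsq (gradDer z r t) i (S c) η

lemma famSq_eq (m : ℕ) (S : Idx d n → smoothAlg d n) (η : Fin n → E d) :
    famSq z r t m S η = ∑ c, ∑ i ∈ Finset.range (m + 1), nsq (gradDer z r t) i (S c) η :=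
  Finset.sum_comm

lemma sum_sum_nsq_gradDer_le (m : ℕ) (S : Idx d n → smoothAlg d n) (η : Fin n → E d) :
    ∑ i ∈ Finset.range (m + 1), ∑ c, ∑ a, nsq (gradDer z r t) i (gradDer z r t a (S c)) η ≤
      famSq z r t (m + 1) S η := by
  unfold famSq
  rw [Finset.sum_range_succ' _ (m + 1)]
  simp only [← nsq_succ]
  linarith [Finset.sum_nonneg fun (c : Idx d n) (_ : c ∈ Finset.univ) =>
    nsq_nonneg (gradDer z r t) 0 (S c) η]

/-- The commutator is of order one in S with bounded coefficients. Summing it over all `a` stays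
bounded by the full norms of S because each commutator runs over one block. -/
lemma exists_sum_nsq_divComm_le (j : ℕ) :
    ∃ C : ℝ, 0 ≤ C ∧ ∀ (n : ℕ) (t : ℝ), 0 ≤ t → t ≤ 1 → ∀ (S : Idx d n → smoothAlg d n),
      ∀ η ∈ cube z r n,
      ∑ a, nsq (gradDer z r t) j (divComm z r t a S) η ≤ C * famSq z r t (j + 1) S η := by
  obtain ⟨B, hB0, hB⟩ := exists_nsq_coeff_le z r j
  set K : ℝ := 4 ^ j * B with hK
  have hK0 : 0 ≤ K := by positivity
  refine ⟨2 * (d * (2 * K + 2 * d * K) + K), by positivity, fun n t h0 h1 S η hη => ?_⟩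
  set N : smoothAlg d n → ℝ := fun F => ∑ i ∈ Finset.range (j + 1), nsq (gradDer z r t) i F η
    with hN
  have hN0 : ∀ F, 0 ≤ N F := fun F => Finset.sum_nonneg fun _ _ => nsq_nonneg _ _ _ _
  have hdr : ∀ a F, nsq (gradDer z r t) j (drift z t a * F) η ≤ K * N F := fun a F =>
    nsq_mul_le_of_bound z r t j B _ F η fun i hi => (hB n t h0 h1 a i hi η hη).1
  have hcu : ∀ a F, nsq (gradDer z r t) j (curv z r t a * F) η ≤ K * N F := fun a F =>
    nsq_mul_le_of_bound z r t j B _ F η fun i hi => (hB n t h0 h1 a i hi η hη).2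
  have hfull : ∑ c, ∑ a, N (gradDer z r t a (S c)) ≤ famSq z r t (j + 1) S η := by
    refine le_trans (le_of_eq ?_) (sum_sum_nsq_gradDer_le z r t j S η)
    simp only [hN]
    rw [Finset.sum_comm]
    simp_rw [Finset.sum_comm (s := Finset.univ) (t := Finset.range (j + 1))]
    refine Finset.sum_congr rfl fun i _ => Finset.sum_comm
  have hpt : ∀ a : Idx d n, nsq (gradDer z r t) j (divComm z r t a S) η ≤
      2 * (d * ∑ s : Fin d, 2 * (K * N (gradDer z r t a (S (a.1, s))) +
        K * N (gradDer z r t (a.1, s) (S (a.1, s)))) + K * N (S a)) := by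
    intro a
    unfold divComm
    refine (nsq_add_le _ j _ _ η).trans ?_
    gcongr
    · refine (nsq_sum_le _ _ j _ η).trans ?_
      rw [Finset.card_univ, Fintype.card_fin]
      gcongr with s
      refine (nsq_sub_le _ j _ _ η).trans ?_
      gcongr
      · exact hdr _ _
      · exact hdr _ _
    · exact hcu _ _
  have h3 : ∑ a, N (S a) ≤ famSq z r t (j + 1) S η := by
    rw [famSq_eq]
    refine Finset.sum_le_sum fun c _ => ?_
    exact Finset.sum_le_sum_of_subset_of_nonneg (Finset.range_mono (by omega))
      fun _ _ _ => nsq_nonneg _ _ _ _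
  -- The pairs (a, c) with c in the block of a form a subset of all pairs, and the sum over all
  -- pairs is part of the norm of DS.
  have h4 : ∑ a : Idx d n, ∑ s : Fin d, N (gradDer z r t a (S (a.1, s))) ≤
      famSq z r t (j + 1) S η := by
    refine le_trans ?_ hfull
    rw [Finset.sum_comm (s := (Finset.univ : Finset (Idx d n)))
      (t := (Finset.univ : Finset (Idx d n))), Fintype.sum_prod_type, Fintype.sum_prod_type]
    refine Finset.sum_le_sum fun k _ => Finset.sum_le_sum fun u _ => ?_
    rw [Fintype.sum_prod_type]
    exact Finset.single_le_sum (f := fun l => ∑ s, N (gradDer z r t (k, u) (S (l, s))))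
      (fun l _ => Finset.sum_nonneg fun s _ => hN0 _) (Finset.mem_univ k)
  -- The summand depends on a only through its block, so each diagonal term is counted d times.
  have h5 : ∑ a : Idx d n, ∑ s : Fin d, N (gradDer z r t (a.1, s) (S (a.1, s))) ≤
      d * famSq z r t (j + 1) S η := by
    rw [Fintype.sum_prod_type]
    simp only [Finset.sum_const, Finset.card_univ, Fintype.card_fin, nsmul_eq_mul]
    rw [← Finset.mul_sum]
    gcongr
    refine le_trans ?_ hfull
    rw [← Fintype.sum_prod_type (f := fun a : Idx d n => N (gradDer z r t a (S a)))]
    refine Finset.sum_le_sum fun a _ => ?_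
    exact Finset.single_le_sum (f := fun c => N (gradDer z r t c (S a))) (fun _ _ => hN0 _)
      (Finset.mem_univ a)
  calc _ ≤ _ := Finset.sum_le_sum fun a _ => hpt a
    _ = 2 * (d * (2 * K * ∑ a : Idx d n, ∑ s : Fin d, N (gradDer z r t a (S (a.1, s))) +
        2 * K * ∑ a : Idx d n, ∑ s : Fin d, N (gradDer z r t (a.1, s) (S (a.1, s)))) +
        K * ∑ a, N (S a)) := by
      simp only [← Finset.mul_sum, Finset.sum_add_distrib]
      ring
    _ ≤ 2 * (d * (2 * K * famSq z r t (j + 1) S η + 2 * K * (d * famSq z r t (j + 1) S η)) +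
        K * famSq z r t (j + 1) S η) := by gcongr
    _ = _ := by ring

/-- Integration with respect to the law of `η`, as a linear functional. -/
noncomputable def expect (n : ℕ) [Fact (0 < r)] : smoothAlg d n →ₗ[ℝ] ℝ where
  toFun F := ∫ η, F.1 η ∂(etaLaw z r n)
  map_add' F G := integral_add (integrable_of_continuous z r (continuous_coe F))
    (integrable_of_continuous z r (continuous_coe G))
  map_smul' c F := integral_const_mul c F.1

lemma expect_apply [Fact (0 < r)] (F : smoothAlg d n) :
    expect z r n F = ∫ η, F.1 η ∂(etaLaw z r n) := rfl

lemma expect_diverg_mul [Fact (0 < r)] (S : Idx d n → smoothAlg d n) (G : smoothAlg d n) :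
    expect z r n (diverg z r t S * G) = expect z r n (∑ a, S a * gradDer z r t a G) := by
  unfold diverg
  rw [Finset.sum_mul, map_sum, map_sum]
  refine Finset.sum_congr rfl fun a _ => ?_
  rw [mul_comm (adj z r t a (S a)), mul_comm (S a)]
  exact (integral_gradDer_mul z r t a G (S a)).symm

lemma coe_sum (κ : Type*) (s : Finset κ) (F : κ → smoothAlg d n) (η : Fin n → E d) :
    (∑ k ∈ s, F k).1 η = ∑ k ∈ s, (F k).1 η := by
  rw [AddSubmonoidClass.coe_finsetSum, Finset.sum_apply]

lemma coe_mul (F G : smoothAlg d n) (η : Fin n → E d) : (F * G).1 η = F.1 η * G.1 η := rfl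

/-- Duality gives E δ(S)² = E⟨S, Dδ(S)⟩. Commuting D with δ and integrating by parts again yields E
∑ D_aS_c D_cS_a plus a commutator term. The first sum is at most E|DS|² and the second is controlled
by `exists_sum_nsq_divComm_le`. -/
lemma exists_integral_diverg_sq_le [Fact (0 < r)] :
    ∃ C : ℝ, 0 ≤ C ∧ ∀ (n : ℕ) (t : ℝ), 0 ≤ t → t ≤ 1 → ∀ (S : Idx d n → smoothAlg d n),
      ∫ η, (diverg z r t S).1 η ^ 2 ∂(etaLaw z r n) ≤
        C * ∫ η, famSq z r t 1 S η ∂(etaLaw z r n) := by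
  obtain ⟨C, hC0, hC⟩ := exists_sum_nsq_divComm_le z r 0
  -- One unit comes from the products D_aS_c D_cS_a, and C + 1 from the commutator paired with S.
  refine ⟨2 + C, by positivity, fun n t h0 h1 S => ?_⟩
  have hcf : Continuous (famSq z r t 1 S) :=
    continuous_finsetSum _ fun i _ => continuous_finsetSum _ fun c _ => continuous_nsq z r t i _
  have e1 : ∫ η, (diverg z r t S).1 η ^ 2 ∂(etaLaw z r n) =
      expect z r n (diverg z r t S * diverg z r t S) := by
    rw [expect_apply]; simp only [coe_mul, pow_two]
  have e2 : expect z r n (diverg z r t S * diverg z r t S) =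
      expect z r n ((∑ a, ∑ c, gradDer z r t a (S c) * gradDer z r t c (S a)) +
        ∑ a, divComm z r t a S * S a) := by
    rw [expect_diverg_mul]
    simp only [gradDer_diverg, mul_add, Finset.sum_add_distrib, map_add]
    congr 1
    · rw [map_sum, map_sum]
      refine Finset.sum_congr rfl fun a _ => ?_
      -- The second integration by parts, moving δ from D_aS onto S_a.
      rw [mul_comm, expect_diverg_mul]
    · simp only [mul_comm]
  rw [e1, e2, expect_apply, ← integral_const_mul]
  refine integral_mono_cube z r (continuous_coe _) (continuous_const.mul hcf) fun η hη => ?_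
  have h2 : ∑ a, ∑ c, (gradDer z r t a (S c)).1 η * (gradDer z r t c (S a)).1 η ≤
      famSq z r t 1 S η := by
    have h3 : ∑ c, nsq (gradDer z r t) 1 (S c) η ≤ famSq z r t 1 S η := by
      refine Finset.single_le_sum (f := fun i => ∑ c, nsq (gradDer z r t) i (S c) η)
        (fun i _ => Finset.sum_nonneg fun c _ => nsq_nonneg _ _ _ _) (Finset.mem_range.2 ?_)
      omega
    refine le_trans ?_ h3
    have h4 : ∑ a, ∑ c, (gradDer z r t a (S c)).1 η * (gradDer z r t c (S a)).1 η ≤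
        ∑ a, ∑ c, ((gradDer z r t a (S c)).1 η ^ 2 + (gradDer z r t c (S a)).1 η ^ 2) / 2 := by
      refine Finset.sum_le_sum fun a _ => Finset.sum_le_sum fun c _ => ?_
      nlinarith [sq_nonneg ((gradDer z r t a (S c)).1 η - (gradDer z r t c (S a)).1 η)]
    refine h4.trans (le_of_eq ?_)
    simp only [← Finset.sum_div, Finset.sum_add_distrib, nsq_succ, nsq_zero]
    rw [Finset.sum_comm (f := fun a c => (gradDer z r t c (S a)).1 η ^ 2)]
    rw [Finset.sum_comm]
    ring
  have h5 : ∑ a, (divComm z r t a S).1 η * (S a).1 η ≤ (C + 1) * famSq z r t 1 S η := by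
    have h6 := hC n t h0 h1 S η hη
    have h7 : ∑ c, nsq (gradDer z r t) 0 (S c) η ≤ famSq z r t 1 S η := by
      refine Finset.single_le_sum (f := fun i => ∑ c, nsq (gradDer z r t) i (S c) η)
        (fun i _ => Finset.sum_nonneg fun c _ => nsq_nonneg _ _ _ _) (Finset.mem_range.2 ?_)
      omega
    have h8 : ∑ a, (divComm z r t a S).1 η * (S a).1 η ≤
        ∑ a, (nsq (gradDer z r t) 0 (divComm z r t a S) η + nsq (gradDer z r t) 0 (S a) η) := by
      refine Finset.sum_le_sum fun a _ => ?_
      simp only [nsq_zero]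
      nlinarith [sq_nonneg ((divComm z r t a S).1 η - (S a).1 η),
        sq_nonneg ((divComm z r t a S).1 η), sq_nonneg ((S a).1 η)]
    rw [Finset.sum_add_distrib] at h8
    simp only [zero_add] at h6
    linarith
  change (∑ a, ∑ c, gradDer z r t a (S c) * gradDer z r t c (S a)).1 η +
    (∑ a, divComm z r t a S * S a).1 η ≤ _
  simp only [coe_sum, coe_mul]
  linarith

end DivergenceEstimates

/-! ### Weighted L² bounds for derivatives of a divergence. -/

section IteratedDivergence

variable {d n : ℕ} (z : E d) (r t : ℝ)

lemma integral_le_lin_comb [Fact (0 < r)] {F U V : (Fin n → E d) → ℝ} (c e : ℝ)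
    (hF : Continuous F) (hU : Continuous U) (hV : Continuous V)
    (h : ∀ η ∈ cube z r n, F η ≤ c * U η + e * V η) :
    ∫ η, F η ∂(etaLaw z r n) ≤
      c * ∫ η, U η ∂(etaLaw z r n) + e * ∫ η, V η ∂(etaLaw z r n) := by
  have hU' : Continuous fun η => c * U η := continuous_const.mul hU
  have hV' : Continuous fun η => e * V η := continuous_const.mul hV
  have hUV : Continuous fun η => c * U η + e * V η := hU'.add hV'
  refine (integral_mono_cube z r hF hUV h).trans (le_of_eq ?_)
  rw [integral_add (integrable_of_continuous z r hU') (integrable_of_continuous z r hV'),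
    integral_const_mul, integral_const_mul]

/-- `∑_{p + q = m} (∑_c |D^p S_c|²) |D^q G|²`. -/
noncomputable def prodSq (m : ℕ) (S : Idx d n → smoothAlg d n) (G : smoothAlg d n)
    (η : Fin n → E d) : ℝ :=
  ∑ p ∈ antidiagonal m, (∑ c, nsq (gradDer z r t) p.1 (S c) η) * nsq (gradDer z r t) p.2 G η

lemma sum_nsq_nonneg (i : ℕ) (S : Idx d n → smoothAlg d n) (η : Fin n → E d) :
    0 ≤ ∑ c, nsq (gradDer z r t) i (S c) η :=
  Finset.sum_nonneg fun _ _ => nsq_nonneg _ _ _ _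

lemma prodSq_nonneg (m : ℕ) (S : Idx d n → smoothAlg d n) (G : smoothAlg d n)
    (η : Fin n → E d) : 0 ≤ prodSq z r t m S G η :=
  Finset.sum_nonneg fun _ _ => mul_nonneg (sum_nsq_nonneg z r t _ _ _) (nsq_nonneg _ _ _ _)

lemma continuous_prodSq (m : ℕ) (S : Idx d n → smoothAlg d n) (G : smoothAlg d n) :
    Continuous (prodSq z r t m S G) :=
  continuous_finsetSum _ fun _ _ =>
    (continuous_finsetSum _ fun _ _ => continuous_nsq z r t _ _).mul (continuous_nsq z r t _ _)

lemma sum_nsq_mul_le (m : ℕ) (S : Idx d n → smoothAlg d n) (G : smoothAlg d n)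
    (η : Fin n → E d) :
    ∑ c, nsq (gradDer z r t) m (S c * G) η ≤ 4 ^ m * prodSq z r t m S G η := by
  refine (Finset.sum_le_sum fun c _ => nsq_mul_le _ m (S c) G η).trans (le_of_eq ?_)
  unfold prodSq
  rw [← Finset.mul_sum, Finset.sum_comm]
  simp only [Finset.sum_mul]

lemma mul_le_prodSq (p q m : ℕ) (h : p + q = m) (S : Idx d n → smoothAlg d n)
    (G : smoothAlg d n) (η : Fin n → E d) :
    (∑ c, nsq (gradDer z r t) p (S c) η) * nsq (gradDer z r t) q G η ≤ prodSq z r t m S G η :=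
  Finset.single_le_sum (f := fun p : ℕ × ℕ => (∑ c, nsq (gradDer z r t) p.1 (S c) η) *
    nsq (gradDer z r t) p.2 G η)
    (fun _ _ => mul_nonneg (sum_nsq_nonneg z r t _ _ _) (nsq_nonneg _ _ _ _))
    (a := (p, q)) (Finset.HasAntidiagonal.mem_antidiagonal.2 h)

lemma prodSq_le_sum {i m : ℕ} (h : i < m) (S : Idx d n → smoothAlg d n)
    (G : smoothAlg d n) (η : Fin n → E d) :
    prodSq z r t i S G η ≤ ∑ i ∈ Finset.range m, prodSq z r t i S G η :=
  Finset.single_le_sum (f := fun i => prodSq z r t i S G η)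
    (fun _ _ => prodSq_nonneg z r t _ _ _ _) (Finset.mem_range.2 h)

lemma sum_prodSq_gradDer_le (m : ℕ) (S : Idx d n → smoothAlg d n) (G : smoothAlg d n)
    (η : Fin n → E d) :
    ∑ a, prodSq z r t m (fun c => gradDer z r t a (S c)) G η ≤ prodSq z r t (m + 1) S G η := by
  have h := sum_antidiagonal_fst_succ_le m (fun p : ℕ × ℕ =>
    (∑ c, nsq (gradDer z r t) p.1 (S c) η) * nsq (gradDer z r t) p.2 G η)
    fun p => mul_nonneg (sum_nsq_nonneg z r t _ _ _) (nsq_nonneg _ _ _ _)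
  refine le_trans (le_of_eq ?_) h
  unfold prodSq
  rw [Finset.sum_comm]
  refine Finset.sum_congr rfl fun p _ => ?_
  rw [← Finset.sum_mul, Finset.sum_comm]
  rfl

/-- The weighted `L²` bound for the derivatives of a divergence. -/
lemma exists_integral_nsq_diverg_mul_sq_le [Fact (0 < r)] (j : ℕ) :
    ∃ C : ℝ, 0 ≤ C ∧ ∀ (n : ℕ) (t : ℝ), 0 ≤ t → t ≤ 1 →
      ∀ (S : Idx d n → smoothAlg d n) (G : smoothAlg d n),
      ∫ η, nsq (gradDer z r t) j (diverg z r t S) η * G.1 η ^ 2 ∂(etaLaw z r n) ≤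
        C * ∫ η, ∑ m ∈ Finset.range (j + 2), prodSq z r t m S G η ∂(etaLaw z r n) := by
  -- The weight G² is arbitrary in the statement because later it will itself carry products of
  -- derivatives. The order m runs up to j + 1: δ costs one derivative, and derivatives may fall on
  -- S or on G.
  induction j with
  | zero =>
    obtain ⟨C, hC0, hC⟩ := exists_integral_diverg_sq_le z r
    refine ⟨2 * (4 * C) + 2, by positivity, fun n t h0 h1 S G => ?_⟩
    have hcP : Continuous fun η => ∑ m ∈ Finset.range (0 + 2), prodSq z r t m S G η :=
      continuous_finsetSum _ fun _ _ => continuous_prodSq z r t _ S G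
    have h2 : ∀ η, nsq (gradDer z r t) 0 (diverg z r t S) η * G.1 η ^ 2 ≤
        2 * (diverg z r t fun a => S a * G).1 η ^ 2 +
          2 * (∑ m ∈ Finset.range (0 + 2), prodSq z r t m S G η) := fun η => by
      -- The weight is absorbed by δ(S)G = δ(SG) + ⟨S, DG⟩, which reduces j = 0 to the unweighted
      -- bound for the field SG.
      have e1 := congrArg (fun F : smoothAlg d n => F.1 η) (diverg_mul z r t S G)
      change (diverg z r t S).1 η * G.1 η = (diverg z r t fun a => S a * G).1 η +
        (∑ a, S a * gradDer z r t a G).1 η at e1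
      have e2 : (∑ a, S a * gradDer z r t a G).1 η ^ 2 ≤ prodSq z r t 1 S G η := by
        rw [coe_sum]
        refine (Finset.sum_mul_sq_le_sq_mul_sq Finset.univ _ _).trans ?_
        exact mul_le_prodSq z r t 0 1 1 rfl S G η
      have e3 := prodSq_le_sum z r t (show 1 < 0 + 2 by norm_num) S G η
      rw [nsq_zero, ← mul_pow, e1]
      nlinarith [sq_nonneg ((diverg z r t fun a => S a * G).1 η -
        (∑ a, S a * gradDer z r t a G).1 η)]
    have h3 : ∀ η, famSq z r t 1 (fun a => S a * G) η ≤
        4 * ∑ m ∈ Finset.range (0 + 2), prodSq z r t m S G η := fun η => by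
      unfold famSq
      rw [Finset.mul_sum]
      refine Finset.sum_le_sum fun i hi => (sum_nsq_mul_le z r t i S G η).trans ?_
      have hi' := Finset.mem_range.1 hi
      refine mul_le_mul_of_nonneg_right ?_ (prodSq_nonneg z r t _ _ _ _)
      calc (4 : ℝ) ^ i ≤ 4 ^ 1 := pow_le_pow_right₀ (by norm_num) (by omega)
        _ = 4 := by norm_num
    have hcf : Continuous (famSq z r t 1 fun a => S a * G) :=
      continuous_finsetSum _ fun i _ => continuous_finsetSum _ fun c _ => continuous_nsq z r t i _
    have h4 := integral_le_lin_comb z r 4 0 hcf hcP hcP fun η _ => by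
      simpa using h3 η
    have h5 := hC n t h0 h1 fun a => S a * G
    have hcd : Continuous fun η => (diverg z r t fun a => S a * G).1 η ^ 2 :=
      (continuous_coe _).pow 2
    have hcl : Continuous fun η => nsq (gradDer z r t) 0 (diverg z r t S) η * G.1 η ^ 2 :=
      (continuous_nsq z r t 0 _).mul ((continuous_coe G).pow 2)
    have h6 := integral_le_lin_comb z r 2 2 hcl hcd hcP fun η _ => h2 η
    refine h6.trans ?_
    have h7 := mul_le_mul_of_nonneg_left h4 hC0
    linarith
  | succ j ih =>
    obtain ⟨C, hC0, hC⟩ := ih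
    obtain ⟨B, hB0, hB⟩ := exists_sum_nsq_divComm_le z r j
    refine ⟨2 * C + 2 * B, by positivity, fun n t h0 h1 S G => ?_⟩
    set P : ℕ → (Idx d n → smoothAlg d n) → (Fin n → E d) → ℝ :=
      fun m S η => ∑ m ∈ Finset.range m, prodSq z r t m S G η with hP
    have hcP : ∀ m S, Continuous (P m S) := fun m S =>
      continuous_finsetSum _ fun _ _ => continuous_prodSq z r t _ S G
    have hcQ : ∀ F : smoothAlg d n, Continuous fun η => nsq (gradDer z r t) j F η * G.1 η ^ 2 :=
      fun F => (continuous_nsq z r t j _).mul ((continuous_coe G).pow 2)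
    have hcd : Continuous fun η => ∑ a,
        nsq (gradDer z r t) j (diverg z r t fun c => gradDer z r t a (S c)) η * G.1 η ^ 2 :=
      continuous_finsetSum _ fun a _ => hcQ _
    have h2 : ∀ η ∈ cube z r n, nsq (gradDer z r t) (j + 1) (diverg z r t S) η * G.1 η ^ 2 ≤
        2 * (∑ a, nsq (gradDer z r t) j (diverg z r t fun c => gradDer z r t a (S c)) η *
          G.1 η ^ 2) + 2 * B * P (j + 1 + 2) S η := fun η hη => by
      -- D_aδ(S) is δ(D_aS) plus a commutator, so the induction hypothesis applies to the fields
      -- D_aS with the same G.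
      have e1 : nsq (gradDer z r t) (j + 1) (diverg z r t S) η ≤
          2 * ((∑ a, nsq (gradDer z r t) j (diverg z r t fun c => gradDer z r t a (S c)) η) +
            B * famSq z r t (j + 1) S η) := by
        rw [nsq_succ]
        calc _ ≤ ∑ a, 2 * (nsq (gradDer z r t) j
              (diverg z r t fun c => gradDer z r t a (S c)) η +
              nsq (gradDer z r t) j (divComm z r t a S) η) := Finset.sum_le_sum fun a _ => by
                rw [gradDer_diverg]; exact nsq_add_le _ _ _ _ _
          _ = 2 * ((∑ a, nsq (gradDer z r t) j
              (diverg z r t fun c => gradDer z r t a (S c)) η) +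
              ∑ a, nsq (gradDer z r t) j (divComm z r t a S) η) := by
                rw [← Finset.mul_sum, Finset.sum_add_distrib]
          _ ≤ _ := by gcongr; exact hB n t h0 h1 S η hη
      have e2 : famSq z r t (j + 1) S η * G.1 η ^ 2 ≤ P (j + 1 + 2) S η := by
        unfold famSq
        rw [hP, Finset.sum_mul]
        refine (Finset.sum_le_sum fun i _ => mul_le_prodSq z r t i 0 i rfl S G η).trans ?_
        exact Finset.sum_le_sum_of_subset_of_nonneg (Finset.range_mono (by omega))
          fun _ _ _ => prodSq_nonneg z r t _ _ _ _
      refine (mul_le_mul_of_nonneg_right e1 (sq_nonneg _)).trans ?_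
      rw [← Finset.sum_mul]
      have e3 := mul_le_mul_of_nonneg_left e2 hB0
      linarith
    have h3 : ∀ η, ∑ a, P (j + 2) (fun c => gradDer z r t a (S c)) η ≤ P (j + 1 + 2) S η :=
        fun η => by
      simp only [hP]
      rw [Finset.sum_comm, Finset.sum_range_succ' _ (j + 2)]
      refine (Finset.sum_le_sum fun m _ => sum_prodSq_gradDer_le z r t m S G η).trans ?_
      linarith [prodSq_nonneg z r t 0 S G η]
    have hcl : Continuous fun η => nsq (gradDer z r t) (j + 1) (diverg z r t S) η * G.1 η ^ 2 :=
      (continuous_nsq z r t _ _).mul ((continuous_coe G).pow 2)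
    have h4 := integral_le_lin_comb z r 2 (2 * B) hcl hcd (hcP (j + 1 + 2) S) h2
    rw [integral_finsetSum _ fun a _ => integrable_of_continuous z r (hcQ _)] at h4
    have h5 := integral_mono_cube z r
      (continuous_finsetSum Finset.univ fun a _ => hcP (j + 2) fun c => gradDer z r t a (S c))
      (hcP (j + 1 + 2) S) fun η _ => h3 η
    rw [integral_finsetSum _ fun a _ => integrable_of_continuous z r (hcP _ _)] at h5
    have h6 := Finset.sum_le_sum fun (a : Idx d n) (_ : a ∈ Finset.univ) =>
      hC n t h0 h1 (fun c => gradDer z r t a (S c)) G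
    rw [← Finset.mul_sum] at h6
    have h7 := mul_le_mul_of_nonneg_left h5 hC0
    refine h4.trans ?_
    change _ ≤ _ * ∫ η, P (j + 1 + 2) S η ∂(etaLaw z r n)
    have h8 : ∑ a, ∫ η, nsq (gradDer z r t) j (diverg z r t fun c => gradDer z r t a (S c)) η *
        G.1 η ^ 2 ∂(etaLaw z r n) ≤ C * ∑ a, ∫ η, P (j + 2) (fun c => gradDer z r t a (S c)) η
          ∂(etaLaw z r n) := h6
    linarith

end IteratedDivergence

/-! ### L² bounds for the iterated weights W_I. -/

section Weights

variable {d n : ℕ} (z : E d) (r t : ℝ)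

lemma sum_gradDer_weighted (m p q : ℕ) (w : ℕ → (Fin n → E d) → ℝ) (F G : smoothAlg d n)
    (η : Fin n → E d) :
    ∑ b ∈ Finset.range (m + 1), w b η * ∑ x ∈ antidiagonal b,
      nsq (gradDer z r t) (p + 1 + x.1) F η * nsq (gradDer z r t) (q + x.2) G η =
    ∑ a, ∑ b ∈ Finset.range (m + 1), w b η * ∑ x ∈ antidiagonal b,
      nsq (gradDer z r t) (p + x.1) (gradDer z r t a F) η *
        nsq (gradDer z r t) (q + x.2) G η := by
  rw [Finset.sum_comm]
  refine Finset.sum_congr rfl fun b _ => ?_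
  rw [← Finset.mul_sum, Finset.sum_comm]
  congr 1
  refine Finset.sum_congr rfl fun x _ => ?_
  rw [← Finset.sum_mul, Nat.add_right_comm, nsq_succ]

/-- A bound for ∫ V G² valid for every G improves itself: apply it to the product FG and use the
Leibniz inequality. Then replace F and G by all their iterated derivatives, one derivation at a
time, and sum. -/
lemma integral_mul_nsq_mul_nsq_le [Fact (0 < r)] (m : ℕ) (V : (Fin n → E d) → ℝ)
    (hV : Continuous V) (w : ℕ → (Fin n → E d) → ℝ) (hw : ∀ b, Continuous (w b))
    (hw0 : ∀ b η, 0 ≤ w b η) (C : ℝ) (hC : 0 ≤ C)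
    (H : ∀ G : smoothAlg d n, ∫ η, V η * G.1 η ^ 2 ∂(etaLaw z r n) ≤
      C * ∫ η, ∑ b ∈ Finset.range (m + 1), w b η * nsq (gradDer z r t) b G η ∂(etaLaw z r n))
    (p q : ℕ) (F G : smoothAlg d n) :
    ∫ η, V η * (nsq (gradDer z r t) p F η * nsq (gradDer z r t) q G η) ∂(etaLaw z r n) ≤
      C * 4 ^ m * ∫ η, ∑ b ∈ Finset.range (m + 1), w b η * ∑ x ∈ antidiagonal b,
        nsq (gradDer z r t) (p + x.1) F η * nsq (gradDer z r t) (q + x.2) G η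
        ∂(etaLaw z r n) := by
  have cN := fun (i : ℕ) (F : smoothAlg d n) => continuous_nsq z r t i F
  have cR : ∀ (p q : ℕ) (F G : smoothAlg d n), Continuous fun η =>
      ∑ b ∈ Finset.range (m + 1), w b η * ∑ x ∈ antidiagonal b,
        nsq (gradDer z r t) (p + x.1) F η * nsq (gradDer z r t) (q + x.2) G η :=
    fun p q F G => continuous_finsetSum _ fun b _ => (hw b).mul
      (continuous_finsetSum _ fun x _ => (cN _ _).mul (cN _ _))
  have cL : ∀ (p q : ℕ) (F G : smoothAlg d n), Continuous fun η =>
      V η * (nsq (gradDer z r t) p F η * nsq (gradDer z r t) q G η) :=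
    fun p q F G => hV.mul ((cN _ _).mul (cN _ _))
  induction p generalizing F with
  | zero =>
    induction q generalizing G with
    | zero =>
      refine le_trans (le_of_eq ?_) ((H (F * G)).trans ?_)
      · congr 1; ext η; simp only [nsq_zero, coe_mul, mul_pow]
      rw [mul_assoc]
      gcongr
      refine (integral_le_lin_comb z r (4 ^ m) 0 ?_ (cR 0 0 F G) (cR 0 0 F G)
        fun η _ => ?_).trans (by simp)
      · exact continuous_finsetSum _ fun b _ => (hw b).mul (cN _ _)
      · rw [zero_mul, add_zero, Finset.mul_sum]
        refine Finset.sum_le_sum fun b hb => ?_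
        rw [mul_left_comm]
        refine mul_le_mul_of_nonneg_left ?_ (hw0 b η)
        refine (nsq_mul_le _ b F G η).trans ?_
        simp only [zero_add]
        refine mul_le_mul_of_nonneg_right (pow_le_pow_right₀ (by norm_num) ?_)
          (Finset.sum_nonneg fun _ _ => mul_nonneg (nsq_nonneg _ _ _ _) (nsq_nonneg _ _ _ _))
        have := Finset.mem_range.1 hb
        omega
    | succ q ih =>
      have e1 : ∀ η, V η * (nsq (gradDer z r t) 0 F η * nsq (gradDer z r t) (q + 1) G η) =
          ∑ a, V η * (nsq (gradDer z r t) 0 F η *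
            nsq (gradDer z r t) q (gradDer z r t a G) η) := fun η => by
        rw [nsq_succ, Finset.mul_sum, Finset.mul_sum]
      have e2 : ∀ η, ∑ b ∈ Finset.range (m + 1), w b η * ∑ x ∈ antidiagonal b,
          nsq (gradDer z r t) (0 + x.1) F η * nsq (gradDer z r t) (q + 1 + x.2) G η =
          ∑ a, ∑ b ∈ Finset.range (m + 1), w b η * ∑ x ∈ antidiagonal b,
            nsq (gradDer z r t) (0 + x.1) F η *
              nsq (gradDer z r t) (q + x.2) (gradDer z r t a G) η := fun η => by
        rw [Finset.sum_comm]
        refine Finset.sum_congr rfl fun b _ => ?_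
        rw [← Finset.mul_sum, Finset.sum_comm]
        congr 1
        refine Finset.sum_congr rfl fun x _ => ?_
        rw [← Finset.mul_sum, Nat.add_right_comm, nsq_succ]
      simp only [e1, e2]
      rw [integral_finsetSum _ fun a _ => integrable_of_continuous z r (cL _ _ _ _),
        integral_finsetSum _ fun a _ => integrable_of_continuous z r (cR _ _ _ _),
        Finset.mul_sum]
      exact Finset.sum_le_sum fun a _ => ih _
  | succ p ih =>
    have e1 : ∀ η, V η * (nsq (gradDer z r t) (p + 1) F η * nsq (gradDer z r t) q G η) =
        ∑ a, V η * (nsq (gradDer z r t) p (gradDer z r t a F) η *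
          nsq (gradDer z r t) q G η) := fun η => by
      rw [nsq_succ, Finset.sum_mul, Finset.mul_sum]
    simp only [e1, sum_gradDer_weighted]
    rw [integral_finsetSum _ fun a _ => integrable_of_continuous z r (cL _ _ _ _),
      integral_finsetSum _ fun a _ => integrable_of_continuous z r (cR _ _ _ _),
      Finset.mul_sum]
    exact Finset.sum_le_sum fun a _ => ih _

/-- The iterated weights of the integration by parts formula:
`W [] = 1` and `W (i :: I) = δ(W I • h i)`. -/
noncomputable def iterDiv {κ : Type*} (h : κ → Idx d n → smoothAlg d n) : List κ → smoothAlg d n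
  | [] => 1
  | i :: I => diverg z r t fun c => iterDiv h I * h i c

/-- `s^k ∑_{b ≤ m} τ^{m - b} |D^b G|²`. -/
noncomputable def weightedSq (k m : ℕ) (s τ : (Fin n → E d) → ℝ) (G : smoothAlg d n)
    (η : Fin n → E d) : ℝ :=
  ∑ b ∈ Finset.range (m + 1), s η ^ k * τ η ^ (m - b) * nsq (gradDer z r t) b G η

lemma continuous_weightedSq (k m : ℕ) (s τ : (Fin n → E d) → ℝ) (hs : Continuous s)
    (hτ : Continuous τ) (G : smoothAlg d n) : Continuous (weightedSq z r t k m s τ G) :=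
  continuous_finsetSum _ fun _ _ => ((hs.pow _).mul (hτ.pow _)).mul (continuous_nsq z r t _ _)

/-- One step of the recursion for W_{i::I} = δ(W_I h_i). The known bound for V = W_I is tested
against derivatives of h and of G; each derivative of h is then traded for a power of τ, and h
itself for one factor s. -/
lemma integral_nsq_mul_family_le [Fact (0 < r)] (Q k a' a'' b j : ℕ) (hj : a' + a'' + b ≤ j + 1)
    (hQ : k + 1 + j ≤ Q) (C : ℝ) (hC : 0 ≤ C) (V : smoothAlg d n) (s τ : (Fin n → E d) → ℝ)
    (hs : Continuous s) (hτ : Continuous τ) (hs0 : ∀ η, 0 ≤ s η) (hτ1 : ∀ η, 1 ≤ τ η)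
    (h : Idx d n → smoothAlg d n)
    (hh : ∀ a ≤ Q, ∀ η, ∑ c, nsq (gradDer z r t) a (h c) η ≤ s η * τ η ^ a)
    (H : ∀ G : smoothAlg d n, ∫ η, nsq (gradDer z r t) a' V η * G.1 η ^ 2 ∂(etaLaw z r n) ≤
      C * ∫ η, weightedSq z r t k (k + a') s τ G η ∂(etaLaw z r n)) (G : smoothAlg d n) :
    ∫ η, nsq (gradDer z r t) a' V η * ((∑ c, nsq (gradDer z r t) a'' (h c) η) *
        nsq (gradDer z r t) b G η) ∂(etaLaw z r n) ≤
      C * 4 ^ (k + a') * (k + a' + 1) ^ 2 *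
        ∫ η, weightedSq z r t (k + 1) (k + 1 + j) s τ G η ∂(etaLaw z r n) := by
  have cN := fun (i : ℕ) (F : smoothAlg d n) => continuous_nsq z r t i F
  have hτ0 : ∀ η, 0 ≤ τ η := fun η => zero_le_one.trans (hτ1 η)
  have hw0 : ∀ (b : ℕ) η, 0 ≤ s η ^ k * τ η ^ (k + a' - b) :=
    fun b η => mul_nonneg (pow_nonneg (hs0 η) _) (pow_nonneg (hτ0 η) _)
  have key := fun c => integral_mul_nsq_mul_nsq_le z r t (k + a') (nsq (gradDer z r t) a' V)
    (cN _ _) (fun b η => s η ^ k * τ η ^ (k + a' - b)) (fun b => (hs.pow _).mul (hτ.pow _))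
    hw0 C hC H a'' b (h c) G
  have cL : ∀ c, Continuous fun η => nsq (gradDer z r t) a' V η *
      (nsq (gradDer z r t) a'' (h c) η * nsq (gradDer z r t) b G η) :=
    fun c => (cN _ _).mul ((cN _ _).mul (cN _ _))
  have cR : ∀ c, Continuous fun η => ∑ β ∈ Finset.range (k + a' + 1),
      s η ^ k * τ η ^ (k + a' - β) * ∑ x ∈ antidiagonal β,
        nsq (gradDer z r t) (a'' + x.1) (h c) η * nsq (gradDer z r t) (b + x.2) G η :=
    fun c => continuous_finsetSum _ fun β _ => ((hs.pow _).mul (hτ.pow _)).mul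
      (continuous_finsetSum _ fun x _ => (cN _ _).mul (cN _ _))
  have e1 : ∀ η, nsq (gradDer z r t) a' V η * ((∑ c, nsq (gradDer z r t) a'' (h c) η) *
        nsq (gradDer z r t) b G η) = ∑ c, nsq (gradDer z r t) a' V η *
      (nsq (gradDer z r t) a'' (h c) η * nsq (gradDer z r t) b G η) := fun η => by
    rw [Finset.sum_mul, Finset.mul_sum]
  simp only [e1]
  rw [integral_finsetSum _ fun a _ => integrable_of_continuous z r (cL _)]
  refine (Finset.sum_le_sum fun c _ => key c).trans ?_
  rw [← Finset.mul_sum, mul_assoc (C * 4 ^ (k + a')), ← integral_finsetSum _ fun a _ =>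
    integrable_of_continuous z r (cR _)]
  refine mul_le_mul_of_nonneg_left ?_ (by positivity)
  refine (integral_le_lin_comb z r ((k + a' + 1) ^ 2) 0 (continuous_finsetSum _ fun c _ => cR c)
    (continuous_weightedSq z r t (k + 1) (k + 1 + j) s τ hs hτ G)
    (continuous_weightedSq z r t (k + 1) (k + 1 + j) s τ hs hτ G) fun η _ => ?_).trans (by simp)
  have hT0 : 0 ≤ weightedSq z r t (k + 1) (k + 1 + j) s τ G η :=
    Finset.sum_nonneg fun _ _ => mul_nonneg (mul_nonneg (pow_nonneg (hs0 η) _)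
      (pow_nonneg (hτ0 η) _)) (nsq_nonneg _ _ _ _)
  rw [zero_mul, add_zero, Finset.sum_comm]
  have hterm : ∀ β ∈ Finset.range (k + a' + 1), ∀ x ∈ antidiagonal β,
      s η ^ k * τ η ^ (k + a' - β) * ∑ c, (nsq (gradDer z r t) (a'' + x.1) (h c) η *
        nsq (gradDer z r t) (b + x.2) G η) ≤ weightedSq z r t (k + 1) (k + 1 + j) s τ G η := by
    intro β hβ x hx
    have hβ' := Finset.mem_range.1 hβ
    have hx' := Finset.HasAntidiagonal.mem_antidiagonal.1 hx
    have h1 := hh (a'' + x.1) (by omega) η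
    have h2 : s η ^ (k + 1) * τ η ^ (k + 1 + j - (b + x.2)) *
        nsq (gradDer z r t) (b + x.2) G η ≤ weightedSq z r t (k + 1) (k + 1 + j) s τ G η :=
      Finset.single_le_sum (f := fun b => s η ^ (k + 1) * τ η ^ (k + 1 + j - b) *
        nsq (gradDer z r t) b G η) (fun _ _ => mul_nonneg (mul_nonneg (pow_nonneg (hs0 η) _)
          (pow_nonneg (hτ0 η) _)) (nsq_nonneg _ _ _ _)) (Finset.mem_range.2 (by omega))
    refine le_trans ?_ h2
    rw [← Finset.sum_mul, ← mul_assoc]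
    refine mul_le_mul_of_nonneg_right ?_ (nsq_nonneg _ _ _ _)
    calc _ ≤ s η ^ k * τ η ^ (k + a' - β) * (s η * τ η ^ (a'' + x.1)) :=
          mul_le_mul_of_nonneg_left h1 (mul_nonneg (pow_nonneg (hs0 η) _)
            (pow_nonneg (hτ0 η) _))
      _ = s η ^ (k + 1) * τ η ^ (k + a' - β + (a'' + x.1)) := by ring
      -- As x.1 + x.2 = β, the exponent plus b + x.2 equals k + a' + a'' + b, which is at most k + 1
      -- + j; raising the exponent is allowed since τ ≥ 1.
      _ ≤ _ := mul_le_mul_of_nonneg_left (pow_le_pow_right₀ (hτ1 η) (by omega))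
            (pow_nonneg (hs0 η) _)
  calc _ = ∑ β ∈ Finset.range (k + a' + 1), ∑ x ∈ antidiagonal β,
      s η ^ k * τ η ^ (k + a' - β) * ∑ c, (nsq (gradDer z r t) (a'' + x.1) (h c) η *
        nsq (gradDer z r t) (b + x.2) G η) := by
        refine Finset.sum_congr rfl fun β _ => ?_
        rw [← Finset.mul_sum, Finset.sum_comm, Finset.mul_sum]
    _ ≤ ∑ β ∈ Finset.range (k + a' + 1), ∑ x ∈ antidiagonal β,
        weightedSq z r t (k + 1) (k + 1 + j) s τ G η :=
      Finset.sum_le_sum fun β hβ => Finset.sum_le_sum fun x hx => hterm β hβ x hx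
    -- There are k + a' + 1 values of β and at most as many splittings x of each, whence the squared
    -- factor in the constant.
    _ ≤ ∑ β ∈ Finset.range (k + a' + 1), (k + a' + 1 : ℝ) *
        weightedSq z r t (k + 1) (k + 1 + j) s τ G η := by
      refine Finset.sum_le_sum fun β hβ => ?_
      rw [Finset.sum_const, Finset.Nat.card_antidiagonal, nsmul_eq_mul]
      refine mul_le_mul_of_nonneg_right ?_ hT0
      have := Finset.mem_range.1 hβ
      exact_mod_cast (by omega : β + 1 ≤ k + a' + 1)
    _ = _ := by
      rw [Finset.sum_const, Finset.card_range, nsmul_eq_mul]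
      push_cast; ring

/-- The weighted `L²` bound for the derivatives of the iterated weights. -/
lemma exists_integral_nsq_iterDiv_le [Fact (0 < r)] (κ : Type*) (Q k : ℕ) :
    ∀ j, k + j ≤ Q → ∃ C : ℝ, 0 ≤ C ∧ ∀ (n : ℕ) (t : ℝ), 0 ≤ t → t ≤ 1 →
      ∀ (s τ : (Fin n → E d) → ℝ), Continuous s → Continuous τ → (∀ η, 0 ≤ s η) →
      (∀ η, 1 ≤ τ η) → ∀ (h : κ → Idx d n → smoothAlg d n),
      (∀ i, ∀ a ≤ Q, ∀ η, ∑ c, nsq (gradDer z r t) a (h i c) η ≤ s η * τ η ^ a) →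
      ∀ (I : List κ), I.length = k → ∀ G : smoothAlg d n,
      ∫ η, nsq (gradDer z r t) j (iterDiv z r t h I) η * G.1 η ^ 2 ∂(etaLaw z r n) ≤
        C * ∫ η, weightedSq z r t k (k + j) s τ G η ∂(etaLaw z r n) := by
  induction k with
  | zero =>
    intro j _
    refine ⟨1, zero_le_one, fun n t h0 h1 s τ hs hτ hs0 hτ1 h hh I hI G => ?_⟩
    have hτ0 : ∀ η, 0 ≤ τ η := fun η => zero_le_one.trans (hτ1 η)
    rw [one_mul, List.length_eq_zero_iff.1 hI]
    refine integral_mono_cube z r ((continuous_nsq z r t _ _).mul ((continuous_coe G).pow 2))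
      (continuous_weightedSq z r t _ _ s τ hs hτ G) fun η _ => ?_
    have hT0 : 0 ≤ weightedSq z r t 0 (0 + j) s τ G η :=
      Finset.sum_nonneg fun _ _ => mul_nonneg (mul_nonneg (pow_nonneg (hs0 η) _)
        (pow_nonneg (hτ0 η) _)) (nsq_nonneg _ _ _ _)
    change nsq (gradDer z r t) j 1 η * G.1 η ^ 2 ≤ _
    cases j with
    | zero =>
      unfold weightedSq
      simp [nsq_zero]
    | succ j => rw [nsq_one_succ, zero_mul]; exact hT0
  | succ k ih =>
    intro j hj
    -- The constants are made total in j, with value 0 beyond the admissible range, so that they can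
    -- be chosen as one function.
    have ih' : ∀ j : ℕ, ∃ C : ℝ, 0 ≤ C ∧ (k + j ≤ Q → ∀ (n : ℕ) (t : ℝ), 0 ≤ t → t ≤ 1 →
      ∀ (s τ : (Fin n → E d) → ℝ), Continuous s → Continuous τ → (∀ η, 0 ≤ s η) →
      (∀ η, 1 ≤ τ η) → ∀ (h : κ → Idx d n → smoothAlg d n),
      (∀ i, ∀ a ≤ Q, ∀ η, ∑ c, nsq (gradDer z r t) a (h i c) η ≤ s η * τ η ^ a) →
      ∀ (I : List κ), I.length = k → ∀ G : smoothAlg d n,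
      ∫ η, nsq (gradDer z r t) j (iterDiv z r t h I) η * G.1 η ^ 2 ∂(etaLaw z r n) ≤
        C * ∫ η, weightedSq z r t k (k + j) s τ G η ∂(etaLaw z r n)) := fun j => by
      by_cases hj : k + j ≤ Q
      · obtain ⟨C, h1, h2⟩ := ih j hj
        exact ⟨C, h1, fun _ => h2⟩
      · exact ⟨0, le_rfl, fun h => absurd h hj⟩
    choose C hC0 hC using ih'
    obtain ⟨B, hB0, hB⟩ := exists_integral_nsq_diverg_mul_sq_le z r j
    -- The outer sums distribute m ≤ j + 1 derivatives between W_I h_i and G, and the innermost sum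
    -- distributes those of the product between W_I and h_i.
    refine ⟨B * ∑ m ∈ Finset.range (j + 2), ∑ p ∈ antidiagonal m, 4 ^ p.1 *
      ∑ u ∈ antidiagonal p.1, C u.1 * 4 ^ (k + u.1) * (k + u.1 + 1) ^ 2, ?_,
      fun n t h0 h1 s τ hs hτ hs0 hτ1 h hh I hI G => ?_⟩
    · refine mul_nonneg hB0 (Finset.sum_nonneg fun m _ => Finset.sum_nonneg fun p _ =>
        mul_nonneg (by positivity) (Finset.sum_nonneg fun u _ => ?_))
      have := hC0 u.1
      positivity
    match I, hI with
    | i :: I, hI =>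
    have hI' : I.length = k := by simpa using hI
    have cN := fun (i : ℕ) (F : smoothAlg d n) => continuous_nsq z r t i F
    refine (hB n t h0 h1 (fun c => iterDiv z r t h I * h i c) G).trans ?_
    rw [mul_assoc]
    refine mul_le_mul_of_nonneg_left ?_ hB0
    set T : (Fin n → E d) → ℝ := weightedSq z r t (k + 1) (k + 1 + j) s τ G with hT
    set L : ℕ × ℕ → ℕ × ℕ → (Fin n → E d) → ℝ := fun p u η =>
      nsq (gradDer z r t) u.1 (iterDiv z r t h I) η *
        ((∑ c, nsq (gradDer z r t) u.2 (h i c) η) * nsq (gradDer z r t) p.2 G η) with hL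
    have cL : ∀ p u, Continuous (L p u) := fun p u => (cN _ _).mul
      ((continuous_finsetSum _ fun c _ => cN _ _).mul (cN _ _))
    have cL' : ∀ p : ℕ × ℕ, Continuous fun η => ∑ u ∈ antidiagonal p.1, L p u η := fun p =>
      continuous_finsetSum _ fun u _ => cL p u
    have cL2 : ∀ p : ℕ × ℕ, Continuous fun η => 4 ^ p.1 * ∑ u ∈ antidiagonal p.1, L p u η :=
      fun p => continuous_const.mul (cL' p)
    have cL3 : ∀ m : ℕ, Continuous fun η => ∑ p ∈ antidiagonal m,
      4 ^ p.1 * ∑ u ∈ antidiagonal p.1, L p u η := fun m => continuous_finsetSum _ fun p _ => cL2 p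
    have h2 : ∀ η, ∑ m ∈ Finset.range (j + 2),
        prodSq z r t m (fun c => iterDiv z r t h I * h i c) G η ≤
        ∑ m ∈ Finset.range (j + 2), ∑ p ∈ antidiagonal m,
          4 ^ p.1 * ∑ u ∈ antidiagonal p.1, L p u η := fun η => by
      refine Finset.sum_le_sum fun m _ => Finset.sum_le_sum fun p _ => ?_
      refine (mul_le_mul_of_nonneg_right (Finset.sum_le_sum fun c _ =>
        nsq_mul_le (gradDer z r t) p.1 (iterDiv z r t h I) (h i c) η)
        (nsq_nonneg _ _ _ _)).trans (le_of_eq ?_)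
      rw [← Finset.mul_sum, Finset.sum_comm, mul_assoc, Finset.sum_mul]
      congr 1
      refine Finset.sum_congr rfl fun u _ => ?_
      rw [← Finset.mul_sum, mul_assoc]
    refine (integral_mono_cube z r (continuous_finsetSum _ fun m _ => continuous_prodSq z r t m _ _)
      (continuous_finsetSum _ fun m _ => cL3 m) fun η _ => h2 η).trans ?_
    rw [integral_finsetSum _ fun m _ => integrable_of_continuous z r (cL3 m), Finset.sum_mul]
    refine Finset.sum_le_sum fun m hm => ?_
    rw [integral_finsetSum _ fun p _ => integrable_of_continuous z r (cL2 p), Finset.sum_mul]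
    refine Finset.sum_le_sum fun p hp => ?_
    rw [integral_const_mul, integral_finsetSum _ fun u _ => integrable_of_continuous z r (cL p u),
      mul_assoc, Finset.sum_mul]
    refine mul_le_mul_of_nonneg_left (Finset.sum_le_sum fun u hu => ?_) (by positivity)
    have hm' := Finset.mem_range.1 hm
    have hp' := Finset.HasAntidiagonal.mem_antidiagonal.1 hp
    have hu' := Finset.HasAntidiagonal.mem_antidiagonal.1 hu
    exact integral_nsq_mul_family_le z r t Q k u.1 u.2 p.2 j (by omega) (by omega) (C u.1)
      (hC0 _) (iterDiv z r t h I) s τ hs hτ hs0 hτ1 (h i) (hh i)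
      (hC u.1 (by omega) n t h0 h1 s τ hs hτ hs0 hτ1 h hh I hI') G

/-- The `L²` bound for the iterated weights. -/
lemma exists_integral_iterDiv_sq_le [Fact (0 < r)] (κ : Type*) (Q : ℕ) :
    ∃ C : ℝ, 0 ≤ C ∧ ∀ (n : ℕ) (t : ℝ), 0 ≤ t → t ≤ 1 →
      ∀ (s τ : (Fin n → E d) → ℝ), Continuous s → Continuous τ → (∀ η, 0 ≤ s η) →
      (∀ η, 1 ≤ τ η) → ∀ (h : κ → Idx d n → smoothAlg d n),
      (∀ i, ∀ a ≤ Q, ∀ η, ∑ c, nsq (gradDer z r t) a (h i c) η ≤ s η * τ η ^ a) →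
      ∀ (I : List κ), I.length ≤ Q →
      ∫ η, (iterDiv z r t h I).1 η ^ 2 ∂(etaLaw z r n) ≤
        C * ∫ η, (s η * τ η) ^ I.length ∂(etaLaw z r n) := by
  choose C hC0 hC using fun k : ℕ => fun hk : k ≤ Q =>
    exists_integral_nsq_iterDiv_le z r κ Q k 0 (by omega)
  refine ⟨∑ k : Fin (Q + 1), C k (by omega), Finset.sum_nonneg fun _ _ => hC0 _ _,
    fun n t h0 h1 s τ hs hτ hs0 hτ1 h hh I hI => ?_⟩
  have hτ0 : ∀ η, 0 ≤ τ η := fun η => zero_le_one.trans (hτ1 η)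
  have h2 := hC I.length hI n t h0 h1 s τ hs hτ hs0 hτ1 h hh I rfl 1
  -- For j = 0 and G = 1 only the undifferentiated term b = 0 survives, giving s^{|I|}τ^{|I|}.
  have e1 : ∀ η, weightedSq z r t I.length (I.length + 0) s τ 1 η = (s η * τ η) ^ I.length :=
    fun η => by
      unfold weightedSq
      rw [Finset.sum_range_succ']
      simp [nsq_one_succ, nsq_zero, mul_pow]
  simp only [e1, nsq_zero, OneMemClass.coe_one, Pi.one_apply, one_pow, mul_one] at h2
  refine h2.trans (mul_le_mul_of_nonneg_right ?_ (integral_nonneg fun η =>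
    pow_nonneg (mul_nonneg (hs0 η) (hτ0 η)) _))
  exact Finset.single_le_sum (f := fun k : Fin (Q + 1) => C k (by omega))
    (fun _ _ => hC0 _ _) (Finset.mem_univ (⟨I.length, by omega⟩ : Fin (Q + 1)))

end Weights

/-! ### The regularised inverse Malliavin matrix and the fields h_i. -/

section Covariance

variable {d n : ℕ} (z : E d) (r t : ℝ) (f : Fin d → smoothAlg d n) (ε : ℝ)

/-- The entries `(D f_i, D f_j)_H` of the Malliavin matrix. -/
noncomputable def gram (i j : Fin d) : smoothAlg d n :=
  ∑ c, gradDer z r t c (f i) * gradDer z r t c (f j)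

/-- The regularized Malliavin matrix `σ + ε`. -/
noncomputable def regMat : Matrix (Fin d) (Fin d) (smoothAlg d n) :=
  Matrix.of (gram z r t f) + Matrix.scalar (Fin d) (algebraMap ℝ (smoothAlg d n) ε)

/-- Evaluation at a point. -/
def evalAt (η : Fin n → E d) : smoothAlg d n →+* ℝ where
  toFun F := F.1 η
  map_one' := rfl
  map_mul' _ _ := rfl
  map_zero' := rfl
  map_add' _ _ := rfl

lemma evalAt_apply (η : Fin n → E d) (F : smoothAlg d n) : evalAt η F = F.1 η := rfl

lemma posSemidef_gram (η : Fin n → E d) :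
    (Matrix.of fun i j => (gram z r t f i j).1 η).PosSemidef := by
  have e : (Matrix.of fun i j => (gram z r t f i j).1 η) =
      (Matrix.of fun (i : Fin d) (c : Idx d n) => (gradDer z r t c (f i)).1 η) *
      (Matrix.of fun (i : Fin d) (c : Idx d n) => (gradDer z r t c (f i)).1 η).conjTranspose := by
    ext i j
    simp only [gram, Matrix.of_apply, Matrix.mul_apply, Matrix.conjTranspose_apply, star_trivial,
      coe_sum, coe_mul]
  rw [e]
  exact Matrix.posSemidef_self_mul_conjTranspose _

lemma regMat_map_evalAt (η : Fin n → E d) :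
    (regMat z r t f ε).map (evalAt η) =
      (Matrix.of fun i j => (gram z r t f i j).1 η) + ε • (1 : Matrix (Fin d) (Fin d) ℝ) := by
  ext i j
  rcases eq_or_ne i j with rfl | h
  · simp [regMat, evalAt_apply]
  · simp [regMat, evalAt_apply, h]

variable {ε} in
lemma det_regMat_pos (hε : 0 < ε) (η : Fin n → E d) : 0 < ((regMat z r t f ε).det).1 η := by
  have h1 : ((regMat z r t f ε).det).1 η = ((regMat z r t f ε).map (evalAt η)).det :=
    RingHom.map_det (evalAt η) _
  rw [h1, regMat_map_evalAt]
  exact (Matrix.PosDef.posSemidef_add (posSemidef_gram z r t f η)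
    (Matrix.PosDef.one.smul hε)).det_pos

variable {ε} in
/-- The inverse of the regularized Malliavin matrix. -/
noncomputable def regInv (hε : 0 < ε) : Matrix (Fin d) (Fin d) (smoothAlg d n) :=
  (⟨fun η => (((regMat z r t f ε).det).1 η)⁻¹, (contDiff_coe _).inv fun η =>
    (det_regMat_pos z r t f hε η).ne'⟩ : smoothAlg d n) • (regMat z r t f ε).adjugate

variable {ε} (hε : 0 < ε)

lemma regMat_mul_regInv : regMat z r t f ε * regInv z r t f hε = 1 := by
  unfold regInv
  rw [Matrix.mul_smul, Matrix.mul_adjugate, smul_smul]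
  refine (congrArg (· • (1 : Matrix (Fin d) (Fin d) (smoothAlg d n))) ?_).trans (one_smul _ _)
  ext η
  exact inv_mul_cancel₀ (det_regMat_pos z r t f hε η).ne'

lemma regInv_mul_regMat : regInv z r t f hε * regMat z r t f ε = 1 :=
  mul_eq_one_comm.1 (regMat_mul_regInv z r t f hε)

lemma regInv_map_evalAt (η : Fin n → E d) :
    (regInv z r t f hε).map (evalAt η) = ((Matrix.of fun i j => (gram z r t f i j).1 η) +
      ε • (1 : Matrix (Fin d) (Fin d) ℝ))⁻¹ := by
  rw [← regMat_map_evalAt]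
  refine (Matrix.inv_eq_right_inv ?_).symm
  rw [← Matrix.map_mul, regMat_mul_regInv]
  exact Matrix.map_one _ (map_zero _) (map_one _)

lemma gradDer_regMat (c : Idx d n) (k l : Fin d) :
    gradDer z r t c (regMat z r t f ε k l) = gradDer z r t c (gram z r t f k l) := by
  unfold regMat
  rw [Matrix.add_apply, map_add, Matrix.of_apply, Matrix.scalar_apply, Matrix.diagonal_apply]
  split_ifs <;> simp

/-- The usual formula Dϱ = −ϱ(Dσ)ϱ. The regularisation does not appear since it is constant. -/
lemma gradDer_regInv (c : Idx d n) (i j : Fin d) :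
    gradDer z r t c (regInv z r t f hε i j) =
      -∑ p : Fin d × Fin d, (regInv z r t f hε i p.1 * gradDer z r t c (gram z r t f p.1 p.2)) *
        regInv z r t f hε p.2 j := by
  set ρ := regInv z r t f hε with hρ
  set S := regMat z r t f ε with hS
  -- Differentiate the identity (σ + ε)ϱ = 1 entry by entry.
  have h1 : S.map (gradDer z r t c) * ρ + S * ρ.map (gradDer z r t c) = 0 := by
    refine Matrix.ext fun i j => ?_
    have h := congrArg (fun M : Matrix (Fin d) (Fin d) (smoothAlg d n) =>
      gradDer z r t c (M i j)) (regMat_mul_regInv z r t f hε)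
    have h0 : gradDer z r t c ((1 : Matrix (Fin d) (Fin d) (smoothAlg d n)) i j) = 0 := by
      rw [Matrix.one_apply]; split_ifs <;> simp
    simp only [h0, Matrix.mul_apply, map_sum, Derivation.leibniz, smul_eq_mul] at h
    rw [Matrix.add_apply, Matrix.mul_apply, Matrix.mul_apply, ← Finset.sum_add_distrib,
      Matrix.zero_apply]
    refine Eq.trans ?_ h
    refine Finset.sum_congr rfl fun k _ => ?_
    simp only [Matrix.map_apply, hρ, hS]
    ring
  have h2 : ρ.map (gradDer z r t c) = -(ρ * S.map (gradDer z r t c) * ρ) := by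
    have h3 : ρ * (S.map (gradDer z r t c) * ρ + S * ρ.map (gradDer z r t c)) = 0 := by
      rw [h1, mul_zero]
    rw [mul_add, ← mul_assoc, ← mul_assoc, regInv_mul_regMat, one_mul] at h3
    exact eq_neg_of_add_eq_zero_right h3
  have h4 := congrFun (congrFun h2 i) j
  rw [Matrix.map_apply] at h4
  rw [h4, Matrix.neg_apply, Matrix.mul_apply, Fintype.sum_prod_type, Finset.sum_comm]
  congr 1
  refine Finset.sum_congr rfl fun l _ => ?_
  rw [Matrix.mul_apply, Finset.sum_mul]
  refine Finset.sum_congr rfl fun k _ => ?_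
  rw [Matrix.map_apply, gradDer_regMat]

/-- `∑_{ij} ϱ_{ij}²` for the regularized inverse. -/
noncomputable def invSq (η : Fin n → E d) : ℝ := ∑ i, ∑ j, (regInv z r t f hε i j).1 η ^ 2

/-- `∑_i ∑_{1 ≤ m ≤ Q + 1} |D^m f_i|²`. -/
noncomputable def derivSq (Q : ℕ) (η : Fin n → E d) : ℝ :=
  ∑ i, ∑ m ∈ Finset.range (Q + 1), nsq (gradDer z r t) (m + 1) (f i) η

lemma invSq_nonneg (η : Fin n → E d) : 0 ≤ invSq z r t f hε η :=
  Finset.sum_nonneg fun _ _ => Finset.sum_nonneg fun _ _ => sq_nonneg _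

lemma derivSq_nonneg (Q : ℕ) (η : Fin n → E d) : 0 ≤ derivSq z r t f Q η :=
  Finset.sum_nonneg fun _ _ => Finset.sum_nonneg fun _ _ => nsq_nonneg _ _ _ _

lemma continuous_invSq : Continuous (invSq z r t f hε) :=
  continuous_finsetSum _ fun _ _ => continuous_finsetSum _ fun _ _ => (continuous_coe _).pow 2

lemma continuous_derivSq (Q : ℕ) : Continuous (derivSq z r t f Q) :=
  continuous_finsetSum _ fun _ _ => continuous_finsetSum _ fun _ _ => continuous_nsq z r t _ _

lemma nsq_le_derivSq {Q m : ℕ} (hm : m ≤ Q) (i : Fin d) (η : Fin n → E d) :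
    nsq (gradDer z r t) (m + 1) (f i) η ≤ derivSq z r t f Q η := by
  refine le_trans ?_ (Finset.single_le_sum (f := fun i => ∑ m ∈ Finset.range (Q + 1),
    nsq (gradDer z r t) (m + 1) (f i) η)
    (fun _ _ => Finset.sum_nonneg fun _ _ => nsq_nonneg _ _ _ _) (Finset.mem_univ i))
  exact Finset.single_le_sum (f := fun m => nsq (gradDer z r t) (m + 1) (f i) η)
    (fun _ _ => nsq_nonneg _ _ _ _) (Finset.mem_range.2 (by omega))

/-- The entries of σ are sums of products of first derivatives of f, so Q derivatives of σ involve
derivatives of f up to order Q + 1. This fixes the range in `derivSq`. -/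
lemma nsq_gram_le {Q y : ℕ} (hy : y ≤ Q) (k l : Fin d) (η : Fin n → E d) :
    nsq (gradDer z r t) y (gram z r t f k l) η ≤
      4 ^ Q * (Q + 1) * derivSq z r t f Q η ^ 2 := by
  unfold gram
  refine (nsq_sum_mul_le _ _ y _ _ η).trans ?_
  have hF := derivSq_nonneg z r t f Q η
  have h1 : ∀ p ∈ antidiagonal y, (∑ c, nsq (gradDer z r t) p.1 (gradDer z r t c (f k)) η) *
      ∑ c, nsq (gradDer z r t) p.2 (gradDer z r t c (f l)) η ≤ derivSq z r t f Q η ^ 2 := by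
    intro p hp
    have hp' := Finset.HasAntidiagonal.mem_antidiagonal.1 hp
    rw [pow_two]
    exact mul_le_mul (nsq_le_derivSq z r t f (by omega) k η)
      (nsq_le_derivSq z r t f (by omega) l η)
      (Finset.sum_nonneg fun _ _ => nsq_nonneg _ _ _ _) hF
  refine (mul_le_mul_of_nonneg_left (Finset.sum_le_sum h1) (by positivity)).trans ?_
  rw [Finset.sum_const, Finset.Nat.card_antidiagonal, nsmul_eq_mul, ← mul_assoc]
  refine mul_le_mul_of_nonneg_right ?_ (sq_nonneg _)
  refine mul_le_mul (pow_le_pow_right₀ (by norm_num) hy) ?_ (by positivity) (by positivity)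
  exact_mod_cast (by omega : y + 1 ≤ Q + 1)

lemma nsq_regInv_le_sum (a : ℕ) (i j : Fin d) (η : Fin n → E d) :
    nsq (gradDer z r t) a (regInv z r t f hε i j) η ≤
      ∑ i, ∑ j, nsq (gradDer z r t) a (regInv z r t f hε i j) η := by
  refine le_trans ?_ (Finset.single_le_sum (f := fun i => ∑ j,
    nsq (gradDer z r t) a (regInv z r t f hε i j) η)
    (fun _ _ => Finset.sum_nonneg fun _ _ => nsq_nonneg _ _ _ _) (Finset.mem_univ i))
  exact Finset.single_le_sum (f := fun j => nsq (gradDer z r t) a (regInv z r t f hε i j) η)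
    (fun _ _ => nsq_nonneg _ _ _ _) (Finset.mem_univ j)

/-- By Dϱ = −ϱ(Dσ)ϱ every derivative of ϱ costs one more factor ϱ Dσ, of squared size at most a
multiple of RF² ≤ τ. The constant depends on d and on the orders only, in particular not on ε. -/
lemma exists_nsq_regInv_le (d Q a : ℕ) : a ≤ Q → ∃ C : ℝ, 0 ≤ C ∧
    ∀ (n : ℕ) (z : E d) (r t : ℝ) (f : Fin d → smoothAlg d n) (ε : ℝ) (hε : 0 < ε)
      (η : Fin n → E d), ∀ i ≤ a,
      ∑ k, ∑ l, nsq (gradDer z r t) i (regInv z r t f hε k l) η ≤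
        C * invSq z r t f hε η * (1 + invSq z r t f hε η * derivSq z r t f Q η ^ 2) ^ i := by
  induction a with
  | zero =>
    refine fun _ => ⟨1, zero_le_one, fun n z r t f ε hε η i hi => ?_⟩
    obtain rfl : i = 0 := by omega
    simp [nsq_zero, invSq]
  | succ a ih =>
    intro ha
    obtain ⟨C, hC0, hC⟩ := ih (by omega)
    set K : ℝ := 4 ^ Q * (Q + 1) with hK
    refine ⟨C + d * (d * (4 ^ a * ((a + 1) * (d * (d * (4 ^ a * ((a + 1) * (C * K))))
      * (d * (d * C)))))), by positivity, fun n z r t f ε hε η i hi => ?_⟩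
    set R := invSq z r t f hε η with hR
    set F := derivSq z r t f Q η with hF
    set τ := 1 + R * F ^ 2 with hτ
    have hR0 : 0 ≤ R := invSq_nonneg z r t f hε η
    have hF0 : 0 ≤ F := derivSq_nonneg z r t f Q η
    have hτ1 : 1 ≤ τ := by rw [hτ]; nlinarith [mul_nonneg hR0 (sq_nonneg F)]
    have hτ0 : 0 ≤ τ := zero_le_one.trans hτ1
    have hRF : R * F ^ 2 ≤ τ := by rw [hτ]; linarith
    have hsmall := hC n z r t f ε hε η
    have hρ : ∀ i ≤ a, ∀ k l, nsq (gradDer z r t) i (regInv z r t f hε k l) η ≤ C * R * τ ^ i :=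
      fun i hi k l => (nsq_regInv_le_sum z r t f hε i k l η).trans (hsmall i hi)
    have hG : ∀ y ≤ a, ∀ k l, ∑ c, nsq (gradDer z r t) y (gradDer z r t c (gram z r t f k l)) η ≤
        K * F ^ 2 := fun y hy k l => by
      have := nsq_gram_le z r t f (show y + 1 ≤ Q by omega) k l η
      rwa [nsq_succ] at this
    rcases Nat.lt_or_ge i (a + 1) with hlt | hge
    · refine (hsmall i (by omega)).trans ?_
      have h0 : 0 ≤ R * τ ^ i := mul_nonneg hR0 (pow_nonneg hτ0 _)
      rw [mul_assoc, mul_assoc]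
      refine mul_le_mul_of_nonneg_right ?_ h0
      exact le_add_of_nonneg_right (by positivity)
    obtain rfl : i = a + 1 := by omega
    have hent : ∀ k l, nsq (gradDer z r t) (a + 1) (regInv z r t f hε k l) η ≤
        4 ^ a * ((a + 1) * ((d * (d * (4 ^ a * ((a + 1) * (C * K)))) * (d * (d * C))) *
          (R * τ ^ (a + 1)))) := by
      intro k l
      rw [nsq_succ]
      have h1 : ∀ c, nsq (gradDer z r t) a (gradDer z r t c (regInv z r t f hε k l)) η ≤
          4 ^ a * ∑ p ∈ antidiagonal a,
            (∑ q : Fin d × Fin d, nsq (gradDer z r t) p.1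
              (regInv z r t f hε k q.1 * gradDer z r t c (gram z r t f q.1 q.2)) η) *
            ∑ q : Fin d × Fin d, nsq (gradDer z r t) p.2 (regInv z r t f hε q.2 l) η := fun c => by
        rw [gradDer_regInv, nsq_neg]
        exact nsq_sum_mul_le _ _ _ _ _ _
      refine (Finset.sum_le_sum fun c _ => h1 c).trans ?_
      rw [← Finset.mul_sum, Finset.sum_comm]
      refine mul_le_mul_of_nonneg_left ?_ (by positivity)
      have h2 : ∀ p ∈ antidiagonal a, ∑ c,
            (∑ q : Fin d × Fin d, nsq (gradDer z r t) p.1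
              (regInv z r t f hε k q.1 * gradDer z r t c (gram z r t f q.1 q.2)) η) *
            ∑ q : Fin d × Fin d, nsq (gradDer z r t) p.2 (regInv z r t f hε q.2 l) η ≤
          (d * (d * (4 ^ a * ((a + 1) * (C * K)))) * (d * (d * C))) * (R * τ ^ (a + 1)) := by
        intro p hp
        have hp' := Finset.HasAntidiagonal.mem_antidiagonal.1 hp
        have h3 : ∑ q : Fin d × Fin d, nsq (gradDer z r t) p.2 (regInv z r t f hε q.2 l) η ≤
            d * (d * C) * (R * τ ^ p.2) := by
          refine (Finset.sum_le_sum fun q _ => hρ p.2 (by omega) q.2 l).trans (le_of_eq ?_)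
          simp only [Finset.sum_const, Finset.card_univ, Fintype.card_prod, Fintype.card_fin,
            nsmul_eq_mul]
          push_cast; ring
        have h4 : ∑ c, ∑ q : Fin d × Fin d, nsq (gradDer z r t) p.1
              (regInv z r t f hε k q.1 * gradDer z r t c (gram z r t f q.1 q.2)) η ≤
            d * (d * (4 ^ a * ((a + 1) * (C * K)))) * (R * τ ^ p.1 * F ^ 2) := by
          rw [Finset.sum_comm]
          have h5 : ∀ q : Fin d × Fin d, ∑ c, nsq (gradDer z r t) p.1
              (regInv z r t f hε k q.1 * gradDer z r t c (gram z r t f q.1 q.2)) η ≤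
              4 ^ a * ((a + 1) * (C * K)) * (R * τ ^ p.1 * F ^ 2) := by
            intro q
            refine (Finset.sum_le_sum fun c _ => nsq_mul_le _ p.1 _ _ η).trans ?_
            rw [← Finset.mul_sum, Finset.sum_comm]
            have h6 : ∀ u ∈ antidiagonal p.1, ∑ c, nsq (gradDer z r t) u.1
                (regInv z r t f hε k q.1) η * nsq (gradDer z r t) u.2
                (gradDer z r t c (gram z r t f q.1 q.2)) η ≤ C * R * τ ^ p.1 * (K * F ^ 2) := by
              intro u hu
              have hu' := Finset.HasAntidiagonal.mem_antidiagonal.1 hu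
              rw [← Finset.mul_sum]
              refine mul_le_mul ((hρ u.1 (by omega) k q.1).trans ?_) (hG u.2 (by omega) _ _)
                (Finset.sum_nonneg fun _ _ => nsq_nonneg _ _ _ _)
                (mul_nonneg (mul_nonneg hC0 hR0) (pow_nonneg hτ0 _))
              exact mul_le_mul_of_nonneg_left (pow_le_pow_right₀ hτ1 (by omega))
                (mul_nonneg hC0 hR0)
            refine (mul_le_mul_of_nonneg_left (Finset.sum_le_sum h6) (by positivity)).trans ?_
            rw [Finset.sum_const, Finset.Nat.card_antidiagonal, nsmul_eq_mul]
            have h7 : (4 : ℝ) ^ p.1 * ((p.1 + 1 : ℕ) : ℝ) ≤ 4 ^ a * (a + 1) := by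
              refine mul_le_mul (pow_le_pow_right₀ (by norm_num) (by omega)) ?_ (by positivity)
                (by positivity)
              exact_mod_cast (by omega : p.1 + 1 ≤ a + 1)
            have h8 : 0 ≤ C * R * τ ^ p.1 * (K * F ^ 2) := by positivity
            calc _ = (4 : ℝ) ^ p.1 * ((p.1 + 1 : ℕ) : ℝ) * (C * R * τ ^ p.1 * (K * F ^ 2)) := by
                  ring
              _ ≤ 4 ^ a * (a + 1) * (C * R * τ ^ p.1 * (K * F ^ 2)) :=
                  mul_le_mul_of_nonneg_right h7 h8
              _ = _ := by ring
          refine (Finset.sum_le_sum fun q _ => h5 q).trans (le_of_eq ?_)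
          simp only [Finset.sum_const, Finset.card_univ, Fintype.card_prod, Fintype.card_fin,
            nsmul_eq_mul]
          push_cast; ring
        rw [← Finset.sum_mul]
        refine (mul_le_mul h4 h3 (Finset.sum_nonneg fun _ _ => nsq_nonneg _ _ _ _)
          (by positivity)).trans ?_
        -- Of the two factors ϱ around Dσ one is kept as R; the other joins F² and is paid for by
        -- the extra power of τ.
        have h9 : R * τ ^ p.1 * F ^ 2 * (R * τ ^ p.2) ≤ R * τ ^ (a + 1) := by
          calc _ = R * F ^ 2 * (R * τ ^ (p.1 + p.2)) := by ring
            _ ≤ τ * (R * τ ^ (p.1 + p.2)) :=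
              mul_le_mul_of_nonneg_right hRF (mul_nonneg hR0 (pow_nonneg hτ0 _))
            _ = R * τ ^ (a + 1) := by rw [hp']; ring
        calc _ = (d * (d * (4 ^ a * ((a + 1) * (C * K)))) * (d * (d * C))) *
              (R * τ ^ p.1 * F ^ 2 * (R * τ ^ p.2)) := by ring
          _ ≤ _ := mul_le_mul_of_nonneg_left h9 (by positivity)
      refine (Finset.sum_le_sum h2).trans (le_of_eq ?_)
      rw [Finset.sum_const, Finset.Nat.card_antidiagonal, nsmul_eq_mul]
      push_cast; ring
    refine (Finset.sum_le_sum fun k _ => Finset.sum_le_sum fun l _ => hent k l).trans ?_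
    simp only [Finset.sum_const, Finset.card_univ, Fintype.card_fin, nsmul_eq_mul]
    have h0 : 0 ≤ C * (R * τ ^ (a + 1)) := by positivity
    calc _ ≤ C * (R * τ ^ (a + 1)) + _ := le_add_of_nonneg_left h0
      _ = _ := by ring

/-- The `H`-valued functions `∑_j ϱ_{ij} D f_j`. -/
noncomputable def dirField (i : Fin d) (c : Idx d n) : smoothAlg d n :=
  ∑ j, regInv z r t f hε i j * gradDer z r t c (f j)

/-- This supplies the hypothesis of `exists_integral_iterDiv_sq_le` with s a multiple of RF and τ =
1 + RF². -/
lemma exists_nsq_dirField_le (d Q : ℕ) : ∃ C : ℝ, 0 ≤ C ∧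
    ∀ (n : ℕ) (z : E d) (r t : ℝ) (f : Fin d → smoothAlg d n) (ε : ℝ) (hε : 0 < ε)
      (i : Fin d), ∀ a ≤ Q, ∀ η : Fin n → E d,
      ∑ c, nsq (gradDer z r t) a (dirField z r t f hε i c) η ≤
        C * (invSq z r t f hε η * derivSq z r t f Q η) *
          (1 + invSq z r t f hε η * derivSq z r t f Q η ^ 2) ^ a := by
  obtain ⟨C, hC0, hC⟩ := exists_nsq_regInv_le d Q Q le_rfl
  refine ⟨4 ^ Q * ((Q + 1) * (C * d)), by positivity, fun n z r t f ε hε i a ha η => ?_⟩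
  set R := invSq z r t f hε η with hR
  set F := derivSq z r t f Q η with hF
  set τ := 1 + R * F ^ 2 with hτ
  have hR0 : 0 ≤ R := invSq_nonneg z r t f hε η
  have hF0 : 0 ≤ F := derivSq_nonneg z r t f Q η
  have hτ1 : 1 ≤ τ := by rw [hτ]; nlinarith [mul_nonneg hR0 (sq_nonneg F)]
  have hτ0 : 0 ≤ τ := zero_le_one.trans hτ1
  refine (Finset.sum_le_sum fun c _ => nsq_sum_mul_le _ _ a _ _ η).trans ?_
  rw [← Finset.mul_sum, Finset.sum_comm]
  have h1 : ∀ p ∈ antidiagonal a, ∑ c, (∑ j, nsq (gradDer z r t) p.1 (regInv z r t f hε i j) η) *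
      ∑ j, nsq (gradDer z r t) p.2 (gradDer z r t c (f j)) η ≤ C * R * τ ^ a * (d * F) := by
    intro p hp
    have hp' := Finset.HasAntidiagonal.mem_antidiagonal.1 hp
    rw [← Finset.mul_sum, Finset.sum_comm]
    refine mul_le_mul ?_ ?_ (Finset.sum_nonneg fun _ _ => Finset.sum_nonneg fun _ _ =>
      nsq_nonneg _ _ _ _) (by positivity)
    · refine (Finset.single_le_sum (f := fun i => ∑ j, nsq (gradDer z r t) p.1
        (regInv z r t f hε i j) η) (fun _ _ => Finset.sum_nonneg fun _ _ => nsq_nonneg _ _ _ _)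
        (Finset.mem_univ i)).trans ?_
      refine (hC n z r t f ε hε η p.1 (by omega)).trans ?_
      exact mul_le_mul_of_nonneg_left (pow_le_pow_right₀ hτ1 (by omega)) (mul_nonneg hC0 hR0)
    · refine (Finset.sum_le_sum fun j _ => nsq_le_derivSq z r t f (show p.2 ≤ Q by omega) j
        η).trans (le_of_eq ?_)
      simp [hF]
  refine (mul_le_mul_of_nonneg_left (Finset.sum_le_sum h1) (by positivity)).trans ?_
  rw [Finset.sum_const, Finset.Nat.card_antidiagonal, nsmul_eq_mul]
  have h7 : (4 : ℝ) ^ a * ((a + 1 : ℕ) : ℝ) ≤ 4 ^ Q * (Q + 1) := by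
    refine mul_le_mul (pow_le_pow_right₀ (by norm_num) (by omega)) ?_ (by positivity)
      (by positivity)
    exact_mod_cast (by omega : a + 1 ≤ Q + 1)
  calc _ = (4 : ℝ) ^ a * ((a + 1 : ℕ) : ℝ) * (C * R * τ ^ a * (d * F)) := by ring
    _ ≤ 4 ^ Q * (Q + 1) * (C * R * τ ^ a * (d * F)) :=
        mul_le_mul_of_nonneg_right h7 (by positivity)
    _ = _ := by ring

/-- The `L²` bound for the weights of the integration by parts formula. -/
lemma exists_integral_weight_sq_le [Fact (0 < r)] (Q : ℕ) : ∃ C : ℝ, 0 ≤ C ∧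
    ∀ (n : ℕ) (t : ℝ), 0 ≤ t → t ≤ 1 → ∀ (f : Fin d → smoothAlg d n) (ε : ℝ) (hε : 0 < ε)
      (I : List (Fin d)), I.length ≤ Q →
      ∫ η, (iterDiv z r t (dirField z r t f hε) I).1 η ^ 2 ∂(etaLaw z r n) ≤
        C * ∫ η, (invSq z r t f hε η * derivSq z r t f Q η *
          (1 + invSq z r t f hε η * derivSq z r t f Q η ^ 2)) ^ I.length ∂(etaLaw z r n) := by
  obtain ⟨C, hC0, hC⟩ := exists_nsq_dirField_le d Q
  obtain ⟨B, hB0, hB⟩ := exists_integral_iterDiv_sq_le z r (Fin d) Q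
  -- The factor C inside s is raised to the power |I|; (1 + C)^Q dominates all these powers at once.
  refine ⟨B * (1 + C) ^ Q, by positivity, fun n t h0 h1 f ε hε I hI => ?_⟩
  have cR := continuous_invSq z r t f hε
  have cF := continuous_derivSq z r t f Q
  have hR0 := invSq_nonneg z r t f hε
  have hF0 := derivSq_nonneg z r t f Q
  have h2 := hB n t h0 h1 (fun η => C * (invSq z r t f hε η * derivSq z r t f Q η))
    (fun η => 1 + invSq z r t f hε η * derivSq z r t f Q η ^ 2) (by fun_prop) (by fun_prop)
    (fun η => mul_nonneg hC0 (mul_nonneg (hR0 η) (hF0 η)))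
    (fun η => le_add_of_nonneg_right (mul_nonneg (hR0 η) (sq_nonneg _)))
    (dirField z r t f hε) (fun i a ha η => hC n z r t f ε hε i a ha η) I hI
  refine h2.trans ?_
  rw [mul_assoc]
  refine mul_le_mul_of_nonneg_left ?_ hB0
  simp only [mul_assoc C, mul_pow C]
  rw [integral_const_mul]
  refine mul_le_mul_of_nonneg_right ?_ (integral_nonneg fun η => pow_nonneg (mul_nonneg
    (mul_nonneg (hR0 η) (hF0 η)) (add_nonneg zero_le_one (mul_nonneg (hR0 η) (sq_nonneg _)))) _)
  calc C ^ I.length ≤ (1 + C) ^ I.length := pow_le_pow_left₀ hC0 (by linarith) _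
    _ ≤ (1 + C) ^ Q := pow_le_pow_right₀ (by linarith) hI

end Covariance

/-! ### The chain rule and the integration by parts formula for φ(f). -/

section ChainRule

variable {d n : ℕ}

/-- The partial derivative of a function on `ℝ^d`. -/
noncomputable def pder (i : Fin d) (φ : E d → ℝ) : E d → ℝ :=
  fun x => fderiv ℝ φ x (EuclideanSpace.single i 1)

/-- Iterated partial derivatives, the head of the list being applied first. -/
noncomputable def pders : List (Fin d) → (E d → ℝ) → (E d → ℝ)
  | [], φ => φ
  | i :: I, φ => pders I (pder i φ)

lemma contDiff_pder {φ : E d → ℝ} (hφ : ContDiff ℝ ((⊤ : ℕ∞) : WithTop ℕ∞) φ) (i : Fin d) :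
    ContDiff ℝ ((⊤ : ℕ∞) : WithTop ℕ∞) (pder i φ) :=
  (hφ.fderiv_right (m := ((⊤ : ℕ∞) : WithTop ℕ∞)) (by simp)).clm_apply contDiff_const

lemma contDiff_pders {φ : E d → ℝ} (hφ : ContDiff ℝ ((⊤ : ℕ∞) : WithTop ℕ∞) φ)
    (I : List (Fin d)) : ContDiff ℝ ((⊤ : ℕ∞) : WithTop ℕ∞) (pders I φ) := by
  induction I generalizing φ with
  | nil => exact hφ
  | cons i I ih => exact ih (contDiff_pder hφ i)

/-- The composition of a smooth function with a vector of smooth functions. -/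
def compAlg (f : Fin d → smoothAlg d n) (φ : E d → ℝ)
    (hφ : ContDiff ℝ ((⊤ : ℕ∞) : WithTop ℕ∞) φ) : smoothAlg d n :=
  ⟨fun η => φ (WithLp.toLp 2 fun i => (f i).1 η),
    hφ.comp ((contDiff_euclidean).2 fun i => contDiff_coe (f i))⟩

lemma partialDer_compAlg (f : Fin d → smoothAlg d n) (φ : E d → ℝ)
    (hφ : ContDiff ℝ ((⊤ : ℕ∞) : WithTop ℕ∞) φ) (a : Idx d n) :
    partialDer a (compAlg f φ hφ) =
      ∑ l, compAlg f (pder l φ) (contDiff_pder hφ l) * partialDer a (f l) := by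
  ext η
  rw [coe_sum, partialDer_apply]
  have h1 : HasFDerivAt (fun η : Fin n → E d => (WithLp.toLp 2 fun i => (f i).1 η : E d))
      ((PiLp.continuousLinearEquiv 2 ℝ (fun _ : Fin d => ℝ)).symm.toContinuousLinearMap.comp
        (ContinuousLinearMap.pi fun i => fderiv ℝ (f i).1 η)) η := by
    refine (PiLp.continuousLinearEquiv 2 ℝ (fun _ : Fin d =>
      ℝ)).symm.toContinuousLinearMap.hasFDerivAt.comp η ?_
    exact hasFDerivAt_pi.2 fun i => (differentiable_coe (f i) η).hasFDerivAt
  have h2 : HasFDerivAt (compAlg f φ hφ).1 _ η :=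
    ((hφ.differentiable (by simp)) _).hasFDerivAt.comp η h1
  rw [h2.fderiv]
  simp only [ContinuousLinearMap.comp_apply]
  set v : E d := (PiLp.continuousLinearEquiv 2 ℝ (fun _ : Fin d =>
    ℝ)).symm.toContinuousLinearMap
    ((ContinuousLinearMap.pi fun i => fderiv ℝ (f i).1 η) (basisVec a)) with hv
  have hv' : v = ∑ l, (fderiv ℝ (f l).1 η (basisVec a)) • EuclideanSpace.single l (1 : ℝ) := by
    ext k
    simp [hv, Finset.sum_apply, Pi.single_apply]
  rw [hv', map_sum]
  refine Finset.sum_congr rfl fun l _ => ?_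
  rw [map_smul, smul_eq_mul, mul_comm]
  rfl

variable (z : E d) (r t : ℝ)

lemma gradDer_compAlg (f : Fin d → smoothAlg d n) (φ : E d → ℝ)
    (hφ : ContDiff ℝ ((⊤ : ℕ∞) : WithTop ℕ∞) φ) (a : Idx d n) :
    gradDer z r t a (compAlg f φ hφ) =
      ∑ l, compAlg f (pder l φ) (contDiff_pder hφ l) * gradDer z r t a (f l) := by
  simp only [gradDer_apply, partialDer_compAlg, Finset.mul_sum]
  exact Finset.sum_congr rfl fun l _ => by ring

variable (f : Fin d → smoothAlg d n) {ε : ℝ} (hε : 0 < ε)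

/-- By the chain rule the left side is ∑_l (ϱσ)_{il} ∂_lφ(f), and ϱσ = 1 − εϱ because ϱ inverts σ +
ε. -/
lemma sum_dirField_mul_gradDer_compAlg (φ : E d → ℝ)
    (hφ : ContDiff ℝ ((⊤ : ℕ∞) : WithTop ℕ∞) φ) (i : Fin d) :
    ∑ c, dirField z r t f hε i c * gradDer z r t c (compAlg f φ hφ) =
      compAlg f (pder i φ) (contDiff_pder hφ i) -
        ε • ∑ l, regInv z r t f hε i l * compAlg f (pder l φ) (contDiff_pder hφ l) := by
  set ρ := regInv z r t f hε with hρ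
  set Φ : Fin d → smoothAlg d n := fun l => compAlg f (pder l φ) (contDiff_pder hφ l) with hΦ
  have hS : ∀ j l, regMat z r t f ε j l = gram z r t f j l +
      if j = l then algebraMap ℝ (smoothAlg d n) ε else 0 := fun j l => by
    simp [regMat, Matrix.diagonal_apply]
  have h1 : ∀ l, ∑ j, ρ i j * gram z r t f j l =
      (if i = l then 1 else 0) - ε • ρ i l := fun l => by
    have h := congrFun (congrFun (regInv_mul_regMat z r t f hε) i) l
    rw [Matrix.mul_apply, Matrix.one_apply] at h
    simp only [hS, mul_add, Finset.sum_add_distrib] at h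
    rw [← h]
    simp only [mul_ite, mul_zero, Finset.sum_ite_eq', Finset.mem_univ, if_true]
    rw [mul_comm (regInv z r t f hε i l), ← Algebra.smul_def]
    simp [hρ]
  have h2 : ∑ c, dirField z r t f hε i c * gradDer z r t c (compAlg f φ hφ) =
      ∑ l, (∑ j, ρ i j * gram z r t f j l) * Φ l := by
    simp only [dirField, gradDer_compAlg, gram, Finset.sum_mul, Finset.mul_sum]
    rw [Finset.sum_comm]
    refine Finset.sum_congr rfl fun l _ => ?_
    rw [Finset.sum_comm]
    refine Finset.sum_congr rfl fun j _ => Finset.sum_congr rfl fun c _ => ?_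
    simp only [hρ, hΦ]
    ring
  rw [h2]
  simp only [h1, sub_mul, Finset.sum_sub_distrib, Finset.smul_sum]
  simp [hΦ]

/-- One step of integration by parts, with the error due to the regularization. -/
lemma expect_pder_mul [Fact (0 < r)] (φ : E d → ℝ)
    (hφ : ContDiff ℝ ((⊤ : ℕ∞) : WithTop ℕ∞) φ) (i : Fin d) (W : smoothAlg d n) :
    expect z r n (compAlg f (pder i φ) (contDiff_pder hφ i) * W) =
      expect z r n (compAlg f φ hφ * diverg z r t fun c => W * dirField z r t f hε i c) +
      expect z r n (ε • ∑ l, (regInv z r t f hε i l *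
        compAlg f (pder l φ) (contDiff_pder hφ l)) * W) := by
  rw [mul_comm (compAlg f φ hφ), expect_diverg_mul, ← map_add]
  congr 1
  have h := sum_dirField_mul_gradDer_compAlg z r t f hε φ hφ i
  rw [← Finset.sum_mul, ← smul_mul_assoc]
  simp only [mul_assoc, ← Finset.mul_sum, h]
  ring

/-- The Cauchy–Schwarz inequality, from the discriminant of the nonnegative polynomial x ↦ ∫ (F +
xG)². -/
lemma sq_integral_mul_le [Fact (0 < r)] {F G : (Fin n → E d) → ℝ} (hF : Continuous F)
    (hG : Continuous G) :
    (∫ η, F η * G η ∂(etaLaw z r n)) ^ 2 ≤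
      (∫ η, F η ^ 2 ∂(etaLaw z r n)) * ∫ η, G η ^ 2 ∂(etaLaw z r n) := by
  have iF : Continuous fun η => F η ^ 2 := hF.pow 2
  have iG : Continuous fun η => G η ^ 2 := hG.pow 2
  have iFG : Continuous fun η => F η * G η := hF.mul hG
  have h : ∀ x : ℝ, 0 ≤ (∫ η, G η ^ 2 ∂(etaLaw z r n)) * (x * x) +
      (2 * ∫ η, F η * G η ∂(etaLaw z r n)) * x + ∫ η, F η ^ 2 ∂(etaLaw z r n) := by
    intro x
    have h0 : 0 ≤ ∫ η, (F η + x * G η) ^ 2 ∂(etaLaw z r n) :=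
      integral_nonneg fun η => sq_nonneg _
    have e : ∀ η, (F η + x * G η) ^ 2 = F η ^ 2 + ((2 * x) * (F η * G η) + x ^ 2 * G η ^ 2) :=
      fun η => by ring
    have i1 : Integrable (fun η => (2 * x) * (F η * G η)) (etaLaw z r n) :=
      (integrable_of_continuous z r iFG).const_mul _
    have i2 : Integrable (fun η => x ^ 2 * G η ^ 2) (etaLaw z r n) :=
      (integrable_of_continuous z r iG).const_mul _
    simp only [e] at h0
    have i3 : Integrable (fun η => (2 * x) * (F η * G η) + x ^ 2 * G η ^ 2) (etaLaw z r n) :=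
      i1.add i2
    rw [integral_add (integrable_of_continuous z r iF) i3, integral_add i1 i2,
      integral_const_mul, integral_const_mul] at h0
    linarith
  have := discrim_le_zero h
  unfold discrim at this
  linarith

lemma abs_integral_mul_le [Fact (0 < r)] {F G : (Fin n → E d) → ℝ} (hF : Continuous F)
    (hG : Continuous G) :
    |∫ η, F η * G η ∂(etaLaw z r n)| ≤
      √(∫ η, F η ^ 2 ∂(etaLaw z r n)) * √(∫ η, G η ^ 2 ∂(etaLaw z r n)) := by
  rw [← Real.sqrt_mul (integral_nonneg fun η => sq_nonneg _), ← Real.sqrt_sq_eq_abs]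
  exact Real.sqrt_le_sqrt (sq_integral_mul_le z r hF hG)

/-- The factor ε is kept next to ϱ, since ε|ϱ| remains bounded and tends to zero in the
nondegenerate case, whereas |ϱ| alone has no such bound in advance. -/
lemma abs_expect_error_le [Fact (0 < r)] (φ : E d → ℝ)
    (hφ : ContDiff ℝ ((⊤ : ℕ∞) : WithTop ℕ∞) φ) (B : ℝ) (hB0 : 0 ≤ B)
    (hB : ∀ l x, |pder l φ x| ≤ B) (i : Fin d) (W : smoothAlg d n) :
    |expect z r n (ε • ∑ l, (regInv z r t f hε i l *
        compAlg f (pder l φ) (contDiff_pder hφ l)) * W)| ≤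
      B * d * √(∫ η, W.1 η ^ 2 ∂(etaLaw z r n)) *
        √(∫ η, ε ^ 2 * invSq z r t f hε η ∂(etaLaw z r n)) := by
  have h1 : ∀ l, |expect z r n (ε • ((regInv z r t f hε i l *
        compAlg f (pder l φ) (contDiff_pder hφ l)) * W))| ≤
      B * (√(∫ η, W.1 η ^ 2 ∂(etaLaw z r n)) *
        √(∫ η, ε ^ 2 * invSq z r t f hε η ∂(etaLaw z r n))) := by
    intro l
    have c1 := continuous_coe W
    have c2 := continuous_coe (ε • (regInv z r t f hε i l *
        compAlg f (pder l φ) (contDiff_pder hφ l)))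
    rw [← smul_mul_assoc, mul_comm]
    refine (abs_integral_mul_le z r c1 c2).trans ?_
    rw [mul_left_comm]
    refine mul_le_mul_of_nonneg_left ?_ (Real.sqrt_nonneg _)
    rw [← Real.sqrt_sq hB0, ← Real.sqrt_mul (sq_nonneg _), ← integral_const_mul]
    refine Real.sqrt_le_sqrt (integral_mono_cube z r (c2.pow 2) (continuous_const.mul
      (continuous_const.mul (continuous_invSq z r t f hε))) fun η _ => ?_)
    change (ε * ((regInv z r t f hε i l).1 η * pder l φ (WithLp.toLp 2 fun i => (f i).1 η))) ^ 2 ≤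
      B ^ 2 * (ε ^ 2 * invSq z r t f hε η)
    have h2 : (regInv z r t f hε i l).1 η ^ 2 ≤ invSq z r t f hε η := by
      refine le_trans ?_ (Finset.single_le_sum (f := fun i => ∑ j,
        (regInv z r t f hε i j).1 η ^ 2)
        (fun _ _ => Finset.sum_nonneg fun _ _ => sq_nonneg _) (Finset.mem_univ i))
      exact Finset.single_le_sum (f := fun j => (regInv z r t f hε i j).1 η ^ 2)
        (fun _ _ => sq_nonneg _) (Finset.mem_univ l)
    have h3 : pder l φ (WithLp.toLp 2 fun i => (f i).1 η) ^ 2 ≤ B ^ 2 := by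
      rw [← sq_abs]; exact pow_le_pow_left₀ (abs_nonneg _) (hB _ _) 2
    calc _ = ε ^ 2 * ((regInv z r t f hε i l).1 η ^ 2 *
          pder l φ (WithLp.toLp 2 fun i => (f i).1 η) ^ 2) := by ring
      _ ≤ ε ^ 2 * (invSq z r t f hε η * B ^ 2) :=
        mul_le_mul_of_nonneg_left (mul_le_mul h2 h3 (sq_nonneg _) (invSq_nonneg z r t f hε η))
          (sq_nonneg _)
      _ = _ := by ring
  rw [Finset.smul_sum, map_sum]
  refine (Finset.abs_sum_le_sum_abs _ _).trans ((Finset.sum_le_sum fun l _ => h1 l).trans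
    (le_of_eq ?_))
  rw [Finset.sum_const, Finset.card_univ, Fintype.card_fin, nsmul_eq_mul]
  ring

/-- Induction on the multi-index: the hypothesis is applied to ∂_iφ with the weight W_I, and one
more integration by parts moves ∂_i off φ. Each step leaves one error, which involves only the
weight built so far. -/
lemma abs_expect_pders_sub_le [Fact (0 < r)] (w : ℕ → ℝ) (Q : ℕ)
    (hw : ∀ I : List (Fin d), I.length ≤ Q →
      ∫ η, (iterDiv z r t (dirField z r t f hε) I).1 η ^ 2 ∂(etaLaw z r n) ≤ w I.length)
    (B : ℝ) (hB0 : 0 ≤ B) (I : List (Fin d)) (hI : I.length ≤ Q) (φ : E d → ℝ)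
    (hφ : ContDiff ℝ ((⊤ : ℕ∞) : WithTop ℕ∞) φ)
    (hB : ∀ J : List (Fin d), J.length ≤ I.length → ∀ x, |pders J φ x| ≤ B) :
    |expect z r n (compAlg f (pders I φ) (contDiff_pders hφ I)) -
      expect z r n (compAlg f φ hφ * iterDiv z r t (dirField z r t f hε) I)| ≤
      ∑ k ∈ Finset.range I.length, B * d * √(w k) *
        √(∫ η, ε ^ 2 * invSq z r t f hε η ∂(etaLaw z r n)) := by
  induction I generalizing φ with
  | nil =>
    simp only [iterDiv, mul_one, pders, List.length_nil, Finset.range_zero, Finset.sum_empty]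
    simp
  | cons i I ih =>
    have hI' : I.length ≤ Q := by simp only [List.length_cons] at hI; omega
    have h1 := ih hI' (pder i φ) (contDiff_pder hφ i) fun J hJ x => by
      have := hB (i :: J) (by simpa using hJ) x
      simpa [pders] using this
    have h2 := expect_pder_mul z r t f hε φ hφ i (iterDiv z r t (dirField z r t f hε) I)
    have h3 := abs_expect_error_le z r t f hε φ hφ B hB0 (fun l x => by
      have := hB [l] (by simp) x
      simpa [pders] using this) i (iterDiv z r t (dirField z r t f hε) I)
    rw [List.length_cons, Finset.sum_range_succ]
    rw [h2] at h1
    have h4 : √(∫ η, (iterDiv z r t (dirField z r t f hε) I).1 η ^ 2 ∂(etaLaw z r n)) ≤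
        √(w I.length) := Real.sqrt_le_sqrt (hw I hI')
    have h5 := h3.trans (mul_le_mul_of_nonneg_right (mul_le_mul_of_nonneg_left h4
      (by positivity : 0 ≤ B * d)) (Real.sqrt_nonneg _))
    refine le_trans ?_ (add_le_add h1 h5)
    refine le_trans (le_of_eq ?_) (abs_add_le _ _)
    congr 1
    simp only [pders, iterDiv]
    ring

/-- The integration by parts inequality for smooth functions of `η`. -/
lemma abs_expect_pders_le [Fact (0 < r)] (w : ℕ → ℝ) (Q : ℕ)
    (hw : ∀ I : List (Fin d), I.length ≤ Q →
      ∫ η, (iterDiv z r t (dirField z r t f hε) I).1 η ^ 2 ∂(etaLaw z r n) ≤ w I.length)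
    (B : ℝ) (hB0 : 0 ≤ B) (I : List (Fin d)) (hI : I.length ≤ Q) (φ : E d → ℝ)
    (hφ : ContDiff ℝ ((⊤ : ℕ∞) : WithTop ℕ∞) φ)
    (hB : ∀ J : List (Fin d), J.length ≤ I.length → ∀ x, |pders J φ x| ≤ B) :
    |∫ η, pders I φ (WithLp.toLp 2 fun i => (f i).1 η) ∂(etaLaw z r n)| ≤
      √(∫ η, φ (WithLp.toLp 2 fun i => (f i).1 η) ^ 2 ∂(etaLaw z r n)) * √(w I.length) +
      ∑ k ∈ Finset.range I.length, B * d * √(w k) *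
        √(∫ η, ε ^ 2 * invSq z r t f hε η ∂(etaLaw z r n)) := by
  have h1 := abs_expect_pders_sub_le z r t f hε w Q hw B hB0 I hI φ hφ hB
  have h2 : |expect z r n (compAlg f φ hφ * iterDiv z r t (dirField z r t f hε) I)| ≤
      √(∫ η, φ (WithLp.toLp 2 fun i => (f i).1 η) ^ 2 ∂(etaLaw z r n)) * √(w I.length) := by
    refine (abs_integral_mul_le z r (continuous_coe (compAlg f φ hφ)) (continuous_coe _)).trans ?_
    exact mul_le_mul_of_nonneg_left (Real.sqrt_le_sqrt (hw I hI)) (Real.sqrt_nonneg _)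
  change |expect z r n (compAlg f (pders I φ) (contDiff_pders hφ I))| ≤ _
  have h3 := abs_add_le (expect z r n (compAlg f (pders I φ) (contDiff_pders hφ I)) -
    expect z r n (compAlg f φ hφ * iterDiv z r t (dirField z r t f hε) I))
    (expect z r n (compAlg f φ hφ * iterDiv z r t (dirField z r t f hε) I))
  rw [sub_add_cancel] at h3
  linarith

end ChainRule

/-! ### From functionals on the sample space to smooth functions of η. -/

section Sections

variable {d n : ℕ} (z : E d) (r t : ℝ)

/-- The iterated derivative `D_{I_0} ⋯ D_{I_{j-1}} F`. -/
noncomputable def iterDer : (j : ℕ) → (Fin j → Idx d n) → smoothAlg d n → smoothAlg d n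
  | 0, _, F => F
  | j + 1, I, F => gradDer z r t (I 0) (iterDer j (fun i => I i.succ) F)

lemma iterDer_succ_last (j : ℕ) (I : Fin (j + 1) → Idx d n) (F : smoothAlg d n) :
    iterDer z r t (j + 1) I F =
      iterDer z r t j (fun i => I i.castSucc) (gradDer z r t (I (Fin.last j)) F) := by
  induction j with
  | zero => rfl
  | succ j ih =>
    rw [iterDer, ih]
    rfl

/-- `iterDer` adds new derivatives on the outside and `nsq` on the inside, so the multi-indices are
split at their last entry. -/
lemma sum_iterDer_sq (j : ℕ) (F : smoothAlg d n) (η : Fin n → E d) :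
    ∑ I : Fin j → Idx d n, (iterDer z r t j I F).1 η ^ 2 = nsq (gradDer z r t) j F η := by
  induction j generalizing F with
  | zero => simp [iterDer, nsq_zero]
  | succ j ih =>
    rw [← (Fin.snocEquiv fun _ : Fin (j + 1) => Idx d n).sum_comp, Fintype.sum_prod_type, nsq_succ]
    refine Finset.sum_congr rfl fun a _ => ?_
    rw [← ih]
    refine Finset.sum_congr rfl fun I _ => ?_
    rw [iterDer_succ_last]
    simp [Fin.snocEquiv]

/-- The section of a functional at fixed `(ε, ζ)`. -/
def sect (u : Omega d n → ℝ) (hu : ∀ e : (Fin n → Bool) × (Fin n → E d),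
    ContDiff ℝ ((⊤ : ℕ∞) : WithTop ℕ∞) fun η : Fin n → E d => u (η, e))
    (e : (Fin n → Bool) × (Fin n → E d)) : smoothAlg d n := ⟨fun η => u (η, e), hu e⟩

variable {u : Omega d n → ℝ} (hu : ∀ e : (Fin n → Bool) × (Fin n → E d),
    ContDiff ℝ ((⊤ : ℕ∞) : WithTop ℕ∞) fun η : Fin n → E d => u (η, e))
  (θ : (Fin n → E d) → ℝ)

lemma iterGrad_apply (j : ℕ) (I : Fin j → Idx d n) (e : (Fin n → Bool) × (Fin n → E d))
    (η : Fin n → E d) :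
    iterGrad (psi z r) θ u j (η, e) I = (iterDer z r (θ e.2) j I (sect u hu e)).1 η := by
  induction j generalizing η with
  | zero => rfl
  | succ j ih =>
    change θ e.2 * psi z r (η (I 0).1) * fderiv ℝ (fun η : Fin n → E d =>
      iterGrad (psi z r) θ u j (η, e) fun i => I i.succ) η (basisVec (I 0)) = _
    simp only [ih]
    rfl

lemma norm_iterGrad_sq (j : ℕ) (e : (Fin n → Bool) × (Fin n → E d)) (η : Fin n → E d) :
    ‖iterGrad (psi z r) θ u j (η, e)‖ ^ 2 =
      nsq (gradDer z r (θ e.2)) j (sect u hu e) η := by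
  rw [EuclideanSpace.real_norm_sq_eq, ← sum_iterDer_sq]
  simp only [iterGrad_apply z r hu]

lemma inner_iterGrad_one {v : Omega d n → ℝ} (hv : ∀ e : (Fin n → Bool) × (Fin n → E d),
    ContDiff ℝ ((⊤ : ℕ∞) : WithTop ℕ∞) fun η : Fin n → E d => v (η, e))
    (e : (Fin n → Bool) × (Fin n → E d)) (η : Fin n → E d) :
    inner ℝ (iterGrad (psi z r) θ u 1 (η, e)) (iterGrad (psi z r) θ v 1 (η, e)) =
      ∑ c, (gradDer z r (θ e.2) c (sect u hu e)).1 η *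
        (gradDer z r (θ e.2) c (sect v hv e)).1 η := by
  rw [PiLp.inner_apply]
  simp only [iterGrad_apply z r hu, iterGrad_apply z r hv]
  rw [← (Equiv.funUnique (Fin 1) (Idx d n)).symm.sum_comp]
  refine Finset.sum_congr rfl fun c _ => ?_
  simp [iterDer, mul_comm]

-- The partial derivative is a pointwise limit of difference quotients, each jointly measurable in
-- all variables.
include hu in
lemma measurable_gradCoord (hm : Measurable u) (hθ : Measurable θ) (a : Idx d n) :
    Measurable (gradCoord (psi z r) θ a u) := by
  unfold gradCoord
  have hψ : Measurable fun ω : Omega d n => psi z r (ω.1 a.1) :=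
    (contDiff_psi z r).continuous.measurable.comp
      ((measurable_pi_apply a.1).comp measurable_fst)
  refine ((hθ.comp measurable_snd.snd).mul hψ).mul ?_
  set v : Fin n → E d := Pi.single a.1 (EuclideanSpace.single a.2 1) with hv
  refine measurable_of_tendsto_metrizable (f := fun (k : ℕ) (ω : Omega d n) =>
    ((k : ℝ) + 1) * (u (ω.1 + ((k : ℝ) + 1)⁻¹ • v, ω.2) - u ω)) (fun k => ?_) ?_
  · refine measurable_const.mul ((hm.comp ?_).sub hm)
    exact (measurable_fst.add_const _).prodMk measurable_snd
  · rw [tendsto_pi_nhds]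
    intro ω
    have h1 := (((hu ω.2).differentiable (by simp)) ω.1).hasFDerivAt.hasLineDerivAt v
    have h2 := h1.tendsto_slope_zero
    have h3 : Tendsto (fun k : ℕ => ((k : ℝ) + 1)⁻¹) atTop (𝓝[≠] 0) := by
      refine tendsto_nhdsWithin_iff.2 ⟨?_, Eventually.of_forall fun k => ?_⟩
      · simpa using tendsto_one_div_add_atTop_nhds_zero_nat (𝕜 := ℝ)
      · simp only [Set.mem_compl_iff, Set.mem_singleton_iff]; positivity
    have h4 := h2.comp h3
    refine h4.congr fun k => ?_
    simp

include hu in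
lemma measurable_iterGrad_apply (hm : Measurable u) (hθ : Measurable θ) (j : ℕ)
    (I : Fin j → Idx d n) : Measurable fun ω => iterGrad (psi z r) θ u j ω I := by
  induction j with
  | zero => exact hm
  | succ j ih =>
    refine measurable_gradCoord z r (u := fun ω' => iterGrad (psi z r) θ u j ω' fun i => I i.succ)
      (fun e => ?_) θ (ih _) hθ (I 0)
    simp only [iterGrad_apply z r hu]
    exact contDiff_coe _

include hu in
lemma measurable_iterGrad (hm : Measurable u) (hθ : Measurable θ) (j : ℕ) :
    Measurable fun ω => iterGrad (psi z r) θ u j ω := by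
  refine (WithLp.measurable_toLp 2 _).comp (measurable_pi_lambda _ fun I => ?_ :
    Measurable fun ω => WithLp.ofLp (iterGrad (psi z r) θ u j ω))
  exact measurable_iterGrad_apply z r hu θ hm hθ j I

end Sections

/-! ### The integration by parts inequality for test functionals. -/

section Global

variable {d n : ℕ}

/-- The squared Euclidean norm of the inverse of `M + ε`. -/
noncomputable def regFun (ε : ℝ) (M : Fin d → Fin d → ℝ) : ℝ :=
  ∑ i, ∑ j, ((Matrix.of M + ε • (1 : Matrix (Fin d) (Fin d) ℝ))⁻¹ i j) ^ 2

lemma regFun_nonneg (ε : ℝ) (M : Fin d → Fin d → ℝ) : 0 ≤ regFun ε M :=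
  Finset.sum_nonneg fun _ _ => Finset.sum_nonneg fun _ _ => sq_nonneg _

lemma measurable_matrix_inv_apply (ε : ℝ) (i j : Fin d) : Measurable fun M : Fin d → Fin d → ℝ =>
    (Matrix.of M + ε • (1 : Matrix (Fin d) (Fin d) ℝ))⁻¹ i j := by
  have hc : Continuous fun M : Fin d → Fin d → ℝ =>
      (Matrix.of M + ε • (1 : Matrix (Fin d) (Fin d) ℝ)) :=
    (continuous_id (X := Matrix (Fin d) (Fin d) ℝ)).add continuous_const
  have h1 : Continuous fun M : Fin d → Fin d → ℝ =>
      (Matrix.of M + ε • (1 : Matrix (Fin d) (Fin d) ℝ)).det := hc.matrix_det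
  have h2 : Continuous fun M : Fin d → Fin d → ℝ =>
      (Matrix.of M + ε • (1 : Matrix (Fin d) (Fin d) ℝ)).adjugate i j :=
    hc.matrix_adjugate.matrix_elem i j
  simp only [Matrix.inv_def, Ring.inverse_eq_inv', Matrix.smul_apply, smul_eq_mul]
  exact h1.measurable.inv.mul h2.measurable

lemma measurable_regFun (ε : ℝ) : Measurable (regFun (d := d) ε) :=
  Finset.measurable_sum _ fun i _ => Finset.measurable_sum _ fun j _ =>
    (measurable_matrix_inv_apply ε i j).pow_const 2

/-- The Malliavin matrix of a family of derivatives. -/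
noncomputable def malMat (G : Fin d → (j : ℕ) → Omega d n → HTensor d n j) (ω : Omega d n) :
    Fin d → Fin d → ℝ :=
  fun i j => inner ℝ (G i 1 ω) (G j 1 ω)

/-- `∑_i ∑_{1 ≤ m ≤ Q + 1} ‖D^m f_i‖²`. -/
noncomputable def derSq (G : Fin d → (j : ℕ) → Omega d n → HTensor d n j) (Q : ℕ)
    (ω : Omega d n) : ℝ :=
  ∑ i, ∑ m ∈ Finset.range (Q + 1), ‖G i (m + 1) ω‖ ^ 2

lemma derSq_nonneg (G : Fin d → (j : ℕ) → Omega d n → HTensor d n j) (Q : ℕ)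
    (ω : Omega d n) : 0 ≤ derSq G Q ω :=
  Finset.sum_nonneg fun _ _ => Finset.sum_nonneg fun _ _ => sq_nonneg _

/-- The quantity which dominates the weights of the integration by parts formula. -/
noncomputable def domin (G : Fin d → (j : ℕ) → Omega d n → HTensor d n j) (Q : ℕ) (ε : ℝ)
    (ω : Omega d n) : ℝ :=
  regFun ε (malMat G ω) * derSq G Q ω * (1 + regFun ε (malMat G ω) * derSq G Q ω ^ 2)

lemma domin_nonneg (G : Fin d → (j : ℕ) → Omega d n → HTensor d n j) (Q : ℕ) (ε : ℝ)
    (ω : Omega d n) : 0 ≤ domin G Q ε ω :=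
  mul_nonneg (mul_nonneg (regFun_nonneg _ _) (derSq_nonneg _ _ _))
    (add_nonneg zero_le_one (mul_nonneg (regFun_nonneg _ _) (sq_nonneg _)))

variable (z : E d) (r : ℝ) (θ : (Fin n → E d) → ℝ)

/-- The stochastic derivatives of a vector of smooth functionals. -/
noncomputable def gradFam (u : Fin d → Omega d n → ℝ) (i : Fin d) (j : ℕ) (ω : Omega d n) :
    HTensor d n j := iterGrad (psi z r) θ (u i) j ω

variable {u : Fin d → Omega d n → ℝ} (hu : ∀ i, ∀ e : (Fin n → Bool) × (Fin n → E d),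
    ContDiff ℝ ((⊤ : ℕ∞) : WithTop ℕ∞) fun η : Fin n → E d => u i (η, e))

lemma regFun_gradFam {ε : ℝ} (hε : 0 < ε) (e : (Fin n → Bool) × (Fin n → E d))
    (η : Fin n → E d) :
    regFun ε (malMat (gradFam z r θ u) (η, e)) =
      invSq z r (θ e.2) (fun i => sect (u i) (hu i) e) hε η := by
  unfold regFun invSq
  have h := regInv_map_evalAt z r (θ e.2) (fun i => sect (u i) (hu i) e) hε η
  have h2 : (Matrix.of fun i j => (gram z r (θ e.2) (fun i => sect (u i) (hu i) e) i j).1 η) =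
      Matrix.of (malMat (gradFam z r θ u) (η, e)) := by
    ext i j
    simp only [Matrix.of_apply, malMat, gradFam, gram, coe_sum, coe_mul]
    rw [inner_iterGrad_one z r (hu i) θ (hu j)]
  rw [h2] at h
  rw [← h]
  rfl

lemma derSq_gradFam (Q : ℕ) (e : (Fin n → Bool) × (Fin n → E d)) (η : Fin n → E d) :
    derSq (gradFam z r θ u) Q (η, e) =
      derivSq z r (θ e.2) (fun i => sect (u i) (hu i) e) Q η := by
  unfold derSq derivSq gradFam
  simp only [norm_iterGrad_sq z r (hu _)]

lemma measurable_malMat (G : Fin d → (j : ℕ) → Omega d n → HTensor d n j)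
    (hG : ∀ i j, Measurable (G i j)) : Measurable (malMat G) :=
  measurable_pi_lambda _ fun i => measurable_pi_lambda _ fun j => (hG i 1).inner (hG j 1)

lemma measurable_derSq (G : Fin d → (j : ℕ) → Omega d n → HTensor d n j)
    (hG : ∀ i j, Measurable (G i j)) (Q : ℕ) : Measurable (derSq G Q) :=
  Finset.measurable_sum _ fun i _ => Finset.measurable_sum _ fun m _ =>
    (hG i (m + 1)).norm.pow_const 2

lemma measurable_domin (G : Fin d → (j : ℕ) → Omega d n → HTensor d n j)
    (hG : ∀ i j, Measurable (G i j)) (Q : ℕ) (ε : ℝ) : Measurable (domin G Q ε) := by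
  have h1 : Measurable fun ω => regFun ε (malMat G ω) :=
    (measurable_regFun ε).comp (measurable_malMat G hG)
  have h2 := measurable_derSq G hG Q
  exact (h1.mul h2).mul (measurable_const.add (h1.mul (h2.pow_const 2)))

lemma ofReal_sqrt_integral [Fact (0 < r)] {F : (Fin n → E d) → ℝ} (hF : Continuous F)
    (hF0 : ∀ η, 0 ≤ F η) :
    ENNReal.ofReal √(∫ η, F η ∂(etaLaw z r n)) =
      (∫⁻ η, ENNReal.ofReal (F η) ∂(etaLaw z r n)) ^ (1 / 2 : ℝ) := by
  rw [Real.sqrt_eq_rpow, ← ENNReal.ofReal_rpow_of_nonneg (integral_nonneg hF0) (by norm_num),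
    ofReal_integral_eq_lintegral_ofReal (integrable_of_continuous z r hF)
      (Eventually.of_forall hF0)]

/-- A second Cauchy–Schwarz inequality, now in the frozen variables, turns products of conditional
L² norms into products of global ones. -/
lemma lintegral_lintegral_sqrt_mul_le {α β : Type*} [MeasurableSpace α] [MeasurableSpace β]
    (μ : Measure α) (lam : Measure β) [SFinite μ] [SFinite lam] {X Y : α × β → ℝ≥0∞}
    (hX : Measurable X) (hY : Measurable Y) :
    ∫⁻ b, (∫⁻ a, X (a, b) ∂μ) ^ (1 / 2 : ℝ) * (∫⁻ a, Y (a, b) ∂μ) ^ (1 / 2 : ℝ) ∂lam ≤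
      (∫⁻ p, X p ∂(μ.prod lam)) ^ (1 / 2 : ℝ) * (∫⁻ p, Y p ∂(μ.prod lam)) ^ (1 / 2 : ℝ) := by
  rw [lintegral_prod_symm' _ hX, lintegral_prod_symm' _ hY]
  exact ENNReal.lintegral_mul_norm_pow_le hX.lintegral_prod_left'.aemeasurable
    hY.lintegral_prod_left'.aemeasurable (by norm_num) (by norm_num) (by norm_num)

/-- The integration by parts inequality for test functionals. -/
lemma exists_enorm_integral_pders_le [Fact (0 < r)] (q : ℕ) : ∃ C : ℝ, 0 ≤ C ∧
    ∀ (n : ℕ) (θ : (Fin n → E d) → ℝ), Measurable θ → (∀ x, θ x ∈ Set.Icc (0 : ℝ) 1) →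
    ∀ (lam : Measure ((Fin n → Bool) × (Fin n → E d))) [IsFiniteMeasure lam]
      (u : Fin d → Omega d n → ℝ), (∀ i, Measurable (u i)) →
      (∀ i, ∀ e : (Fin n → Bool) × (Fin n → E d),
        ContDiff ℝ ((⊤ : ℕ∞) : WithTop ℕ∞) fun η : Fin n → E d => u i (η, e)) →
    ∀ (ε : ℝ), 0 < ε → ∀ (I : List (Fin d)), I.length = q → ∀ (φ : E d → ℝ),
      ContDiff ℝ ((⊤ : ℕ∞) : WithTop ℕ∞) φ → ∀ B : ℝ, 0 ≤ B →
      (∀ J : List (Fin d), J.length ≤ q → ∀ x, |pders J φ x| ≤ B) →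
      ‖∫ ω, pders I φ (WithLp.toLp 2 fun i => u i ω) ∂((etaLaw z r n).prod lam)‖ₑ ≤
        (∫⁻ ω, ENNReal.ofReal (φ (WithLp.toLp 2 fun i => u i ω) ^ 2)
          ∂((etaLaw z r n).prod lam)) ^ (1 / 2 : ℝ) *
        (∫⁻ ω, ENNReal.ofReal (C * domin (gradFam z r θ u) q ε ω ^ q)
          ∂((etaLaw z r n).prod lam)) ^ (1 / 2 : ℝ) +
        ∑ k ∈ Finset.range q, ENNReal.ofReal (B * d) *
          ((∫⁻ ω, ENNReal.ofReal (C * domin (gradFam z r θ u) q ε ω ^ k)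
            ∂((etaLaw z r n).prod lam)) ^ (1 / 2 : ℝ) *
          (∫⁻ ω, ENNReal.ofReal (ε ^ 2 * regFun ε (malMat (gradFam z r θ u) ω))
            ∂((etaLaw z r n).prod lam)) ^ (1 / 2 : ℝ)) := by
  obtain ⟨C, hC0, hC⟩ := exists_integral_weight_sq_le z r q
  refine ⟨C, hC0, fun n θ hθ hθ1 lam _ u hm hu ε hε I hI φ hφ B hB0 hB => ?_⟩
  have hG : ∀ i j, Measurable (gradFam z r θ u i j) := fun i j =>
    measurable_iterGrad z r (hu i) θ (hm i) hθ j
  have hU : Measurable fun ω : Omega d n => (WithLp.toLp 2 fun i => u i ω : E d) :=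
    (WithLp.measurable_toLp 2 _).comp (measurable_pi_lambda _ hm)
  have hD : ∀ k, Measurable fun ω => ENNReal.ofReal (C * domin (gradFam z r θ u) q ε ω ^ k) :=
    fun k => (measurable_const.mul ((measurable_domin _ hG q ε).pow_const k)).ennreal_ofReal
  have hR : Measurable fun ω =>
      ENNReal.ofReal (ε ^ 2 * regFun ε (malMat (gradFam z r θ u) ω)) :=
    (measurable_const.mul ((measurable_regFun ε).comp (measurable_malMat _ hG))).ennreal_ofReal
  have hφm : Measurable fun ω => ENNReal.ofReal (φ (WithLp.toLp 2 fun i => u i ω) ^ 2) :=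
    ((hφ.continuous.measurable.comp hU).pow_const 2).ennreal_ofReal
  have hint : Integrable (fun ω => pders I φ (WithLp.toLp 2 fun i => u i ω))
      ((etaLaw z r n).prod lam) :=
    Integrable.of_bound ((contDiff_pders hφ I).continuous.measurable.comp hU).aestronglyMeasurable
      B (Eventually.of_forall fun ω => hB I hI.le _)
  -- Condition on (ε, ζ): then θ is a constant in [0, 1] and the section of u is a vector of smooth
  -- functions of η. The measure `lam` need not be a probability, which leaves room for the
  -- restriction to Ξ.
  rw [integral_prod_symm _ hint]
  refine (enorm_integral_le_lintegral_enorm _).trans ?_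
  have hpt : ∀ e : (Fin n → Bool) × (Fin n → E d),
      ‖∫ η, pders I φ (WithLp.toLp 2 fun i => u i (η, e)) ∂(etaLaw z r n)‖ₑ ≤
        (∫⁻ η, ENNReal.ofReal (φ (WithLp.toLp 2 fun i => u i (η, e)) ^ 2)
          ∂(etaLaw z r n)) ^ (1 / 2 : ℝ) *
        (∫⁻ η, ENNReal.ofReal (C * domin (gradFam z r θ u) q ε (η, e) ^ q)
          ∂(etaLaw z r n)) ^ (1 / 2 : ℝ) +
        ∑ k ∈ Finset.range q, ENNReal.ofReal (B * d) *
          ((∫⁻ η, ENNReal.ofReal (C * domin (gradFam z r θ u) q ε (η, e) ^ k)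
            ∂(etaLaw z r n)) ^ (1 / 2 : ℝ) *
          (∫⁻ η, ENNReal.ofReal (ε ^ 2 * regFun ε (malMat (gradFam z r θ u) (η, e)))
            ∂(etaLaw z r n)) ^ (1 / 2 : ℝ)) := by
    intro e
    set f : Fin d → smoothAlg d n := fun i => sect (u i) (hu i) e with hf
    have e1 : ∀ η, domin (gradFam z r θ u) q ε (η, e) =
        invSq z r (θ e.2) f hε η * derivSq z r (θ e.2) f q η *
          (1 + invSq z r (θ e.2) f hε η * derivSq z r (θ e.2) f q η ^ 2) := fun η => by
      unfold domin
      rw [regFun_gradFam z r θ hu hε, derSq_gradFam z r θ hu]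
    have e2 : ∀ η, regFun ε (malMat (gradFam z r θ u) (η, e)) =
        invSq z r (θ e.2) f hε η := fun η => regFun_gradFam z r θ hu hε e η
    have cR := continuous_invSq z r (θ e.2) f hε
    have cF := continuous_derivSq z r (θ e.2) f q
    have cD : Continuous fun η => domin (gradFam z r θ u) q ε (η, e) := by
      simp only [e1]; fun_prop
    have cD' : ∀ k, Continuous fun η => C * domin (gradFam z r θ u) q ε (η, e) ^ k := fun k =>
      continuous_const.mul (cD.pow k)
    -- The bounds w(k) for the weights are the conditional integrals of the dominating quantity.
    have h := abs_expect_pders_le z r (θ e.2) f hε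
      (fun k => ∫ η, C * domin (gradFam z r θ u) q ε (η, e) ^ k ∂(etaLaw z r n)) q
      (fun I hI => by
        rw [integral_const_mul]
        simp only [e1]
        exact hC n (θ e.2) (hθ1 _).1 (hθ1 _).2 f ε hε I hI)
      B hB0 I hI.le φ hφ (fun J hJ x => hB J (by omega) x)
    have cφ : Continuous fun η => φ (WithLp.toLp 2 fun i => u i (η, e)) ^ 2 :=
      (continuous_coe (compAlg f φ hφ)).pow 2
    have hD0 : ∀ k η, 0 ≤ C * domin (gradFam z r θ u) q ε (η, e) ^ k := fun k η =>
      mul_nonneg hC0 (pow_nonneg (domin_nonneg _ _ _ _) _)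
    have hR0 : ∀ η, 0 ≤ ε ^ 2 * regFun ε (malMat (gradFam z r θ u) (η, e)) := fun η =>
      mul_nonneg (sq_nonneg _) (regFun_nonneg _ _)
    have cR' : Continuous fun η => ε ^ 2 * regFun ε (malMat (gradFam z r θ u) (η, e)) := by
      simp only [e2]; fun_prop
    rw [hI] at h
    simp only [← e2] at h
    rw [← ofReal_sqrt_integral z r cφ fun η => sq_nonneg _]
    simp only [← ofReal_sqrt_integral z r (cD' _) (hD0 _), ← ofReal_sqrt_integral z r cR' hR0]
    rw [← ofReal_norm, Real.norm_eq_abs]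
    refine (ENNReal.ofReal_le_ofReal h).trans ?_
    rw [ENNReal.ofReal_add (by positivity) (Finset.sum_nonneg fun _ _ => by positivity),
      ENNReal.ofReal_mul (Real.sqrt_nonneg _),
      ENNReal.ofReal_sum_of_nonneg fun _ _ => by positivity]
    refine add_le_add le_rfl (Finset.sum_le_sum fun k _ => ?_)
    rw [mul_assoc, ENNReal.ofReal_mul (by positivity), ENNReal.ofReal_mul (Real.sqrt_nonneg _)]
  refine (lintegral_mono hpt).trans ?_
  have hA : Measurable fun e : (Fin n → Bool) × (Fin n → E d) =>
      (∫⁻ η, ENNReal.ofReal (φ (WithLp.toLp 2 fun i => u i (η, e)) ^ 2)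
          ∂(etaLaw z r n)) ^ (1 / 2 : ℝ) *
        (∫⁻ η, ENNReal.ofReal (C * domin (gradFam z r θ u) q ε (η, e) ^ q)
          ∂(etaLaw z r n)) ^ (1 / 2 : ℝ) :=
    (hφm.lintegral_prod_left'.pow_const _).mul ((hD q).lintegral_prod_left'.pow_const _)
  have hB' : ∀ k, Measurable fun e : (Fin n → Bool) × (Fin n → E d) => ENNReal.ofReal (B * d) *
      ((∫⁻ η, ENNReal.ofReal (C * domin (gradFam z r θ u) q ε (η, e) ^ k)
            ∂(etaLaw z r n)) ^ (1 / 2 : ℝ) *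
          (∫⁻ η, ENNReal.ofReal (ε ^ 2 * regFun ε (malMat (gradFam z r θ u) (η, e)))
            ∂(etaLaw z r n)) ^ (1 / 2 : ℝ)) := fun k =>
    measurable_const.mul (((hD k).lintegral_prod_left'.pow_const _).mul
      (hR.lintegral_prod_left'.pow_const _))
  rw [lintegral_add_left hA]
  refine add_le_add (lintegral_lintegral_sqrt_mul_le _ _ hφm (hD q)) ?_
  rw [lintegral_finsetSum _ fun k _ => hB' k]
  refine Finset.sum_le_sum fun k _ => ?_
  rw [lintegral_const_mul' _ _ ENNReal.ofReal_ne_top]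
  exact mul_le_mul_right (lintegral_lintegral_sqrt_mul_le _ _ (hD k) hR) _

end Global

/-! ### Moment bounds for the dominating quantity. -/

section Holder

/-- The binomial formula. It is the source of the sum over M and of the exponents k + M and k + 2M
in K_q. -/
lemma mul_one_add_pow_le {R F : ℝ} (hR : 0 ≤ R) (hF : 0 ≤ F) (k : ℕ) :
    (R * F * (1 + R * F ^ 2)) ^ k ≤
      2 ^ k * ∑ M ∈ Finset.range (k + 1), R ^ (k + M) * F ^ (k + 2 * M) := by
  rw [mul_pow, add_comm (1 : ℝ), add_pow, Finset.mul_sum, Finset.mul_sum]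
  refine Finset.sum_le_sum fun M _ => ?_
  have h : ((k.choose M : ℕ) : ℝ) ≤ 2 ^ k := by exact_mod_cast Nat.choose_le_two_pow k M
  calc (R * F) ^ k * ((R * F ^ 2) ^ M * 1 ^ (k - M) * (k.choose M : ℝ))
      = (k.choose M : ℝ) * (R ^ (k + M) * F ^ (k + 2 * M)) := by
        rw [pow_add, pow_add, pow_mul, one_pow, mul_pow, mul_pow]; ring
    _ ≤ _ := mul_le_mul_of_nonneg_right h (by positivity)

lemma pow_two_mul_rpow_half (x : ℝ≥0∞) (m : ℕ) : (x ^ (2 * m)) ^ (1 / 2 : ℝ) = x ^ m := by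
  rw [mul_comm, pow_mul, ← ENNReal.rpow_natCast (x ^ m) 2, ← ENNReal.rpow_mul]
  norm_num

lemma rpow_half_sum_le {ι : Type*} (s : Finset ι) (x : ι → ℝ≥0∞) :
    (∑ i ∈ s, x i) ^ (1 / 2 : ℝ) ≤ ∑ i ∈ s, x i ^ (1 / 2 : ℝ) :=
  Finset.le_sum_of_subadditive (fun y : ℝ≥0∞ => y ^ (1 / 2 : ℝ)) (by simp)
    (fun _ _ => ENNReal.rpow_add_le_add_rpow _ _ (by norm_num) (by norm_num)) _ _

lemma sum_pow_le_card_pow_mul {ι : Type*} (s : Finset ι) (x : ι → ℝ≥0∞) {k : ℕ} (hk : k ≠ 0) :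
    (∑ i ∈ s, x i) ^ k ≤ (s.card : ℝ≥0∞) ^ k * ∑ i ∈ s, x i ^ k := by
  rcases s.eq_empty_or_nonempty with rfl | hs
  · simp [hk]
  · obtain ⟨a, ha, hmax⟩ := s.exists_max_image x hs
    calc (∑ i ∈ s, x i) ^ k ≤ (s.card • x a) ^ k :=
          pow_le_pow_left' (Finset.sum_le_card_nsmul _ _ _ hmax) k
      _ = (s.card : ℝ≥0∞) ^ k * x a ^ k := by rw [nsmul_eq_mul, mul_pow]
      _ ≤ _ := mul_le_mul_right (Finset.single_le_sum (f := fun i => x i ^ k)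
          (fun _ _ => zero_le) ha) _

lemma lintegral_enorm_pow_le {Ω F : Type*} [MeasurableSpace Ω] [NormedAddCommGroup F]
    {P : Measure Ω} [IsProbabilityMeasure P] {g : Ω → F} (hg : AEStronglyMeasurable g P)
    {s p : ℕ} (hs : s ≠ 0) (hsp : s ≤ p) :
    ∫⁻ ω, ‖g ω‖ₑ ^ s ∂P ≤ eLpNorm g (p : ℝ≥0∞) P ^ s := by
  have h := eLpNorm_nnreal_pow_eq_lintegral (f := g) (μ := P) (p := (s : ℝ≥0))
    (by exact_mod_cast hs)
  simp only [NNReal.coe_natCast, ENNReal.rpow_natCast, ENNReal.coe_natCast] at h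
  rw [← h]
  exact pow_le_pow_left' (eLpNorm_le_eLpNorm_of_exponent_le (by exact_mod_cast hsp) hg) s

variable {d n : ℕ} {P : Measure (Omega d n)}

lemma lintegral_derSq_pow_le [IsProbabilityMeasure P]
    {G : Fin d → (j : ℕ) → Omega d n → HTensor d n j} (hG : ∀ i j, Measurable (G i j))
    (Q : ℕ) {p s : ℕ} (hs : 2 * s ≤ p) {N : ℝ≥0∞}
    (hN : ∀ i, ∀ m ∈ Finset.range (Q + 1), eLpNorm (G i (m + 1)) (p : ℝ≥0∞) P ≤ N) :
    ∫⁻ ω, ENNReal.ofReal (derSq G Q ω) ^ s ∂P ≤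
      ((d * (Q + 1) + 1 : ℕ) : ℝ≥0∞) ^ (2 * s) * N ^ (2 * s) := by
  rcases eq_or_ne s 0 with rfl | hs0
  · simp
  set S : Finset (Fin d × ℕ) := Finset.univ ×ˢ Finset.range (Q + 1) with hS
  have hcard : S.card = d * (Q + 1) := by simp [hS]
  have e1 : ∀ ω, ENNReal.ofReal (derSq G Q ω) = ∑ a ∈ S, ‖G a.1 (a.2 + 1) ω‖ₑ ^ 2 := fun ω => by
    rw [hS, Finset.sum_product]
    unfold derSq
    rw [ENNReal.ofReal_sum_of_nonneg fun _ _ => Finset.sum_nonneg fun _ _ => sq_nonneg _]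
    refine Finset.sum_congr rfl fun i _ => ?_
    rw [ENNReal.ofReal_sum_of_nonneg fun _ _ => sq_nonneg _]
    refine Finset.sum_congr rfl fun m _ => ?_
    rw [ENNReal.ofReal_pow (norm_nonneg _), ofReal_norm]
  calc ∫⁻ ω, ENNReal.ofReal (derSq G Q ω) ^ s ∂P
      ≤ ∫⁻ ω, (S.card : ℝ≥0∞) ^ s * ∑ a ∈ S, ‖G a.1 (a.2 + 1) ω‖ₑ ^ (2 * s) ∂P := by
        refine lintegral_mono fun ω => ?_
        simp only [e1, pow_mul]
        exact sum_pow_le_card_pow_mul S _ hs0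
    _ = (S.card : ℝ≥0∞) ^ s * ∑ a ∈ S, ∫⁻ ω, ‖G a.1 (a.2 + 1) ω‖ₑ ^ (2 * s) ∂P := by
        rw [lintegral_const_mul' _ _ (by simp),
          lintegral_finsetSum _ fun a _ => (hG _ _).enorm.pow_const _]
    _ ≤ (S.card : ℝ≥0∞) ^ s * ∑ a ∈ S, N ^ (2 * s) := by
        gcongr with a ha
        refine (lintegral_enorm_pow_le (hG _ _).aestronglyMeasurable (by omega) hs).trans ?_
        exact pow_le_pow_left' (hN _ _ (by simpa [hS] using ha)) _
    _ = (S.card : ℝ≥0∞) ^ (s + 1) * N ^ (2 * s) := by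
        rw [Finset.sum_const, nsmul_eq_mul, pow_succ]; ring
    -- The `+ 1` makes the base at least 1, so its exponent s + 1 may be raised to 2s.
    _ ≤ _ := by
        refine mul_le_mul_left ?_ _
        refine (pow_le_pow_left' (b := ((d * (Q + 1) + 1 : ℕ) : ℝ≥0∞)) ?_ _).trans
          (pow_le_pow_right₀ ?_ (by omega))
        · rw [hcard]; exact_mod_cast Nat.le_succ _
        · exact_mod_cast Nat.le_add_left 1 _

/-- The sum `∑_{M ≤ k} N^{k+2M} T_{k+M}^{1/4}`. -/
noncomputable def momentSum (T : ℕ → ℝ≥0∞) (N : ℝ≥0∞) (k : ℕ) : ℝ≥0∞ :=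
  ∑ M ∈ Finset.range (k + 1), N ^ (k + 2 * M) * T (k + M) ^ (1 / 4 : ℝ)

/-- Cauchy–Schwarz separates R from F, and the outer square root turns the two halves into fourth
roots. As F is quadratic in the derivatives, its part becomes N^{k+2M}; as R is quadratic in ϱ, its
part is a moment of ϱ of order 4(k + M). -/
lemma lintegral_domin_pow_le [IsProbabilityMeasure P] {Ξ : Set (Omega d n)}
    {G : Fin d → (j : ℕ) → Omega d n → HTensor d n j} (hG : ∀ i j, Measurable (G i j))
    {C : ℝ} (hC : 0 ≤ C) {q k : ℕ} (hk : k ≤ q) (ε : ℝ) {N : ℝ≥0∞}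
    (hN : ∀ i, ∀ m ∈ Finset.range (q + 1),
      eLpNorm (G i (m + 1)) ((2 * (q + 1) * (q + 2) : ℕ) : ℝ≥0∞) P ≤ N) :
    (∫⁻ ω, ENNReal.ofReal (C * domin G q ε ω ^ k) ∂(P.restrict Ξ)) ^ (1 / 2 : ℝ) ≤
      ENNReal.ofReal (C * 2 ^ q) ^ (1 / 2 : ℝ) * ((d * (q + 1) + 1 : ℕ) : ℝ≥0∞) ^ (3 * q) *
      momentSum (fun a => ∫⁻ ω, ENNReal.ofReal (regFun ε (malMat G ω)) ^ (2 * a)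
        ∂(P.restrict Ξ)) N k := by
  set R : Omega d n → ℝ≥0∞ := fun ω => ENNReal.ofReal (regFun ε (malMat G ω)) with hR
  set F : Omega d n → ℝ≥0∞ := fun ω => ENNReal.ofReal (derSq G q ω) with hF
  have mR : Measurable R := ((measurable_regFun ε).comp (measurable_malMat G hG)).ennreal_ofReal
  have mF : Measurable F := (measurable_derSq G hG q).ennreal_ofReal
  set D : ℝ≥0∞ := ((d * (q + 1) + 1 : ℕ) : ℝ≥0∞) with hD
  have hD1 : 1 ≤ D := by rw [hD]; exact_mod_cast Nat.le_add_left 1 _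
  have hterm : ∀ M ∈ Finset.range (k + 1),
      (∫⁻ ω, R ω ^ (k + M) * F ω ^ (k + 2 * M) ∂(P.restrict Ξ)) ^ (1 / 2 : ℝ) ≤
        D ^ (3 * q) *
          (N ^ (k + 2 * M) * (∫⁻ ω, R ω ^ (2 * (k + M)) ∂(P.restrict Ξ)) ^ (1 / 4 : ℝ)) := by
    intro M hM
    have hM' : M ≤ k := by simpa [Nat.lt_succ_iff] using hM
    have h1 : ∫⁻ ω, R ω ^ (k + M) * F ω ^ (k + 2 * M) ∂(P.restrict Ξ) ≤
        (∫⁻ ω, R ω ^ (2 * (k + M)) ∂(P.restrict Ξ)) ^ (1 / 2 : ℝ) *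
        (∫⁻ ω, F ω ^ (2 * (k + 2 * M)) ∂(P.restrict Ξ)) ^ (1 / 2 : ℝ) := by
      have h := ENNReal.lintegral_mul_norm_pow_le (μ := P.restrict Ξ)
        (f := fun ω => R ω ^ (2 * (k + M))) (g := fun ω => F ω ^ (2 * (k + 2 * M)))
        (mR.pow_const _).aemeasurable (mF.pow_const _).aemeasurable
        (p := 1 / 2) (q := 1 / 2) (by norm_num) (by norm_num) (by norm_num)
      refine le_trans (le_of_eq ?_) h
      simp only [pow_two_mul_rpow_half]
    have h2 : ∫⁻ ω, F ω ^ (2 * (k + 2 * M)) ∂(P.restrict Ξ) ≤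
        D ^ (4 * (k + 2 * M)) * N ^ (4 * (k + 2 * M)) := by
      refine (lintegral_mono' Measure.restrict_le_self le_rfl).trans ?_
      -- The required moment has order 4(k + 2M) ≤ 12q, and 12q ≤ 2(q + 1)(q + 2) because (q − 1)(q
      -- − 2) ≥ 0 for every integer q.
      have h := lintegral_derSq_pow_le hG q (s := 2 * (k + 2 * M))
        (p := 2 * (q + 1) * (q + 2)) (by nlinarith [sq_nonneg ((q : ℤ) - 1)]) hN
      rwa [show 2 * (2 * (k + 2 * M)) = 4 * (k + 2 * M) by ring] at h
    calc _ ≤ ((∫⁻ ω, R ω ^ (2 * (k + M)) ∂(P.restrict Ξ)) ^ (1 / 2 : ℝ) *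
        (D ^ (4 * (k + 2 * M)) * N ^ (4 * (k + 2 * M))) ^ (1 / 2 : ℝ)) ^ (1 / 2 : ℝ) := by
          gcongr
          exact h1.trans (by gcongr)
      _ = D ^ (k + 2 * M) *
          (N ^ (k + 2 * M) * (∫⁻ ω, R ω ^ (2 * (k + M)) ∂(P.restrict Ξ)) ^ (1 / 4 : ℝ)) := by
          rw [← mul_pow, show 4 * (k + 2 * M) = 2 * (2 * (k + 2 * M)) by ring,
            pow_two_mul_rpow_half, ENNReal.mul_rpow_of_nonneg _ _ (by norm_num : (0 : ℝ) ≤ 1 / 2),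
            pow_two_mul_rpow_half, ← ENNReal.rpow_mul, mul_pow, mul_comm, mul_assoc]
          norm_num
      _ ≤ _ := by
          refine mul_le_mul_left (pow_le_pow_right₀ hD1 (by omega)) _
  have e1 : ∀ ω, ENNReal.ofReal (C * domin G q ε ω ^ k) ≤
      ENNReal.ofReal (C * 2 ^ q) *
        ∑ M ∈ Finset.range (k + 1), R ω ^ (k + M) * F ω ^ (k + 2 * M) := fun ω => by
    have h := mul_one_add_pow_le (regFun_nonneg ε (malMat G ω)) (derSq_nonneg G q ω) k
    have e : ∑ M ∈ Finset.range (k + 1), R ω ^ (k + M) * F ω ^ (k + 2 * M) =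
        ENNReal.ofReal (∑ M ∈ Finset.range (k + 1),
          regFun ε (malMat G ω) ^ (k + M) * derSq G q ω ^ (k + 2 * M)) := by
      rw [ENNReal.ofReal_sum_of_nonneg fun _ _ => mul_nonneg (pow_nonneg (regFun_nonneg _ _) _)
        (pow_nonneg (derSq_nonneg _ _ _) _)]
      refine Finset.sum_congr rfl fun M _ => ?_
      rw [ENNReal.ofReal_mul (pow_nonneg (regFun_nonneg _ _) _),
        ENNReal.ofReal_pow (regFun_nonneg _ _), ENNReal.ofReal_pow (derSq_nonneg _ _ _)]
    rw [e, ← ENNReal.ofReal_mul (by positivity)]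
    refine ENNReal.ofReal_le_ofReal ?_
    rw [mul_assoc]
    refine mul_le_mul_of_nonneg_left (h.trans ?_) hC
    refine mul_le_mul_of_nonneg_right (pow_le_pow_right₀ (by norm_num) hk) ?_
    exact Finset.sum_nonneg fun _ _ => mul_nonneg (pow_nonneg (regFun_nonneg _ _) _)
        (pow_nonneg (derSq_nonneg _ _ _) _)
  have mRF : ∀ M, Measurable fun ω => R ω ^ (k + M) * F ω ^ (k + 2 * M) := fun M =>
    (mR.pow_const _).mul (mF.pow_const _)
  calc _ ≤ (∫⁻ ω, ENNReal.ofReal (C * 2 ^ q) *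
        ∑ M ∈ Finset.range (k + 1), R ω ^ (k + M) * F ω ^ (k + 2 * M) ∂(P.restrict Ξ)) ^
          (1 / 2 : ℝ) := by
        gcongr with ω
        exact e1 ω
    _ = ENNReal.ofReal (C * 2 ^ q) ^ (1 / 2 : ℝ) * (∑ M ∈ Finset.range (k + 1),
        ∫⁻ ω, R ω ^ (k + M) * F ω ^ (k + 2 * M) ∂(P.restrict Ξ)) ^ (1 / 2 : ℝ) := by
        rw [lintegral_const_mul' _ _ ENNReal.ofReal_ne_top, lintegral_finsetSum _ fun M _ => mRF M,
          ENNReal.mul_rpow_of_nonneg _ _ (by norm_num : (0 : ℝ) ≤ 1 / 2)]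
    _ ≤ ENNReal.ofReal (C * 2 ^ q) ^ (1 / 2 : ℝ) * (∑ M ∈ Finset.range (k + 1),
        D ^ (3 * q) *
          (N ^ (k + 2 * M) * (∫⁻ ω, R ω ^ (2 * (k + M)) ∂(P.restrict Ξ)) ^ (1 / 4 : ℝ))) := by
        gcongr
        exact (rpow_half_sum_le _ _).trans (Finset.sum_le_sum hterm)
    _ = _ := by
        rw [← Finset.mul_sum, mul_assoc]
        rfl

end Holder

/-! ### Bounds for the inverse of M + ε with M positive semidefinite. -/

section RegInverse

variable {d : ℕ}

open scoped Matrix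

/-- Let v be the j-th column of the inverse. Then ε|v|² ≤ ⟨v, (M + ε)v⟩ = v_j, which bounds first
v_j and then every v_i by 1/ε. -/
lemma abs_regularized_inv_le {M : Matrix (Fin d) (Fin d) ℝ} (hM : M.PosSemidef) {ε : ℝ}
    (hε : 0 < ε) (i j : Fin d) : |(M + ε • (1 : Matrix (Fin d) (Fin d) ℝ))⁻¹ i j| ≤ ε⁻¹ := by
  have hA : (M + ε • (1 : Matrix (Fin d) (Fin d) ℝ)).PosDef :=
    Matrix.PosDef.posSemidef_add hM (Matrix.PosDef.one.smul hε)
  set A := M + ε • (1 : Matrix (Fin d) (Fin d) ℝ) with hAdef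
  have hdet : IsUnit A.det := hA.det_pos.ne'.isUnit
  set v : Fin d → ℝ := A⁻¹ *ᵥ Pi.single j 1 with hv
  have hvi : ∀ k, v k = A⁻¹ k j := fun k => by simp [hv]
  have h1 : A *ᵥ v = Pi.single j 1 := by
    rw [hv, Matrix.mulVec_mulVec, Matrix.mul_nonsing_inv _ hdet, Matrix.one_mulVec]
  have h2 : v ⬝ᵥ (A *ᵥ v) = v j := by rw [h1]; simp
  have h3 : 0 ≤ v ⬝ᵥ (M *ᵥ v) := by simpa using hM.dotProduct_mulVec_nonneg v
  have h4 : v ⬝ᵥ (A *ᵥ v) = v ⬝ᵥ (M *ᵥ v) + ε * (v ⬝ᵥ v) := by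
    rw [hAdef, Matrix.add_mulVec, dotProduct_add, Matrix.smul_mulVec, Matrix.one_mulVec,
      dotProduct_smul, smul_eq_mul]
  have h5 : ∀ k, v k ^ 2 ≤ v ⬝ᵥ v := fun k => by
    simp only [dotProduct, ← sq]
    exact Finset.single_le_sum (f := fun k => v k ^ 2) (fun _ _ => sq_nonneg _)
      (Finset.mem_univ k)
  have h6 : ε * (v ⬝ᵥ v) ≤ |v j| := by linarith [le_abs_self (v j)]
  have h7 : |v j| ≤ ε⁻¹ := by
    by_contra hcon
    push Not at hcon
    have h8 : ε * |v j| ^ 2 ≤ |v j| := by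
      rw [sq_abs]; exact (mul_le_mul_of_nonneg_left (h5 j) hε.le).trans h6
    have h9 : 1 < ε * |v j| := by
      rwa [inv_lt_iff_one_lt_mul₀ hε, mul_comm] at hcon
    nlinarith [abs_nonneg (v j), inv_pos.2 hε]
  rw [← hvi]
  refine abs_le_of_sq_le_sq (a := v i) ?_ (inv_pos.2 hε).le
  have h8 : ε * v i ^ 2 ≤ ε⁻¹ := (mul_le_mul_of_nonneg_left (h5 i) hε.le).trans (h6.trans h7)
  rw [inv_pow, ← one_div, le_div_iff₀ (by positivity)]
  have := mul_le_mul_of_nonneg_left h8 hε.le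
  rw [mul_inv_cancel₀ hε.ne'] at this
  nlinarith

/-- The resolvent identity (M + ε)⁻¹ = M⁻¹ − ε(M + ε)⁻¹M⁻¹, where the entries of ε(M + ε)⁻¹ are at
most 1. The bound is uniform in ε, which permits ε → 0. -/
lemma abs_regularized_inv_le_inv {M : Matrix (Fin d) (Fin d) ℝ} (hM : M.PosSemidef)
    (hdet : M.det ≠ 0) {ε : ℝ} (hε : 0 < ε) {B : ℝ} (hB : ∀ i j, |M⁻¹ i j| ≤ B) (i j : Fin d) :
    |(M + ε • (1 : Matrix (Fin d) (Fin d) ℝ))⁻¹ i j| ≤ (d + 1) * B := by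
  have hA : (M + ε • (1 : Matrix (Fin d) (Fin d) ℝ)).PosDef :=
    Matrix.PosDef.posSemidef_add hM (Matrix.PosDef.one.smul hε)
  set A := M + ε • (1 : Matrix (Fin d) (Fin d) ℝ) with hAdef
  have hdetA : IsUnit A.det := hA.det_pos.ne'.isUnit
  have e : A⁻¹ = M⁻¹ - ε • (A⁻¹ * M⁻¹) := by
    have h : A⁻¹ * (A - ε • 1) * M⁻¹ = A⁻¹ := by
      rw [hAdef, add_sub_cancel_right, ← hAdef, mul_assoc, Matrix.mul_nonsing_inv _ hdet.isUnit,
        mul_one]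
    rw [mul_sub, Matrix.nonsing_inv_mul _ hdetA, sub_mul, one_mul] at h
    simpa using h.symm
  rw [e, Matrix.sub_apply, Matrix.smul_apply, Matrix.mul_apply, smul_eq_mul, Finset.mul_sum]
  have hB0 : 0 ≤ B := (abs_nonneg _).trans (hB i j)
  calc _ ≤ |M⁻¹ i j| + |∑ k, ε * (A⁻¹ i k * M⁻¹ k j)| := abs_sub _ _
    _ ≤ B + ∑ _k : Fin d, B := by
      refine add_le_add (hB i j) ((Finset.abs_sum_le_sum_abs _ _).trans
        (Finset.sum_le_sum fun k _ => ?_))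
      rw [← mul_assoc, abs_mul, abs_mul, abs_of_pos hε]
      have h1 : ε * |A⁻¹ i k| ≤ 1 := by
        have := mul_le_mul_of_nonneg_left (abs_regularized_inv_le hM hε i k) hε.le
        rwa [mul_inv_cancel₀ hε.ne'] at this
      calc ε * |A⁻¹ i k| * |M⁻¹ k j| ≤ 1 * B :=
            mul_le_mul h1 (hB k j) (abs_nonneg _) zero_le_one
        _ = B := one_mul B
    _ = (d + 1) * B := by simp; ring

lemma posSemidef_malMat {n : ℕ} (G : Fin d → (j : ℕ) → Omega d n → HTensor d n j)
    (ω : Omega d n) : (Matrix.of (malMat G ω)).PosSemidef :=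
  Matrix.posSemidef_gram ℝ fun i => G i 1 ω

lemma regFun_le {M : Fin d → Fin d → ℝ} (hM : (Matrix.of M).PosSemidef) {ε : ℝ} (hε : 0 < ε) :
    regFun ε M ≤ d ^ 2 * ε⁻¹ ^ 2 := by
  unfold regFun
  calc _ ≤ ∑ _i : Fin d, ∑ _j : Fin d, ε⁻¹ ^ 2 := by
        refine Finset.sum_le_sum fun i _ => Finset.sum_le_sum fun j _ => ?_
        rw [← sq_abs]
        exact pow_le_pow_left₀ (abs_nonneg _) (abs_regularized_inv_le hM hε i j) 2
    _ = _ := by simp; ring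

lemma maxNorm_ne_top (A : Matrix (Fin d) (Fin d) ℝ) : maxNorm A ≠ ∞ := by
  refine ne_top_of_le_ne_top (b := ∑ i, ∑ j, ‖A i j‖ₑ)
    (by simp [ENNReal.sum_eq_top]) (iSup₂_le fun i j => ?_)
  refine le_trans ?_ (Finset.single_le_sum
    (f := fun i => ∑ j, ‖A i j‖ₑ) (fun _ _ => zero_le) (Finset.mem_univ i))
  exact Finset.single_le_sum (f := fun j => ‖A i j‖ₑ) (fun _ _ => zero_le) (Finset.mem_univ j)

lemma ofReal_regFun_le {M : Fin d → Fin d → ℝ} (hM : (Matrix.of M).PosSemidef)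
    (hdet : (Matrix.of M).det ≠ 0) {ε : ℝ} (hε : 0 < ε) :
    ENNReal.ofReal (regFun ε M) ≤
      ((d * (d + 1) : ℕ) : ℝ≥0∞) ^ 2 * maxNorm (Matrix.of M)⁻¹ ^ 2 := by
  have hmax : ∀ i j, ‖(Matrix.of M)⁻¹ i j‖ₑ ≤ maxNorm (Matrix.of M)⁻¹ := fun i j =>
    le_iSup₂ (f := fun i j => ‖(Matrix.of M)⁻¹ i j‖ₑ) i j
  have hfin := maxNorm_ne_top (Matrix.of M)⁻¹
  set B := (maxNorm (Matrix.of M)⁻¹).toReal with hB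
  have hB' : ∀ i j, |(Matrix.of M)⁻¹ i j| ≤ B := fun i j => by
    have h := ENNReal.toReal_mono hfin (hmax i j)
    rwa [toReal_enorm, Real.norm_eq_abs] at h
  have h : regFun ε M ≤ (d * (d + 1)) ^ 2 * B ^ 2 := by
    unfold regFun
    calc _ ≤ ∑ _i : Fin d, ∑ _j : Fin d, ((d + 1) * B) ^ 2 := by
          refine Finset.sum_le_sum fun i _ => Finset.sum_le_sum fun j _ => ?_
          rw [← sq_abs]
          exact pow_le_pow_left₀ (abs_nonneg _) (abs_regularized_inv_le_inv hM hdet hε hB' i j) 2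
      _ = _ := by simp; ring
  refine (ENNReal.ofReal_le_ofReal h).trans (le_of_eq ?_)
  rw [ENNReal.ofReal_mul (by positivity), ENNReal.ofReal_pow (by positivity),
    ENNReal.ofReal_pow ENNReal.toReal_nonneg, ENNReal.ofReal_toReal hfin]
  congr 2
  rw [← ENNReal.ofReal_natCast]
  push_cast
  rfl

lemma continuousAt_regFun {M : Fin d → Fin d → ℝ} (hM : (Matrix.of M).PosSemidef) {ε : ℝ}
    (hε : 0 < ε) : ContinuousAt (regFun ε) M := by
  have hc : Continuous fun M : Fin d → Fin d → ℝ =>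
      (Matrix.of M + ε • (1 : Matrix (Fin d) (Fin d) ℝ)) :=
    (continuous_id (X := Matrix (Fin d) (Fin d) ℝ)).add continuous_const
  have hA : (Matrix.of M + ε • (1 : Matrix (Fin d) (Fin d) ℝ)).PosDef :=
    Matrix.PosDef.posSemidef_add hM (Matrix.PosDef.one.smul hε)
  unfold regFun
  refine tendsto_finsetSum _ fun i _ => tendsto_finsetSum _ fun j _ => Tendsto.pow ?_ 2
  simp only [Matrix.inv_def, Ring.inverse_eq_inv', Matrix.smul_apply, smul_eq_mul]
  exact (hc.matrix_det.continuousAt.inv₀ hA.det_pos.ne').mul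
    (hc.matrix_adjugate.matrix_elem i j).continuousAt

end RegInverse

/-! ### Approximation of Sobolev functionals by test functionals. -/

section Approximation

/-- Convergence in measure of the sum of the norms yields one subsequence that serves all indices
simultaneously. -/
lemma exists_subseq_tendsto_ae {Ω ι : Type*} [MeasurableSpace Ω] {P : Measure Ω} (s : Finset ι)
    (h : ℕ → ι → Ω → ℝ) {p : ℝ≥0∞} (hp : 1 ≤ p)
    (hm : ∀ k, ∀ a ∈ s, AEStronglyMeasurable (h k a) P)
    (hlim : ∀ a ∈ s, Tendsto (fun k => eLpNorm (h k a) p P) atTop (𝓝 0)) :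
    ∃ ns : ℕ → ℕ, StrictMono ns ∧
      ∀ᵐ ω ∂P, ∀ a ∈ s, Tendsto (fun k => h (ns k) a ω) atTop (𝓝 0) := by
  have hm' : ∀ k, ∀ a ∈ s, AEStronglyMeasurable (fun ω => ‖h k a ω‖) P := fun k a ha =>
    (hm k a ha).norm
  have h0 : Tendsto (fun k => eLpNorm ((∑ a ∈ s, fun ω => ‖h k a ω‖) - 0) p P) atTop (𝓝 0) := by
    have hsum : Tendsto (fun k => ∑ a ∈ s, eLpNorm (h k a) p P) atTop (𝓝 0) := by
      simpa using tendsto_finsetSum s hlim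
    refine tendsto_of_tendsto_of_tendsto_of_le_of_le tendsto_const_nhds hsum
      (fun _ => zero_le) fun k => ?_
    rw [sub_zero]
    refine (eLpNorm_sum_le (hm' k) hp).trans (le_of_eq (Finset.sum_congr rfl fun a _ => ?_))
    exact eLpNorm_norm _
  obtain ⟨ns, hns, hae⟩ := (tendstoInMeasure_of_tendsto_eLpNorm (zero_lt_one.trans_le hp).ne'
    (fun k => Finset.aestronglyMeasurable_sum _ (hm' k)) aestronglyMeasurable_const
    h0).exists_seq_tendsto_ae
  refine ⟨ns, hns, ?_⟩
  filter_upwards [hae] with ω hω a ha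
  refine squeeze_zero_norm (fun k => ?_) hω
  rw [Finset.sum_apply]
  exact Finset.single_le_sum (f := fun a => ‖h (ns k) a ω‖) (fun _ _ => norm_nonneg _) ha

variable {d n : ℕ} {P : Measure (Omega d n)}

lemma exists_test_seq {z : E d} {r : ℝ} {θ : (Fin n → E d) → ℝ} (hθ : Measurable θ)
    {p : ℝ≥0∞} (hp : 1 ≤ p) {m : ℕ} (hm1 : 1 ≤ m) {f : Omega d n → E d}
    {G : Fin d → (j : ℕ) → Omega d n → HTensor d n j}
    (hf : ∀ i, HasSobolevDerivs P (psi z r) θ p m (fun ω => f ω i) (G i)) :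
    ∃ u : ℕ → Fin d → Omega d n → ℝ, (∀ k i, IsTest P (u k i)) ∧
      (∀ i, ∀ j ≤ m, Tendsto (fun k => eLpNorm (iterGrad (psi z r) θ (u k i) j - G i j) p P)
        atTop (𝓝 0)) ∧
      (∀ᵐ ω ∂P, Tendsto (fun k => (WithLp.toLp 2 fun i => u k i ω : E d)) atTop (𝓝 (f ω))) ∧
      ∀ᵐ ω ∂P, Tendsto (fun k => malMat (gradFam z r θ (u k)) ω) atTop (𝓝 (malMat G ω)) := by
  choose u ht hu using fun i => (hf i).approx
  have hmeas : ∀ k i j, Measurable (iterGrad (psi z r) θ (u i k) j) := fun k i j =>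
    measurable_iterGrad z r (ht i k).smooth θ (ht i k).measurable hθ j
  -- Almost sure convergence is needed only for orders 0 and 1, that is, for f and for its Malliavin
  -- matrix; higher derivatives enter through norms alone.
  obtain ⟨ns, hns, hae⟩ := exists_subseq_tendsto_ae (P := P)
    ((Finset.univ : Finset (Fin d)) ×ˢ Finset.range 2)
    (fun k a ω => ‖iterGrad (psi z r) θ (u a.1 k) a.2 ω - G a.1 a.2 ω‖) hp
    (fun k a ha => by
      have ha2 : a.2 < 2 := by simpa using (Finset.mem_product.1 ha).2
      exact ((hmeas k a.1 a.2).aestronglyMeasurable.sub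
        ((hf a.1).memLp a.2 (by omega)).aestronglyMeasurable).norm)
    (fun a ha => by
      have ha2 : a.2 < 2 := by simpa using (Finset.mem_product.1 ha).2
      have h := hu a.1 a.2 (by omega)
      refine h.congr fun k => ?_
      exact (eLpNorm_norm _).symm)
  have hae' : ∀ᵐ ω ∂P, ∀ i, ∀ j < 2,
      Tendsto (fun k => iterGrad (psi z r) θ (u i (ns k)) j ω) atTop (𝓝 (G i j ω)) := by
    filter_upwards [hae] with ω hω i j hj
    exact tendsto_iff_norm_sub_tendsto_zero.2 (hω (i, j) (by simpa using hj))
  refine ⟨fun k i => u i (ns k), fun k i => ht i _,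
    fun i j hj => (hu i j hj).comp hns.tendsto_atTop, ?_, ?_⟩
  · have hz : ∀ᵐ ω ∂P, ∀ i I, G i 0 ω I = f ω i := ae_all_iff.2 fun i => (hf i).zero
    filter_upwards [hae', hz] with ω hω hω0
    have h : Tendsto (fun k => fun i => u i (ns k) ω) atTop (𝓝 fun i => f ω i) := by
      refine tendsto_pi_nhds.2 fun i => ?_
      have h1 := hω i 0 (by norm_num)
      have h2 := ((EuclideanSpace.proj (𝕜 := ℝ) (Fin.elim0 : Fin 0 → Idx d n)).continuous.tendsto
        (G i 0 ω)).comp h1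
      rw [← hω0 i Fin.elim0]
      exact h2
    exact ((PiLp.continuous_toLp 2 _).tendsto _).comp h
  · filter_upwards [hae'] with ω hω
    exact tendsto_pi_nhds.2 fun i => tendsto_pi_nhds.2 fun j =>
      (hω i 1 (by norm_num)).inner (hω j 1 (by norm_num))

lemma tendsto_lintegral_of_bounded {Ω : Type*} [MeasurableSpace Ω] {μ : Measure Ω}
    [IsFiniteMeasure μ] {F : ℕ → Ω → ℝ≥0∞} {f : Ω → ℝ≥0∞} (c : ℝ≥0∞) (hc : c ≠ ∞)
    (hF : ∀ k, AEMeasurable (F k) μ) (hb : ∀ k, ∀ᵐ ω ∂μ, F k ω ≤ c)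
    (hlim : ∀ᵐ ω ∂μ, Tendsto (fun k => F k ω) atTop (𝓝 (f ω))) :
    Tendsto (fun k => ∫⁻ ω, F k ω ∂μ) atTop (𝓝 (∫⁻ ω, f ω ∂μ)) :=
  tendsto_lintegral_of_dominated_convergence' (fun _ => c) hF hb
    (by simpa using ENNReal.mul_ne_top hc (measure_ne_top _ _)) hlim

lemma lintegral_ne_top_of_le_const {Ω : Type*} [MeasurableSpace Ω] {μ : Measure Ω}
    [IsFiniteMeasure μ] {F : Ω → ℝ≥0∞} {c : ℝ≥0∞} (hc : c ≠ ∞) (hb : ∀ ω, F ω ≤ c) :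
    ∫⁻ ω, F ω ∂μ ≠ ∞ :=
  ne_top_of_le_ne_top (b := ∫⁻ _, c ∂μ)
    (by simpa using ENNReal.mul_ne_top hc (measure_ne_top _ _)) (lintegral_mono hb)

lemma tendsto_momentSum {T : ℕ → ℕ → ℝ≥0∞} {T' : ℕ → ℝ≥0∞} {N : ℕ → ℝ≥0∞} {N' : ℝ≥0∞}
    (hT : ∀ a, Tendsto (fun k => T k a) atTop (𝓝 (T' a))) (hN : Tendsto N atTop (𝓝 N'))
    (hT' : ∀ a, T' a ≠ ∞) (hN' : N' ≠ ∞) (j : ℕ) :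
    Tendsto (fun k => momentSum (T k) (N k) j) atTop (𝓝 (momentSum T' N' j)) :=
  tendsto_finsetSum _ fun M _ => ENNReal.Tendsto.mul (ENNReal.Tendsto.pow hN)
    (Or.inr (ENNReal.rpow_ne_top_of_nonneg (by norm_num) (hT' _)))
    ((hT _).ennrpow_const _) (Or.inr (ENNReal.pow_ne_top hN'))

lemma momentSum_ne_top {T : ℕ → ℝ≥0∞} {N : ℝ≥0∞} {k : ℕ} (hT : ∀ a ≤ 2 * k, T a ≠ ∞)
    (hN : N ≠ ∞) : momentSum T N k ≠ ∞ :=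
  ENNReal.sum_ne_top.2 fun M hM => ENNReal.mul_ne_top (ENNReal.pow_ne_top hN)
    (ENNReal.rpow_ne_top_of_nonneg (by norm_num)
      (hT _ (by have := Finset.mem_range.1 hM; omega)))

end Approximation

/-! ### Removing the approximation at fixed ε. -/

section Limit

variable {d : ℕ} (z : E d) (r : ℝ)

/-- The integration by parts inequality for Sobolev functionals, with a regularised Malliavin
matrix. -/
lemma exists_enorm_setIntegral_pders_le_add [Fact (0 < r)] (q : ℕ) (hq : q ≤ d + 1) :
    ∃ c : ℝ≥0∞, c ≠ ∞ ∧ ∀ (α : unitInterval) (ν : Measure (E d)) [IsProbabilityMeasure ν] (n : ℕ)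
      (θ : (Fin n → E d) → ℝ), Measurable θ → (∀ x, θ x ∈ Set.Icc (0 : ℝ) 1) →
    ∀ (f : Omega d n → E d), Measurable f →
    ∀ (G : Fin d → (j : ℕ) → Omega d n → HTensor d n j),
      (∀ i, HasSobolevDerivs (law z r α ν n) (psi z r) θ
        ((2 * (d + 2) * (d + 3) : ℕ) : ℝ≥0∞) ((d + 2) ^ 2) (fun ω => f ω i) (G i)) →
    ∀ (Ξ : Set (Omega d n)), MeasurableSet[sigmaEpsZeta d n] Ξ →
    ∀ N : ℝ≥0∞, N ≠ ∞ → (∀ i, ∀ m ∈ Finset.range (q + 1),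
      eLpNorm (G i (m + 1)) ((2 * (q + 1) * (q + 2) : ℕ) : ℝ≥0∞) (law z r α ν n) ≤ N) →
    ∀ (ε : ℝ), 0 < ε → ∀ (I : List (Fin d)), I.length = q → ∀ (φ : E d → ℝ),
      ContDiff ℝ ((⊤ : ℕ∞) : WithTop ℕ∞) φ → ∀ B : ℝ, 0 ≤ B →
      (∀ J : List (Fin d), J.length ≤ q → ∀ x, |pders J φ x| ≤ B) →
      ‖∫ ω in Ξ, pders I φ (f ω) ∂(law z r α ν n)‖ₑ ≤
        (∫⁻ ω in Ξ, ENNReal.ofReal (φ (f ω) ^ 2) ∂(law z r α ν n)) ^ (1 / 2 : ℝ) *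
        (c * momentSum (fun a => ∫⁻ ω in Ξ, ENNReal.ofReal (regFun ε (malMat G ω)) ^ (2 * a)
          ∂(law z r α ν n)) N q) +
        ∑ k ∈ Finset.range q, ENNReal.ofReal (B * d) *
          ((c * momentSum (fun a => ∫⁻ ω in Ξ, ENNReal.ofReal (regFun ε (malMat G ω)) ^ (2 * a)
          ∂(law z r α ν n)) N k) *
          (∫⁻ ω in Ξ, ENNReal.ofReal (ε ^ 2 * regFun ε (malMat G ω)) ∂(law z r α ν n)) ^
            (1 / 2 : ℝ)) := by
  obtain ⟨C, hC0, hC⟩ := exists_enorm_integral_pders_le z r q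
  set c : ℝ≥0∞ := ENNReal.ofReal (C * 2 ^ q) ^ (1 / 2 : ℝ) *
    ((d * (q + 1) + 1 : ℕ) : ℝ≥0∞) ^ (3 * q) with hc
  have hcfin : c ≠ ∞ := ENNReal.mul_ne_top
    (ENNReal.rpow_ne_top_of_nonneg (by norm_num) ENNReal.ofReal_ne_top)
    (ENNReal.pow_ne_top (ENNReal.natCast_ne_top _))
  refine ⟨c, hcfin, fun α ν _ n θ hθ hθ1 f hf G hG Ξ hΞ N hN hGN ε hε I hI φ hφ B hB0 hB => ?_⟩
  set P := law z r α ν n with hP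
  obtain ⟨Ξ', hΞ', rfl⟩ := hΞ
  -- Since Ξ is determined by (ε, ζ), restricting to it leaves a product measure whose η-factor is
  -- unchanged, so integration by parts in η is unaffected.
  have hprod : P.restrict ((fun ω : Omega d n => ω.2) ⁻¹' Ξ') = (etaLaw z r n).prod
      (((Measure.pi fun _ : Fin n => bernoulliLaw α).prod
        (Measure.pi fun _ : Fin n => ν)).restrict Ξ') := by
    have h := Measure.prod_restrict (μ := etaLaw z r n)
      (ν := (Measure.pi fun _ : Fin n => bernoulliLaw α).prod (Measure.pi fun _ : Fin n => ν))
      Set.univ Ξ'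
    rw [Measure.restrict_univ] at h
    rw [h]
    congr 1
    ext ω
    simp
  set Ξ := (fun ω : Omega d n => ω.2) ⁻¹' Ξ' with hΞdef
  obtain ⟨u, hut, hu, huf, huM⟩ := exists_test_seq hθ
    (by exact_mod_cast (by nlinarith : 1 ≤ 2 * (d + 2) * (d + 3)))
    (by nlinarith : 1 ≤ (d + 2) ^ 2) hG
  have hGu : ∀ k i j, Measurable (gradFam z r θ (u k) i j) := fun k i j =>
    measurable_iterGrad z r (hut k i).smooth θ (hut k i).measurable hθ j
  have hord : ∀ m ∈ Finset.range (q + 1), m + 1 ≤ (d + 2) ^ 2 := fun m hm => by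
    have := Finset.mem_range.1 hm
    nlinarith
  have hexp : ((2 * (q + 1) * (q + 2) : ℕ) : ℝ≥0∞) ≤ ((2 * (d + 2) * (d + 3) : ℕ) : ℝ≥0∞) := by
    have h : (q + 1) * (q + 2) ≤ (d + 2) * (d + 3) := Nat.mul_le_mul (by omega) (by omega)
    exact_mod_cast (by nlinarith : 2 * (q + 1) * (q + 2) ≤ 2 * (d + 2) * (d + 3))
  set Δ : ℕ → Fin d × ℕ → ℝ≥0∞ := fun k a =>
    eLpNorm (iterGrad (psi z r) θ (u k a.1) (a.2 + 1) - G a.1 (a.2 + 1))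
      ((2 * (d + 2) * (d + 3) : ℕ) : ℝ≥0∞) P with hΔ
  set S : Finset (Fin d × ℕ) := Finset.univ ×ˢ Finset.range (q + 1) with hS
  set δ : ℕ → ℝ≥0∞ := fun k => ∑ a ∈ S, Δ k a with hδ
  -- The approximating functionals satisfy the norm hypothesis with N + δ_k, where δ_k collects the
  -- approximation errors of finitely many derivatives.
  have hδ0 : Tendsto (fun k => N + δ k) atTop (𝓝 N) := by
    have h : Tendsto δ atTop (𝓝 0) := by
      have hsum : Tendsto δ atTop (𝓝 (∑ _a ∈ S, 0)) := tendsto_finsetSum S fun a ha =>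
        hu a.1 (a.2 + 1) (hord _ (Finset.mem_product.1 ha).2)
      rwa [Finset.sum_const_zero] at hsum
    simpa using tendsto_const_nhds.add h
  have hNk : ∀ k i, ∀ m ∈ Finset.range (q + 1),
      eLpNorm (gradFam z r θ (u k) i (m + 1)) ((2 * (q + 1) * (q + 2) : ℕ) : ℝ≥0∞) P ≤
        N + δ k := by
    intro k i m hm
    have hGm := ((hG i).memLp (m + 1) (hord m hm)).aestronglyMeasurable
    have hum := (hGu k i (m + 1)).aestronglyMeasurable (μ := P)
    have e : gradFam z r θ (u k) i (m + 1) =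
        G i (m + 1) + (iterGrad (psi z r) θ (u k i) (m + 1) - G i (m + 1)) := by
      rw [add_sub_cancel]; rfl
    rw [e]
    refine (eLpNorm_add_le hGm (hum.sub hGm)
      (by exact_mod_cast (by nlinarith : 1 ≤ 2 * (q + 1) * (q + 2)))).trans
      (add_le_add (hGN i m hm) ?_)
    have h1 : Δ k (i, m) ≤ δ k := Finset.single_le_sum (f := Δ k) (fun _ _ => zero_le)
      (Finset.mem_product.2 ⟨Finset.mem_univ i, hm⟩)
    exact (eLpNorm_le_eLpNorm_of_exponent_le hexp (hum.sub hGm)).trans h1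
  have hfΞ := ae_restrict_of_ae (s := Ξ) huf
  have hRΞ : ∀ᵐ ω ∂(P.restrict Ξ), Tendsto (fun k => regFun ε (malMat (gradFam z r θ (u k)) ω))
      atTop (𝓝 (regFun ε (malMat G ω))) := by
    filter_upwards [ae_restrict_of_ae (s := Ξ) huM] with ω hω
    exact (continuousAt_regFun (posSemidef_malMat G ω) hε).tendsto.comp hω
  have mR : ∀ k, Measurable fun ω => regFun ε (malMat (gradFam z r θ (u k)) ω) := fun k =>
    (measurable_regFun ε).comp (measurable_malMat _ (hGu k))
  have mu : ∀ k, Measurable fun ω => (WithLp.toLp 2 fun i => u k i ω : E d) := fun k =>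
    (WithLp.measurable_toLp 2 _).comp (measurable_pi_lambda _ fun i => (hut k i).measurable)
  -- The reason for the regularisation: at fixed ε this quantity has a deterministic bound, whereas
  -- the inverse Malliavin matrices of the approximations may fail to be integrable.
  have hRb : ∀ k ω, regFun ε (malMat (gradFam z r θ (u k)) ω) ≤ d ^ 2 * ε⁻¹ ^ 2 := fun k ω =>
    regFun_le (posSemidef_malMat _ ω) hε
  -- the approximate inequality
  have hk : ∀ k, ‖∫ ω in Ξ, pders I φ (WithLp.toLp 2 fun i => u k i ω) ∂P‖ₑ ≤
      (∫⁻ ω in Ξ, ENNReal.ofReal (φ (WithLp.toLp 2 fun i => u k i ω) ^ 2) ∂P) ^ (1 / 2 : ℝ) *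
        (c * momentSum (fun a => ∫⁻ ω in Ξ, ENNReal.ofReal
          (regFun ε (malMat (gradFam z r θ (u k)) ω)) ^ (2 * a) ∂P) (N + δ k) q) +
        ∑ j ∈ Finset.range q, ENNReal.ofReal (B * d) *
          ((c * momentSum (fun a => ∫⁻ ω in Ξ, ENNReal.ofReal
          (regFun ε (malMat (gradFam z r θ (u k)) ω)) ^ (2 * a) ∂P) (N + δ k) j) *
          (∫⁻ ω in Ξ, ENNReal.ofReal (ε ^ 2 * regFun ε (malMat (gradFam z r θ (u k)) ω)) ∂P) ^
            (1 / 2 : ℝ)) := by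
    intro k
    have h := hC n θ hθ hθ1 (((Measure.pi fun _ : Fin n => bernoulliLaw α).prod
        (Measure.pi fun _ : Fin n => ν)).restrict Ξ') (u k) (fun i => (hut k i).measurable)
        (fun i => (hut k i).smooth) ε hε I hI φ hφ B hB0 hB
    rw [← hprod] at h
    refine h.trans (add_le_add (mul_le_mul_right ?_ _) (Finset.sum_le_sum fun j hj =>
      mul_le_mul_right (mul_le_mul_left ?_ _) _))
    · exact lintegral_domin_pow_le (hGu k) hC0 le_rfl ε (hNk k)
    · exact lintegral_domin_pow_le (hGu k) hC0 (Finset.mem_range.1 hj).le ε (hNk k)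
  -- passage to the limit
  have hT : ∀ a, Tendsto (fun k => ∫⁻ ω in Ξ, ENNReal.ofReal
      (regFun ε (malMat (gradFam z r θ (u k)) ω)) ^ (2 * a) ∂P) atTop
      (𝓝 (∫⁻ ω in Ξ, ENNReal.ofReal (regFun ε (malMat G ω)) ^ (2 * a) ∂P)) := fun a =>
    tendsto_lintegral_of_bounded (ENNReal.ofReal (d ^ 2 * ε⁻¹ ^ 2) ^ (2 * a))
      (ENNReal.pow_ne_top ENNReal.ofReal_ne_top)
      (fun k => ((mR k).ennreal_ofReal.pow_const _).aemeasurable)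
      (fun k => Eventually.of_forall fun ω =>
        pow_le_pow_left' (ENNReal.ofReal_le_ofReal (hRb k ω)) _)
      (hRΞ.mono fun ω hω => ENNReal.Tendsto.pow (ENNReal.tendsto_ofReal hω))
  have hTfin : ∀ a, ∫⁻ ω in Ξ, ENNReal.ofReal (regFun ε (malMat G ω)) ^ (2 * a) ∂P ≠ ∞ := by
    exact fun a => lintegral_ne_top_of_le_const (ENNReal.pow_ne_top ENNReal.ofReal_ne_top)
      fun ω => pow_le_pow_left'
        (ENNReal.ofReal_le_ofReal (regFun_le (posSemidef_malMat G ω) hε)) _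
  have hE : Tendsto (fun k => ∫⁻ ω in Ξ, ENNReal.ofReal
      (ε ^ 2 * regFun ε (malMat (gradFam z r θ (u k)) ω)) ∂P) atTop
      (𝓝 (∫⁻ ω in Ξ, ENNReal.ofReal (ε ^ 2 * regFun ε (malMat G ω)) ∂P)) :=
    tendsto_lintegral_of_bounded (ENNReal.ofReal (ε ^ 2 * (d ^ 2 * ε⁻¹ ^ 2)))
      ENNReal.ofReal_ne_top
      (fun k => ((mR k).const_mul _).ennreal_ofReal.aemeasurable)
      (fun k => Eventually.of_forall fun ω => ENNReal.ofReal_le_ofReal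
        (mul_le_mul_of_nonneg_left (hRb k ω) (sq_nonneg _)))
      (hRΞ.mono fun ω hω => ENNReal.tendsto_ofReal (hω.const_mul _))
  have hEfin : ∫⁻ ω in Ξ, ENNReal.ofReal (ε ^ 2 * regFun ε (malMat G ω)) ∂P ≠ ∞ := by
    exact lintegral_ne_top_of_le_const ENNReal.ofReal_ne_top
      fun ω => ENNReal.ofReal_le_ofReal
        (mul_le_mul_of_nonneg_left (regFun_le (posSemidef_malMat G ω) hε) (sq_nonneg _))
  have hφB : ∀ x, φ x ^ 2 ≤ B ^ 2 := fun x => by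
    have := hB [] (by simp) x
    rw [← sq_abs]
    exact pow_le_pow_left₀ (abs_nonneg _) this 2
  have hA : Tendsto (fun k => ∫⁻ ω in Ξ, ENNReal.ofReal
      (φ (WithLp.toLp 2 fun i => u k i ω) ^ 2) ∂P) atTop
      (𝓝 (∫⁻ ω in Ξ, ENNReal.ofReal (φ (f ω) ^ 2) ∂P)) :=
    tendsto_lintegral_of_bounded (ENNReal.ofReal (B ^ 2)) ENNReal.ofReal_ne_top
      (fun k => ((hφ.continuous.measurable.comp (mu k)).pow_const 2).ennreal_ofReal.aemeasurable)
      (fun k => Eventually.of_forall fun ω => ENNReal.ofReal_le_ofReal (hφB _))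
      (hfΞ.mono fun ω hω => ENNReal.tendsto_ofReal
        (((hφ.continuous.tendsto _).comp hω).pow 2))
  have hAfin : ∫⁻ ω in Ξ, ENNReal.ofReal (φ (f ω) ^ 2) ∂P ≠ ∞ := by
    exact lintegral_ne_top_of_le_const ENNReal.ofReal_ne_top
      fun ω => ENNReal.ofReal_le_ofReal (hφB (f ω))
  have hL : Tendsto (fun k => ‖∫ ω in Ξ, pders I φ (WithLp.toLp 2 fun i => u k i ω) ∂P‖ₑ) atTop
      (𝓝 ‖∫ ω in Ξ, pders I φ (f ω) ∂P‖ₑ) := by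
    refine (continuous_enorm.tendsto _).comp
      (tendsto_integral_of_dominated_convergence (fun _ => B)
      (fun k => ((contDiff_pders hφ I).continuous.measurable.comp (mu k)).aestronglyMeasurable)
      (integrable_const _)
      (fun k => Eventually.of_forall fun ω => hB I hI.le _) ?_)
    filter_upwards [hfΞ] with ω hω
    exact ((contDiff_pders hφ I).continuous.tendsto _).comp hω
  have hW : ∀ j, Tendsto (fun k => c * momentSum (fun a => ∫⁻ ω in Ξ, ENNReal.ofReal
      (regFun ε (malMat (gradFam z r θ (u k)) ω)) ^ (2 * a) ∂P) (N + δ k) j) atTop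
      (𝓝 (c * momentSum (fun a => ∫⁻ ω in Ξ, ENNReal.ofReal (regFun ε (malMat G ω)) ^ (2 * a)
          ∂P) N j)) := fun j =>
    ENNReal.Tendsto.const_mul (tendsto_momentSum hT hδ0 hTfin hN j) (Or.inr hcfin)
  have hWfin : ∀ j, c * momentSum (fun a => ∫⁻ ω in Ξ, ENNReal.ofReal
      (regFun ε (malMat G ω)) ^ (2 * a) ∂P) N j ≠ ∞ := fun j =>
    ENNReal.mul_ne_top hcfin (momentSum_ne_top (fun a _ => hTfin a) hN)
  refine le_of_tendsto_of_tendsto' hL ?_ hk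
  -- Multiplication in `ℝ≥0∞` is not continuous at (0, ∞), hence the finiteness of every limit.
  refine (ENNReal.Tendsto.mul (hA.ennrpow_const _) (Or.inr (hWfin q)) (hW q)
    (Or.inr (ENNReal.rpow_ne_top_of_nonneg (by norm_num) hAfin))).add
    (tendsto_finsetSum _ fun j _ => ENNReal.Tendsto.const_mul
      (ENNReal.Tendsto.mul (hW j) (Or.inr
        (ENNReal.rpow_ne_top_of_nonneg (by norm_num) hEfin)) (hE.ennrpow_const _)
        (Or.inr (hWfin j))) (Or.inr ENNReal.ofReal_ne_top))

end Limit

/-! ### Letting ε tend to 0. -/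

section Nondegenerate

variable {d : ℕ} (z : E d) (r : ℝ)

lemma momentSum_mono {T T' : ℕ → ℝ≥0∞} {D N : ℝ≥0∞} (hD : 1 ≤ D) {k q : ℕ} (hk : k ≤ q)
    (h : ∀ a, T a ≤ D ^ (4 * a) * T' a) : momentSum T N k ≤ D ^ (2 * q) * momentSum T' N k := by
  unfold momentSum
  rw [Finset.mul_sum]
  refine Finset.sum_le_sum fun M hM => ?_
  have hM' := Finset.mem_range.1 hM
  calc N ^ (k + 2 * M) * T (k + M) ^ (1 / 4 : ℝ)
      ≤ N ^ (k + 2 * M) * (D ^ (4 * (k + M)) * T' (k + M)) ^ (1 / 4 : ℝ) := by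
        gcongr
        exact h _
    _ = D ^ (k + M) * (N ^ (k + 2 * M) * T' (k + M) ^ (1 / 4 : ℝ)) := by
        rw [ENNReal.mul_rpow_of_nonneg _ _ (by norm_num : (0 : ℝ) ≤ 1 / 4), mul_comm 4, pow_mul,
          ← ENNReal.rpow_natCast _ 4, ← ENNReal.rpow_mul]
        norm_num
        ring
    _ ≤ _ := mul_le_mul_left (pow_le_pow_right₀ hD (by omega)) _

/-- The integration by parts inequality for Sobolev functionals. -/
lemma exists_enorm_setIntegral_pders_le_momentSum [Fact (0 < r)] (q : ℕ) (hq : q ≤ d + 1) :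
    ∃ c : ℝ≥0∞, c ≠ ∞ ∧ ∀ (α : unitInterval) (ν : Measure (E d)) [IsProbabilityMeasure ν] (n : ℕ)
      (θ : (Fin n → E d) → ℝ), Measurable θ → (∀ x, θ x ∈ Set.Icc (0 : ℝ) 1) →
    ∀ (f : Omega d n → E d), Measurable f →
    ∀ (G : Fin d → (j : ℕ) → Omega d n → HTensor d n j),
      (∀ i, HasSobolevDerivs (law z r α ν n) (psi z r) θ
        ((2 * (d + 2) * (d + 3) : ℕ) : ℝ≥0∞) ((d + 2) ^ 2) (fun ω => f ω i) (G i)) →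
    ∀ (Ξ : Set (Omega d n)), MeasurableSet[sigmaEpsZeta d n] Ξ →
    ∀ N : ℝ≥0∞, N ≠ ∞ → (∀ i, ∀ m ∈ Finset.range (q + 1),
      eLpNorm (G i (m + 1)) ((2 * (q + 1) * (q + 2) : ℕ) : ℝ≥0∞) (law z r α ν n) ≤ N) →
    (∀ᵐ ω ∂((law z r α ν n).restrict Ξ), (Matrix.of (malMat G ω)).det ≠ 0) →
    (∀ a ≤ 2 * q, ∫⁻ ω in Ξ, maxNorm (Matrix.of (malMat G ω))⁻¹ ^ (4 * a) ∂(law z r α ν n) ≠ ∞) →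
    ∀ (I : List (Fin d)), I.length = q → ∀ (φ : E d → ℝ),
      ContDiff ℝ ((⊤ : ℕ∞) : WithTop ℕ∞) φ → ∀ B : ℝ, 0 ≤ B →
      (∀ J : List (Fin d), J.length ≤ q → ∀ x, |pders J φ x| ≤ B) →
      ‖∫ ω in Ξ, pders I φ (f ω) ∂(law z r α ν n)‖ₑ ≤
        (∫⁻ ω in Ξ, ENNReal.ofReal (φ (f ω) ^ 2) ∂(law z r α ν n)) ^ (1 / 2 : ℝ) *
        (c * momentSum (fun a => ∫⁻ ω in Ξ, maxNorm (Matrix.of (malMat G ω))⁻¹ ^ (4 * a)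
          ∂(law z r α ν n)) N q) := by
  obtain ⟨c, hc, hmain⟩ := exists_enorm_setIntegral_pders_le_add z r q hq
  set D : ℝ≥0∞ := ((d * (d + 1) + 1 : ℕ) : ℝ≥0∞) with hD
  have hD1 : 1 ≤ D := by rw [hD]; exact_mod_cast Nat.le_add_left 1 _
  have hDfin : D ≠ ∞ := ENNReal.natCast_ne_top _
  refine ⟨c * D ^ (2 * q), ENNReal.mul_ne_top hc (ENNReal.pow_ne_top hDfin),
    fun α ν _ n θ hθ hθ1 f hf G hG Ξ hΞ N hN hGN hdet hT I hI φ hφ B hB0 hB => ?_⟩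
  set P := law z r α ν n with hP
  set T : ℕ → ℝ≥0∞ := fun a => ∫⁻ ω in Ξ, maxNorm (Matrix.of (malMat G ω))⁻¹ ^ (4 * a) ∂P
    with hTdef
  -- Almost everywhere on Ξ the matrix is invertible, so the regularised inverse is dominated by the
  -- true one uniformly in ε.
  have hR : ∀ ε : ℝ, 0 < ε → ∀ᵐ ω ∂(P.restrict Ξ), ENNReal.ofReal (regFun ε (malMat G ω)) ≤
      D ^ 2 * maxNorm (Matrix.of (malMat G ω))⁻¹ ^ 2 := fun ε hε => by
    filter_upwards [hdet] with ω hω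
    refine (ofReal_regFun_le (posSemidef_malMat G ω) hω hε).trans (mul_le_mul_left ?_ _)
    refine pow_le_pow_left' ?_ 2
    rw [hD]
    exact_mod_cast Nat.le_succ _
  have hTε : ∀ ε : ℝ, 0 < ε → ∀ a, ∫⁻ ω in Ξ, ENNReal.ofReal (regFun ε (malMat G ω)) ^ (2 * a) ∂P ≤
      D ^ (4 * a) * T a := fun ε hε a => by
    rw [hTdef, ← lintegral_const_mul' _ _ (ENNReal.pow_ne_top hDfin)]
    refine lintegral_mono_ae ((hR ε hε).mono fun ω hω => (pow_le_pow_left' hω _).trans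
      (le_of_eq ?_))
    rw [← mul_pow, ← pow_mul, mul_pow]
    congr 2 <;> ring
  have hW : ∀ ε : ℝ, 0 < ε → ∀ k ≤ q,
      c * momentSum (fun a => ∫⁻ ω in Ξ, ENNReal.ofReal (regFun ε (malMat G ω)) ^ (2 * a) ∂P) N k ≤
      c * D ^ (2 * q) * momentSum T N k := fun ε hε k hk => by
    rw [mul_assoc]
    exact mul_le_mul_right (momentSum_mono hD1 hk (hTε ε hε)) _
  set ε : ℕ → ℝ := fun k => 1 / ((k : ℝ) + 1) with hεdef
  have hε : ∀ k, 0 < ε k := fun k => Nat.one_div_pos_of_nat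
  have hε0 : Tendsto ε atTop (𝓝 0) := tendsto_one_div_add_atTop_nhds_zero_nat
  have hk : ∀ k, ‖∫ ω in Ξ, pders I φ (f ω) ∂P‖ₑ ≤
      (∫⁻ ω in Ξ, ENNReal.ofReal (φ (f ω) ^ 2) ∂P) ^ (1 / 2 : ℝ) *
        (c * D ^ (2 * q) * momentSum T N q) +
        ∑ j ∈ Finset.range q, ENNReal.ofReal (B * d) *
          ((c * D ^ (2 * q) * momentSum T N j) *
          (∫⁻ ω in Ξ, ENNReal.ofReal (ε k ^ 2 * regFun (ε k) (malMat G ω)) ∂P) ^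
            (1 / 2 : ℝ)) := fun k =>
    (hmain α ν n θ hθ hθ1 f hf G hG Ξ hΞ N hN hGN (ε k) (hε k) I hI φ hφ B hB0 hB).trans
      (add_le_add (mul_le_mul_right (hW _ (hε k) q le_rfl) _) (Finset.sum_le_sum fun j hj =>
      mul_le_mul_right (mul_le_mul_left (hW _ (hε k) j (Finset.mem_range.1 hj).le) _) _))
  have hGm : ∀ i, AEStronglyMeasurable (G i 1) (P.restrict Ξ) := fun i =>
    ((hG i).memLp 1 (by nlinarith)).aestronglyMeasurable.restrict
  have hMm : AEMeasurable (malMat G) (P.restrict Ξ) :=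
    aemeasurable_pi_lambda _ fun i => aemeasurable_pi_lambda _ fun j =>
      (((hGm i).inner (hGm j)).aemeasurable)
  -- The error integrand ε²R_ε is at most d², because the entries of ε(σ + ε)⁻¹ are at most 1, and
  -- it tends to zero where σ is invertible. Dominated convergence applies without moments of σ⁻¹.
  have hE : Tendsto (fun k => ∫⁻ ω in Ξ, ENNReal.ofReal (ε k ^ 2 * regFun (ε k) (malMat G ω)) ∂P)
      atTop (𝓝 0) := by
    have h := tendsto_lintegral_of_bounded (μ := P.restrict Ξ)
      (F := fun k ω => ENNReal.ofReal (ε k ^ 2 * regFun (ε k) (malMat G ω))) (f := fun _ => 0)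
      (ENNReal.ofReal (d ^ 2)) ENNReal.ofReal_ne_top
      (fun k => (((measurable_regFun (ε k)).comp_aemeasurable hMm).const_mul _).ennreal_ofReal)
      (fun k => Eventually.of_forall fun ω => ENNReal.ofReal_le_ofReal <| by
        calc ε k ^ 2 * regFun (ε k) (malMat G ω) ≤ ε k ^ 2 * (d ^ 2 * (ε k)⁻¹ ^ 2) :=
              mul_le_mul_of_nonneg_left (regFun_le (posSemidef_malMat G ω) (hε k)) (sq_nonneg _)
          _ = d ^ 2 := by
              have := (hε k).ne'
              field_simp) ?_
    · simpa using h
    · have hR' : ∀ᵐ ω ∂(P.restrict Ξ), ∀ k, ENNReal.ofReal (regFun (ε k) (malMat G ω)) ≤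
          D ^ 2 * maxNorm (Matrix.of (malMat G ω))⁻¹ ^ 2 := ae_all_iff.2 fun k => hR _ (hε k)
      filter_upwards [hR'] with ω hω
      have h0 : Tendsto (fun k => ENNReal.ofReal (ε k ^ 2) *
          (D ^ 2 * maxNorm (Matrix.of (malMat G ω))⁻¹ ^ 2)) atTop (𝓝 0) := by
        have h1 : Tendsto (fun k => ENNReal.ofReal (ε k ^ 2)) atTop (𝓝 0) := by
          simpa using ENNReal.tendsto_ofReal (hε0.pow 2)
        have h2 := ENNReal.Tendsto.mul_const (b := D ^ 2 * maxNorm (Matrix.of (malMat G ω))⁻¹ ^ 2)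
          h1 (Or.inr (ENNReal.mul_ne_top (ENNReal.pow_ne_top hDfin)
            (ENNReal.pow_ne_top (maxNorm_ne_top _))))
        simpa using h2
      refine tendsto_of_tendsto_of_tendsto_of_le_of_le tendsto_const_nhds h0
        (fun _ => zero_le) fun k => ?_
      simp only
      rw [ENNReal.ofReal_mul (sq_nonneg _)]
      exact mul_le_mul_right (hω k) _
  have hlim : Tendsto (fun k => (∫⁻ ω in Ξ, ENNReal.ofReal (φ (f ω) ^ 2) ∂P) ^ (1 / 2 : ℝ) *
        (c * D ^ (2 * q) * momentSum T N q) +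
        ∑ j ∈ Finset.range q, ENNReal.ofReal (B * d) *
          ((c * D ^ (2 * q) * momentSum T N j) *
          (∫⁻ ω in Ξ, ENNReal.ofReal (ε k ^ 2 * regFun (ε k) (malMat G ω)) ∂P) ^
            (1 / 2 : ℝ))) atTop (𝓝 ((∫⁻ ω in Ξ, ENNReal.ofReal (φ (f ω) ^ 2) ∂P) ^ (1 / 2 : ℝ) *
        (c * D ^ (2 * q) * momentSum T N q) + ∑ j ∈ Finset.range q, ENNReal.ofReal (B * d) *
          ((c * D ^ (2 * q) * momentSum T N j) * (0 : ℝ≥0∞) ^ (1 / 2 : ℝ)))) := by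
    refine tendsto_const_nhds.add (tendsto_finsetSum _ fun j hj => ?_)
    -- The error multiplies the moment sums of order j < q; these must be finite for the product to
    -- vanish in the limit.
    refine ENNReal.Tendsto.const_mul (ENNReal.Tendsto.const_mul (hE.ennrpow_const _) (Or.inr ?_))
      (Or.inr ENNReal.ofReal_ne_top)
    refine ENNReal.mul_ne_top (ENNReal.mul_ne_top hc (ENNReal.pow_ne_top hDfin))
      (momentSum_ne_top (fun a ha => hT a (ha.trans ?_)) hN)
    have := Finset.mem_range.1 hj
    omega
  have h := ge_of_tendsto' hlim hk
  rwa [ENNReal.zero_rpow_of_pos (by norm_num), Finset.sum_eq_zero (by simp), add_zero] at h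

end Nondegenerate

/-! ### The constants K_q. -/

section Constants

variable {d n : ℕ} {P : Measure (Omega d n)} {ψ : E d → ℝ} {θ : (Fin n → E d) → ℝ}
  {f : Omega d n → E d} {Ξ : Set (Omega d n)}

lemma hasSobolevDerivs_derivs (hf : MemSobolevVec P ψ θ f) (i : Fin d) :
    HasSobolevDerivs P ψ θ ((2 * (d + 2) * (d + 3) : ℕ) : ℝ≥0∞) ((d + 2) ^ 2)
      (fun ω => f ω i) (derivs P ψ θ f i) := by
  unfold derivs sobolevDeriv
  rw [dif_pos (hf i)]
  exact (hf i).choose_spec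

lemma malliavinMatrix_eq (ω : Omega d n) :
    malliavinMatrix P ψ θ f ω = Matrix.of (malMat (derivs P ψ θ f) ω) := rfl

lemma eLpNorm_derivs_le_sobolevMax (q : ℕ) (i : Fin d) {m : ℕ}
    (hm : m ∈ Finset.Icc 1 ((q + 1) ^ 2)) :
    eLpNorm (derivs P ψ θ f i m) ((2 * (q + 1) * (q + 2) : ℕ) : ℝ≥0∞) P ≤
      sobolevMax P ψ θ f q :=
  le_iSup_of_le i (le_iSup₂_of_le m hm le_rfl)

lemma sobolevMax_ne_top [IsProbabilityMeasure P] (hf : MemSobolevVec P ψ θ f) {q : ℕ}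
    (hq : q ≤ d + 1) : sobolevMax P ψ θ f q ≠ ∞ := by
  have hexp : ((2 * (q + 1) * (q + 2) : ℕ) : ℝ≥0∞) ≤ ((2 * (d + 2) * (d + 3) : ℕ) : ℝ≥0∞) := by
    have h : (q + 1) * (q + 2) ≤ (d + 2) * (d + 3) := Nat.mul_le_mul (by omega) (by omega)
    exact_mod_cast (by nlinarith : 2 * (q + 1) * (q + 2) ≤ 2 * (d + 2) * (d + 3))
  set S : Finset (Fin d × ℕ) := Finset.univ ×ˢ Finset.Icc 1 ((q + 1) ^ 2) with hS
  obtain ⟨p, hp⟩ : ∃ p : ℝ≥0∞, p = ((2 * (q + 1) * (q + 2) : ℕ) : ℝ≥0∞) := ⟨_, rfl⟩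
  unfold sobolevMax
  rw [← hp] at hexp ⊢
  set Δ : Fin d × ℕ → ℝ≥0∞ := fun a => eLpNorm (derivs P ψ θ f a.1 a.2) p P with hΔ
  have hΔtop : ∀ a ∈ S, Δ a ≠ ∞ := fun a ha => by
    have ha2 := (Finset.mem_Icc.1 (Finset.mem_product.1 ha).2).2
    have h2 : (q + 1) ^ 2 ≤ (d + 2) ^ 2 := Nat.pow_le_pow_left (by omega) 2
    exact (((hasSobolevDerivs_derivs hf a.1).memLp a.2 (ha2.trans h2)).mono_exponent hexp).2.ne
  refine ne_top_of_le_ne_top (ENNReal.sum_ne_top.2 hΔtop)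
    (iSup_le fun i => iSup₂_le fun m hm => ?_)
  have h1 : Δ (i, m) ≤ ∑ a ∈ S, Δ a := Finset.single_le_sum (f := Δ)
    (fun _ _ => zero_le) (Finset.mem_product.2 ⟨Finset.mem_univ i, hm⟩)
  exact h1

/-- If N_q(f) = 0 then Df = 0, so the Malliavin matrix vanishes and, as d ≥ 1, its determinant is
zero; this contradicts nondegeneracy on Ξ unless Ξ is null. It settles the case in which K_q is
finite only by the convention 0 · ∞ = 0. -/
lemma measure_eq_zero_of_sobolevMax_eq_zero (hd : 1 ≤ d) (hf : MemSobolevVec P ψ θ f)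
    (hdet : ∀ᵐ ω ∂P, ω ∈ Ξ → 0 < (malliavinMatrix P ψ θ f ω).det) {q : ℕ}
    (h0 : sobolevMax P ψ θ f q = 0) : P Ξ = 0 := by
  have hz : ∀ᵐ ω ∂P, ∀ i, derivs P ψ θ f i 1 ω = 0 := ae_all_iff.2 fun i => by
    have h1 : eLpNorm (derivs P ψ θ f i 1) ((2 * (q + 1) * (q + 2) : ℕ) : ℝ≥0∞) P = 0 :=
      le_antisymm ((eLpNorm_derivs_le_sobolevMax q i
        (Finset.mem_Icc.2 ⟨le_rfl, Nat.one_le_pow _ _ (by omega)⟩)).trans h0.le) zero_le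
    exact (eLpNorm_eq_zero_iff ((hasSobolevDerivs_derivs hf i).memLp 1
      (by nlinarith)).aestronglyMeasurable (by simp)).1 h1
  refine measure_mono_null (t := {ω | ¬ (ω ∈ Ξ → 0 < (malliavinMatrix P ψ θ f ω).det)} ∪
    {ω | ¬ ∀ i, derivs P ψ θ f i 1 ω = 0}) ?_ (measure_union_null hdet hz)
  intro ω hω
  by_contra hcon
  simp only [Set.mem_union, Set.mem_ofPred_eq, not_or, not_not] at hcon
  have h := hcon.1 hω
  have hM : malliavinMatrix P ψ θ f ω = 0 := by
    ext i j
    simp [malliavinMatrix, hcon.2]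
  have : Nonempty (Fin d) := ⟨⟨0, hd⟩⟩
  rw [hM, Matrix.det_zero] at h
  exact lt_irrefl _ h

/-- The term M = q of K_q carries the highest moment, of order 4(q + q), with coefficient N^{3q}. If
N ≠ 0 an infinite moment would make K_q infinite; if N = 0 then ϱ vanishes almost surely. -/
lemma lintegral_rho_ne_top_of_K_ne_top (hd : 1 ≤ d) (hf : MemSobolevVec P ψ θ f)
    (hdet : ∀ᵐ ω ∂P, ω ∈ Ξ → 0 < (malliavinMatrix P ψ θ f ω).det) {q : ℕ} (hq : q ≠ 0) {L : ℝ≥0}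
    (hL : 0 < L) (hK : K P ψ θ L q f Ξ ≠ ∞) :
    ∫⁻ ω, maxNorm (rho P ψ θ f Ξ ω) ^ (8 * q) ∂P ≠ ∞ := by
  rcases eq_or_ne (sobolevMax P ψ θ f q) 0 with h0 | h0
  · have hΞ := measure_eq_zero_of_sobolevMax_eq_zero hd hf hdet h0
    have hz : ∀ᵐ ω ∂P, maxNorm (rho P ψ θ f Ξ ω) ^ (8 * q) = 0 := by
      filter_upwards [measure_eq_zero_iff_ae_notMem.1 hΞ] with ω hω
      rw [rho, if_neg hω, maxNorm]
      simp [hq]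
    rw [lintegral_congr_ae hz]
    simp
  · refine fun htop => hK ?_
    unfold K
    refine ENNReal.mul_eq_top.2 (Or.inl ⟨by exact_mod_cast hL.ne', ?_⟩)
    refine ENNReal.sum_eq_top.2 ⟨q, by simp, ?_⟩
    rw [show 4 * (q + q) = 8 * q by ring, htop, ENNReal.top_rpow_of_pos (by norm_num)]
    exact ENNReal.mul_top (pow_ne_zero _ h0)

lemma lintegral_pow_ne_top_of_le [IsFiniteMeasure P] {g : Omega d n → ℝ≥0∞} {a b : ℕ}
    (hab : a ≤ b) (h : ∫⁻ ω, g ω ^ b ∂P ≠ ∞) : ∫⁻ ω, g ω ^ a ∂P ≠ ∞ := by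
  refine ne_top_of_le_ne_top (b := ∫⁻ ω, (1 + g ω ^ b) ∂P) ?_ (lintegral_mono fun ω => ?_)
  · rw [lintegral_add_left measurable_const]
    simpa using h
  · rcases le_total (g ω) 1 with h1 | h1
    · exact (pow_le_one' h1 a).trans le_self_add
    · exact (pow_le_pow_right₀ h1 hab).trans le_add_self

lemma K_ne_top [IsProbabilityMeasure P] (hf : MemSobolevVec P ψ θ f) {q : ℕ} (hq : q ≤ d + 1)
    (L : ℝ≥0) (h : ∫⁻ ω, maxNorm (rho P ψ θ f Ξ ω) ^ (8 * q) ∂P ≠ ∞) : K P ψ θ L q f Ξ ≠ ∞ :=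
  ENNReal.mul_ne_top ENNReal.coe_ne_top <| ENNReal.sum_ne_top.2 fun M hM =>
    ENNReal.mul_ne_top (ENNReal.pow_ne_top (sobolevMax_ne_top hf hq)) <|
      ENNReal.rpow_ne_top_of_nonneg (by norm_num) <| lintegral_pow_ne_top_of_le
        (by have := Finset.mem_range.1 hM; omega) h

/-- The integration by parts inequality with the constants `K_q`. -/
lemma exists_enorm_setIntegral_pders_le_K (z : E d) (r : ℝ) [Fact (0 < r)] (q : ℕ)
    (hq : q ≤ d + 1) : ∃ L : ℝ≥0, 0 < L ∧
    ∀ (α : unitInterval) (ν : Measure (E d)) [IsProbabilityMeasure ν] (n : ℕ)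
      (θ : (Fin n → E d) → ℝ), Measurable θ → (∀ x, θ x ∈ Set.Icc (0 : ℝ) 1) →
    ∀ (f : Omega d n → E d), Measurable f → MemSobolevVec (law z r α ν n) (psi z r) θ f →
    ∀ (Ξ : Set (Omega d n)), MeasurableSet[sigmaEpsZeta d n] Ξ →
    (∀ᵐ ω ∂(law z r α ν n), ω ∈ Ξ →
      0 < (malliavinMatrix (law z r α ν n) (psi z r) θ f ω).det) →
    ∫⁻ ω, maxNorm (rho (law z r α ν n) (psi z r) θ f Ξ ω) ^ (8 * q) ∂(law z r α ν n) ≠ ∞ →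
    ∀ (I : List (Fin d)), I.length = q → ∀ (φ : E d → ℝ),
      ContDiff ℝ ((⊤ : ℕ∞) : WithTop ℕ∞) φ → ∀ B : ℝ, 0 ≤ B →
      (∀ J : List (Fin d), J.length ≤ q → ∀ x, |pders J φ x| ≤ B) →
      ‖∫ ω in Ξ, pders I φ (f ω) ∂(law z r α ν n)‖ₑ ≤
        K (law z r α ν n) (psi z r) θ L q f Ξ *
        (∫⁻ ω in Ξ, ENNReal.ofReal (φ (f ω) ^ 2) ∂(law z r α ν n)) ^ (1 / 2 : ℝ) := by
  obtain ⟨c, hc, hmain⟩ := exists_enorm_setIntegral_pders_le_momentSum z r q hq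
  -- The `+ 1` makes the constant positive, as is needed to recover moments of ϱ from a finite K_q.
  refine ⟨c.toNNReal + 1, by positivity, fun α ν _ n θ hθ hθ1 f hf hmem Ξ hΞ hdet hfin I hI φ hφ
    B hB0 hB => ?_⟩
  set P := law z r α ν n with hP
  have hΞm : MeasurableSet Ξ := by
    obtain ⟨Ξ', hΞ', rfl⟩ := hΞ
    exact measurable_snd hΞ'
  have hle : ∀ a, ∫⁻ ω in Ξ, maxNorm (Matrix.of (malMat (derivs P (psi z r) θ f) ω))⁻¹ ^ a ∂P ≤
      ∫⁻ ω, maxNorm (rho P (psi z r) θ f Ξ ω) ^ a ∂P := fun a => by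
    refine le_trans (le_of_eq (setLIntegral_congr_fun hΞm fun ω hω => ?_))
      (setLIntegral_le_lintegral Ξ _)
    simp only [rho, if_pos hω, malliavinMatrix_eq]
  have h := hmain α ν n θ hθ hθ1 f hf _ (hasSobolevDerivs_derivs hmem) Ξ hΞ
    (sobolevMax P (psi z r) θ f q) (sobolevMax_ne_top hmem hq)
    -- Only derivatives of orders 1 to q + 1 occur, all within the range up to (q + 1)² over which
    -- N_q is taken.
    (fun i m hm => eLpNorm_derivs_le_sobolevMax q i (Finset.mem_Icc.2 ⟨by omega, by
      have := Finset.mem_range.1 hm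
      nlinarith⟩))
    ((ae_restrict_iff' hΞm).2 (hdet.mono fun ω hω hmem => (hω hmem).ne'))
    (fun a ha => ne_top_of_le_ne_top
      (lintegral_pow_ne_top_of_le (by omega : 4 * a ≤ 8 * q) hfin) (hle _))
    I hI φ hφ B hB0 hB
  refine h.trans ?_
  rw [mul_comm]
  refine mul_le_mul_left ?_ _
  unfold K momentSum
  gcongr with M hM
  · rw [← ENNReal.coe_toNNReal hc]
    exact_mod_cast le_self_add
  · rw [add_comm q M]
    exact hle _

end Constants

/-! ### Weak convergence of measures with equi-Lipschitz densities. -/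

section LipschitzDensity

variable {d : ℕ}

/-- The volume of a ball of radius `δ`. -/
noncomputable def ballVol (d : ℕ) (δ : ℝ) : ℝ := δ ^ d * volume.real (Metric.ball (0 : E d) 1)

lemma ballVol_pos {δ : ℝ} (hδ : 0 < δ) : 0 < ballVol d δ :=
  mul_pos (pow_pos hδ _) (ENNReal.toReal_pos
    (Metric.measure_ball_pos volume _ zero_lt_one).ne' measure_ball_lt_top.ne)

lemma volume_ball_eq (y : E d) {δ : ℝ} (hδ : 0 < δ) :
    volume (Metric.ball y δ) = ENNReal.ofReal (ballVol d δ) := by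
  rw [Measure.addHaar_ball_of_pos volume y hδ, ballVol, ENNReal.ofReal_mul (by positivity),
    measureReal_def, ENNReal.ofReal_toReal measure_ball_lt_top.ne, finrank_euclideanSpace_fin]

lemma continuous_ballVol : Continuous (ballVol d) := by
  unfold ballVol
  fun_prop

lemma withDensity_ball_le {p : E d → ℝ} {L : ℝ≥0} (hp0 : ∀ y, 0 ≤ p y) (hp : LipschitzWith L p)
    (y : E d) {δ : ℝ} (hδ : 0 < δ) :
    (volume.withDensity fun x => ENNReal.ofReal (p x)) (Metric.ball y δ) ≤
      ENNReal.ofReal ((p y + L * δ) * ballVol d δ) := by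
  rw [withDensity_apply _ Metric.isOpen_ball.measurableSet,
    ENNReal.ofReal_mul (add_nonneg (hp0 y) (by positivity)), ← volume_ball_eq y hδ,
    ← setLIntegral_const]
  refine setLIntegral_mono measurable_const fun x hx => ENNReal.ofReal_le_ofReal ?_
  have h := (le_abs_self _).trans (hp.dist_le_mul x y)
  have h2 : (L : ℝ) * dist x y ≤ L * δ :=
    mul_le_mul_of_nonneg_left (Metric.mem_ball.1 hx).le L.2
  linarith

lemma le_withDensity_ball {p : E d → ℝ} {L : ℝ≥0} (hp : LipschitzWith L p)
    (y : E d) {δ : ℝ} (hδ : 0 < δ) :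
    ENNReal.ofReal ((p y - L * δ) * ballVol d δ) ≤
      (volume.withDensity fun x => ENNReal.ofReal (p x)) (Metric.ball y δ) := by
  rw [withDensity_apply _ Metric.isOpen_ball.measurableSet,
    ENNReal.ofReal_mul' (ballVol_pos hδ).le, ← volume_ball_eq y hδ, ← setLIntegral_const]
  refine setLIntegral_mono hp.continuous.measurable.ennreal_ofReal
    fun x hx => ENNReal.ofReal_le_ofReal ?_
  have h := (le_abs_self _).trans (hp.dist_le_mul y x)
  have h2 : (L : ℝ) * dist y x ≤ L * δ := by
    rw [dist_comm]
    exact mul_le_mul_of_nonneg_left (Metric.mem_ball.1 hx).le L.2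
  linarith

/-- Comparison of two Lipschitz densities with Lévy-Prokhorov close laws. -/
lemma density_sub_le {μ ν : Measure (E d)} [IsFiniteMeasure μ] [IsFiniteMeasure ν]
    (hν : ν Set.univ ≤ 1) {p q : E d → ℝ} {L : ℝ≥0}
    (hq0 : ∀ y, 0 ≤ q y) (hp : LipschitzWith L p) (hq : LipschitzWith L q)
    (hμp : μ = volume.withDensity fun y => ENNReal.ofReal (p y))
    (hνq : ν = volume.withDensity fun y => ENNReal.ofReal (q y))
    {δ η : ℝ} (hδ : 0 < δ) (hη : 0 < η) (hLP : levyProkhorovEDist μ ν < ENNReal.ofReal η) (y : E d) :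
    (p y - q y) * ballVol d δ ≤ L * δ * ballVol d δ +
      (1 / ballVol d 1 + L) * (ballVol d (δ + η) - ballVol d δ) +
      L * (δ + η) * ballVol d (δ + η) + η := by
  have h1 := left_measure_le_of_levyProkhorovEDist_lt hLP
    (Metric.isOpen_ball (x := y) (ε := δ)).measurableSet
  rw [ENNReal.toReal_ofReal hη.le] at h1
  have h2 : ν (Metric.thickening η (Metric.ball y δ)) ≤
      ENNReal.ofReal ((q y + L * (δ + η)) * ballVol d (δ + η)) := by
    refine (measure_mono ?_).trans (hνq ▸ withDensity_ball_le hq0 hq y (by positivity))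
    rw [add_comm]
    exact (thickening_ball hη hδ y).subset
  have hb : 0 ≤ (q y + L * (δ + η)) * ballVol d (δ + η) :=
    mul_nonneg (add_nonneg (hq0 y) (by positivity)) (ballVol_pos (by positivity)).le
  have h3 : (p y - L * δ) * ballVol d δ ≤ (q y + L * (δ + η)) * ballVol d (δ + η) + η := by
    have h := (hμp ▸ le_withDensity_ball hp y hδ).trans (h1.trans (add_le_add_left h2 _))
    rw [← ENNReal.ofReal_add hb hη.le] at h
    exact (ENNReal.ofReal_le_ofReal_iff (by positivity)).1 h
  -- On the unit ball around y the density is at least q(y) − L, and the mass of that ball is at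
  -- most 1.
  have h4 : q y ≤ 1 / ballVol d 1 + L := by
    have h := (hνq ▸ le_withDensity_ball hq y zero_lt_one : ENNReal.ofReal _ ≤ ν _).trans
      ((measure_mono (Set.subset_univ _)).trans hν)
    rw [← ENNReal.ofReal_one] at h
    have h5 := (ENNReal.ofReal_le_ofReal_iff zero_le_one).1 h
    rw [← le_div_iff₀ (ballVol_pos zero_lt_one)] at h5
    linarith
  have h5 : 0 ≤ ballVol d (δ + η) - ballVol d δ := by
    unfold ballVol
    rw [← sub_mul]
    exact mul_nonneg (sub_nonneg.2 (pow_le_pow_left₀ hδ.le (by linarith) _)) measureReal_nonneg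
  nlinarith [mul_le_mul_of_nonneg_right h4 h5]

/-- At a small fixed scale δ a Lipschitz density is read off from masses of balls, and these are
compared through the Lévy–Prokhorov distance. The bound η depends on L, e and d but not on the
measures. -/
lemma exists_density_close (L : ℝ≥0) {e : ℝ} (he : 0 < e) : ∃ η : ℝ, 0 < η ∧
    ∀ (μ ν : Measure (E d)) [IsFiniteMeasure μ] [IsFiniteMeasure ν], ν Set.univ ≤ 1 →
    ∀ (p q : E d → ℝ), (∀ y, 0 ≤ q y) → LipschitzWith L p → LipschitzWith L q →
    (μ = volume.withDensity fun y => ENNReal.ofReal (p y)) →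
    (ν = volume.withDensity fun y => ENNReal.ofReal (q y)) →
    levyProkhorovEDist μ ν < ENNReal.ofReal η → ∀ y, p y - q y < e := by
  -- At η = 0 the error in `density_sub_le` is 2Lδ times the volume of the ball, strictly below e
  -- times that volume; by continuity this persists for small η > 0.
  set δ : ℝ := e / (2 * L + 1) with hδ
  have hδ0 : 0 < δ := by positivity
  have hδe : 2 * L * δ < e := by
    rw [hδ, mul_div_assoc', div_lt_iff₀ (by positivity)]
    nlinarith [L.2]
  have hv := ballVol_pos (d := d) hδ0
  have hcont : Continuous fun η : ℝ => L * δ * ballVol d δ +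
      (1 / ballVol d 1 + L) * (ballVol d (δ + η) - ballVol d δ) +
      L * (δ + η) * ballVol d (δ + η) + η := by
    have := continuous_ballVol (d := d)
    fun_prop
  have hlt : (fun η : ℝ => L * δ * ballVol d δ +
      (1 / ballVol d 1 + L) * (ballVol d (δ + η) - ballVol d δ) +
      L * (δ + η) * ballVol d (δ + η) + η) 0 < e * ballVol d δ := by
    simp only [add_zero, sub_self, mul_zero]
    nlinarith
  have hev := (hcont.tendsto 0).eventually_lt_const hlt
  obtain ⟨η, hη, hη0⟩ := ((hev.filter_mono nhdsWithin_le_nhds).and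
    (self_mem_nhdsWithin : Set.Ioi (0 : ℝ) ∈ 𝓝[>] 0)).exists
  refine ⟨η, hη0, fun μ ν _ _ hν p q hq0 hp hq hμp hνq hLP y => ?_⟩
  exact lt_of_mul_lt_mul_right ((density_sub_le hν hq0 hp hq hμp hνq hδ0 hη0 hLP y).trans_lt hη)
    hv.le

/-- For compact sets, closeness in the Lévy-Prokhorov distance passes to limits. -/
lemma measure_isCompact_le {ι : Type*} {l : Filter ι} [NeBot l] {μs νs : ι → Measure (E d)}
    {μ ν : Measure (E d)} [IsFiniteMeasureOnCompacts ν]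
    (h1 : ∀ A : Set (E d), MeasurableSet A → Bornology.IsBounded A → ∀ e : ℝ, 0 < e →
      ∀ᶠ i in l, μ A ≤ μs i A + ENNReal.ofReal e)
    (h2 : Tendsto (fun i => levyProkhorovEDist (μs i) (νs i)) l (𝓝 0))
    (h3 : ∀ A : Set (E d), MeasurableSet A → Bornology.IsBounded A → ∀ e : ℝ, 0 < e →
      ∀ᶠ i in l, νs i A ≤ ν A + ENNReal.ofReal e) {A : Set (E d)} (hA : IsCompact A) :
    μ A ≤ ν A := by
  -- The closed thickenings of a compact set decrease to it, so their measures converge; this is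
  -- what compactness is needed for.
  have hlim : Tendsto (fun η : ℝ => ν (Metric.cthickening η A) + ENNReal.ofReal η +
      ENNReal.ofReal η + ENNReal.ofReal η) (𝓝[>] 0) (𝓝 (ν A + 0 + 0 + 0)) := by
    have h0 : Tendsto (fun η : ℝ => ENNReal.ofReal η) (𝓝[>] 0) (𝓝 0) := by
      have := (ENNReal.continuous_ofReal.tendsto 0).mono_left
        (nhdsWithin_le_nhds (s := Set.Ioi (0 : ℝ)))
      simpa using this
    exact ((((tendsto_measure_cthickening_of_isCompact hA).mono_left nhdsWithin_le_nhds).add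
      h0).add h0).add h0
  simp only [add_zero] at hlim
  refine ge_of_tendsto hlim ?_
  filter_upwards [self_mem_nhdsWithin] with η hη
  have hη0 : 0 < η := hη
  obtain ⟨i, hi1, hi2, hi3⟩ := ((h1 A hA.measurableSet hA.isBounded η hη0).and
    ((h2.eventually_lt_const (ENNReal.ofReal_pos.2 hη0)).and
    (h3 (Metric.cthickening η A) Metric.isClosed_cthickening.measurableSet
      hA.isBounded.cthickening η hη0))).exists
  have h4 := left_measure_le_of_levyProkhorovEDist_lt hi2 hA.measurableSet
  rw [ENNReal.toReal_ofReal hη0.le] at h4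
  calc μ A ≤ μs i A + ENNReal.ofReal η := hi1
    _ ≤ νs i (Metric.thickening η A) + ENNReal.ofReal η + ENNReal.ofReal η :=
      add_le_add_left h4 _
    _ ≤ νs i (Metric.cthickening η A) + ENNReal.ofReal η + ENNReal.ofReal η := by
      gcongr
      exact Metric.thickening_subset_cthickening η A
    _ ≤ _ := by gcongr

lemma withDensity_le_add {p q : E d → ℝ} (hq : Measurable q)
    {c : ℝ} (h : ∀ y, p y ≤ q y + c) {A : Set (E d)} (hA : MeasurableSet A) :
    (volume.withDensity fun y => ENNReal.ofReal (p y)) A ≤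
      (volume.withDensity fun y => ENNReal.ofReal (q y)) A + ENNReal.ofReal c * volume A := by
  rw [withDensity_apply _ hA, withDensity_apply _ hA, ← setLIntegral_const,
    ← lintegral_add_left hq.ennreal_ofReal]
  exact setLIntegral_mono (hq.ennreal_ofReal.add measurable_const) fun x _ =>
    (ENNReal.ofReal_le_ofReal (h x)).trans ENNReal.ofReal_add_le

lemma eventually_withDensity_le {ι : Type*} {l : Filter ι} {ps qs : ι → E d → ℝ}
    (hqs : ∀ i, Measurable (qs i)) (h : ∀ c : ℝ, 0 < c → ∀ᶠ i in l, ∀ y, ps i y ≤ qs i y + c)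
    (A : Set (E d)) (hA : MeasurableSet A) (hb : Bornology.IsBounded A) (e : ℝ) (he : 0 < e) :
    ∀ᶠ i in l, (volume.withDensity fun y => ENNReal.ofReal (ps i y)) A ≤
      (volume.withDensity fun y => ENNReal.ofReal (qs i y)) A + ENNReal.ofReal e := by
  have hvol : volume A ≠ ∞ := hb.measure_lt_top.ne
  filter_upwards [h (e / (volume.real A + 1)) (by positivity)] with i hi
  refine (withDensity_le_add (hqs i) hi hA).trans (add_le_add_right ?_ _)
  rw [← ENNReal.ofReal_toReal hvol, ← ENNReal.ofReal_mul (by positivity)]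
  refine ENNReal.ofReal_le_ofReal ?_
  rw [← measureReal_def, div_mul_eq_mul_div, div_le_iff₀ (by positivity)]
  nlinarith [measureReal_nonneg (μ := volume) (s := A)]

/-- Weakly convergent measures with equi-Lipschitz densities: the densities converge uniformly
to a Lipschitz density of the limit. -/
lemma exists_density_of_tendsto {ι : Type*} {l : Filter ι} [NeBot l] {μs : ι → Measure (E d)}
    [∀ i, IsFiniteMeasure (μs i)] {μ : Measure (E d)} [IsFiniteMeasure μ]
    (hmass : ∀ i, μs i Set.univ ≤ 1) {ps : ι → E d → ℝ} {L : ℝ≥0} (h0 : ∀ i y, 0 ≤ ps i y)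
    (hL : ∀ i, LipschitzWith L (ps i))
    (hμs : ∀ i, μs i = volume.withDensity fun y => ENNReal.ofReal (ps i y))
    (hlim : Tendsto (fun i => levyProkhorovEDist (μs i) μ) l (𝓝 0)) :
    ∃ p : E d → ℝ, (∀ y, 0 ≤ p y) ∧ LipschitzWith L p ∧
      (μ = volume.withDensity fun y => ENNReal.ofReal (p y)) ∧ TendstoUniformly ps p l := by
  -- Laws close to the limit are close to each other, hence so are their densities, uniformly in y.
  have hcauchy : UniformCauchySeqOn ps l Set.univ := by
    intro s hs
    obtain ⟨e, he, hes⟩ := Metric.mem_uniformity_dist.1 hs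
    obtain ⟨η, hη, hclose⟩ := exists_density_close (d := d) L he
    have hev : ∀ᶠ i in l, levyProkhorovEDist (μs i) μ < ENNReal.ofReal (η / 2) :=
      hlim.eventually_lt_const (ENNReal.ofReal_pos.2 (by positivity))
    filter_upwards [hev.prod_mk hev] with m hm y _
    have hd : ∀ i j, levyProkhorovEDist (μs i) μ < ENNReal.ofReal (η / 2) →
        levyProkhorovEDist (μs j) μ < ENNReal.ofReal (η / 2) →
        levyProkhorovEDist (μs i) (μs j) < ENNReal.ofReal η := fun i j hi hj => by
      refine (levyProkhorovEDist_triangle _ μ _).trans_lt ?_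
      rw [levyProkhorovEDist_comm μ, ← add_halves η,
        ENNReal.ofReal_add (by positivity) (by positivity)]
      exact ENNReal.add_lt_add hi hj
    refine hes ?_
    rw [Real.dist_eq, abs_sub_lt_iff]
    exact ⟨hclose _ _ (hmass _) _ _ (h0 _) (hL _) (hL _) (hμs _) (hμs _) (hd _ _ hm.1 hm.2) y,
      hclose _ _ (hmass _) _ _ (h0 _) (hL _) (hL _) (hμs _) (hμs _) (hd _ _ hm.2 hm.1) y⟩
  choose p hp using fun y => CompleteSpace.complete (hcauchy.cauchy_map (Set.mem_univ y))
  have hpt : ∀ y, Tendsto (fun i => ps i y) l (𝓝 (p y)) := hp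
  have hunif : TendstoUniformly ps p l :=
    tendstoUniformlyOn_univ.1 (hcauchy.tendstoUniformlyOn_of_tendsto fun y _ => hpt y)
  have hpL : LipschitzWith L p := LipschitzWith.of_dist_le_mul fun x y =>
    le_of_tendsto' ((hpt x).dist (hpt y)) fun i => (hL i).dist_le_mul x y
  have hp0 : ∀ y, 0 ≤ p y := fun y => ge_of_tendsto' (hpt y) fun i => h0 i y
  refine ⟨p, hp0, hpL, ?_, hunif⟩
  have hu := Metric.tendstoUniformly_iff.1 hunif
  set ν : Measure (E d) := volume.withDensity fun y => ENNReal.ofReal (p y) with hν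
  have hloc : IsLocallyFiniteMeasure ν :=
    IsLocallyFiniteMeasure.withDensity_ofReal hpL.continuous
  -- Uniform closeness of densities controls masses of bounded sets only. Both inequalities are
  -- therefore proved on compact sets and extended by inner regularity.
  have hcomp : ∀ A : Set (E d), IsCompact A → μ A = ν A := fun A hA => by
    refine le_antisymm ?_ ?_
    · refine measure_isCompact_le (l := l) (μs := fun _ => μ) (νs := μs)
        (fun A _ _ e he => Eventually.of_forall fun _ => le_self_add) ?_ ?_ hA
      · simpa only [levyProkhorovEDist_comm μ] using hlim
      · intro A hA hb e he
        simp only [hμs]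
        refine eventually_withDensity_le (qs := fun _ => p) (fun _ => hpL.continuous.measurable)
          (fun c hc => ?_) A hA hb e he
        filter_upwards [hu c hc] with i hi y
        have := (abs_sub_lt_iff.1 (Real.dist_eq _ _ ▸ hi y)).2
        linarith
    · refine measure_isCompact_le (l := l) (μs := μs) (νs := fun _ => μ) ?_ hlim
        (fun A _ _ e he => Eventually.of_forall fun _ => le_self_add) hA
      intro A hA hb e he
      simp only [hμs]
      refine eventually_withDensity_le (ps := fun _ => p) (fun i => (hL i).continuous.measurable)
          (fun c hc => ?_) A hA hb e he
      filter_upwards [hu c hc] with i hi y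
      have := (abs_sub_lt_iff.1 (Real.dist_eq _ _ ▸ hi y)).1
      linarith
  ext A hA
  -- Nothing yet says that p is integrable; exhausting the space by compact sets bounds its total
  -- mass by that of μ.
  have hνtop : ν A ≠ ∞ := by
    refine ne_top_of_le_ne_top (measure_ne_top μ Set.univ) ?_
    refine (measure_mono (Set.subset_univ A)).trans ?_
    rw [isOpen_univ.measure_eq_iSup_isCompact ν]
    exact iSup₂_le fun K _ => iSup_le fun hK => by
      rw [← hcomp K hK]; exact measure_mono (Set.subset_univ _)
  rw [hA.measure_eq_iSup_isCompact_of_ne_top (measure_ne_top μ A),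
    hA.measure_eq_iSup_isCompact_of_ne_top hνtop]
  exact iSup_congr fun K => iSup_congr fun _ => iSup_congr fun hK => hcomp K hK

/-- The missing mass δ bounds ν(B) − μ(B) for every B, as seen by comparing complements. -/
lemma levyProkhorovEDist_le_of_le {μ ν : Measure (E d)} (h : μ ≤ ν) [IsFiniteMeasure μ]
    {δ : ℝ≥0∞} (hδ : ν Set.univ ≤ μ Set.univ + δ) : levyProkhorovEDist μ ν ≤ δ := by
  refine levyProkhorovEDist_le_of_forall _ _ _ fun ε B hε hε' hB => ?_
  have hpos : 0 < ε.toReal := ENNReal.toReal_pos (pos_of_gt hε).ne' hε'.ne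
  have hsub : B ⊆ Metric.thickening ε.toReal B := Metric.self_subset_thickening hpos B
  refine ⟨(h B).trans ((measure_mono hsub).trans le_self_add), ?_⟩
  have h1 : ν B ≤ μ B + δ := by
    have h2 : ν B + μ Bᶜ ≤ μ B + δ + μ Bᶜ := by
      calc ν B + μ Bᶜ ≤ ν B + ν Bᶜ := add_le_add_right (h _) _
        _ = ν Set.univ := measure_add_measure_compl hB
        _ ≤ μ Set.univ + δ := hδ
        _ = μ B + δ + μ Bᶜ := by rw [← measure_add_measure_compl hB]; ring
    exact (ENNReal.add_le_add_iff_right (measure_ne_top _ _)).1 h2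
  exact h1.trans (add_le_add (measure_mono hsub) hε.le)

end LipschitzDensity

/-! ### Mixed derivatives of tensor products. -/

section ProductFunctions

variable {d : ℕ}

/-- The tensor product of functions of one real variable. -/
noncomputable def prodFun (F : Fin d → ℝ → ℝ) (x : E d) : ℝ := ∏ i, F i (x i)

lemma contDiff_prodFun {F : Fin d → ℝ → ℝ}
    (hF : ∀ i, ContDiff ℝ ((⊤ : ℕ∞) : WithTop ℕ∞) (F i)) :
    ContDiff ℝ ((⊤ : ℕ∞) : WithTop ℕ∞) (prodFun F) :=
  contDiff_prod fun i _ => (hF i).comp (EuclideanSpace.proj (𝕜 := ℝ) i).contDiff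

lemma pder_prodFun {F : Fin d → ℝ → ℝ} (hF : ∀ i, ContDiff ℝ ((⊤ : ℕ∞) : WithTop ℕ∞) (F i))
    (a : Fin d) : pder a (prodFun F) = prodFun (Function.update F a (deriv (F a))) := by
  ext x
  have hd : ∀ i ∈ Finset.univ, HasFDerivAt (fun x : E d => F i (x i))
      (deriv (F i) (x i) • (EuclideanSpace.proj (𝕜 := ℝ) i : E d →L[ℝ] ℝ)) x := fun i _ =>
    ((((hF i).differentiable (by simp)) (x i)).hasDerivAt).comp_hasFDerivAt x
      (EuclideanSpace.proj (𝕜 := ℝ) i : E d →L[ℝ] ℝ).hasFDerivAt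
  have h := HasFDerivAt.finsetProd hd
  unfold pder
  have h' : HasFDerivAt (prodFun F) _ x := h
  rw [h'.fderiv]
  have hs : ∀ i, (EuclideanSpace.proj (𝕜 := ℝ) i : E d →L[ℝ] ℝ) (EuclideanSpace.single a 1) =
      if i = a then 1 else 0 := fun i => by
    simp [EuclideanSpace.proj]
  simp only [sum_apply, smul_apply, smul_eq_mul, hs]
  rw [Finset.sum_eq_single a (fun b _ hb => by simp [hb]) (by simp)]
  unfold prodFun
  rw [← Finset.mul_prod_erase Finset.univ _ (Finset.mem_univ a)]
  simp only [Function.update_self, if_true, mul_one]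
  rw [mul_comm]
  congr 1
  refine Finset.prod_congr rfl fun i hi => ?_
  rw [Function.update_of_ne (Finset.ne_of_mem_erase hi)]

lemma pders_prodFun (I : List (Fin d)) {F : Fin d → ℝ → ℝ}
    (hF : ∀ i, ContDiff ℝ ((⊤ : ℕ∞) : WithTop ℕ∞) (F i)) :
    pders I (prodFun F) = prodFun fun i => iteratedDeriv (I.count i) (F i) := by
  induction I generalizing F with
  | nil => simp [pders]
  | cons a I ih =>
    rw [pders, pder_prodFun hF, ih]
    · congr 1
      ext i : 1
      rcases eq_or_ne i a with rfl | h
      · rw [Function.update_self, List.count_cons_self, iteratedDeriv_succ']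
      · rw [Function.update_of_ne h, List.count_cons_of_ne h.symm]
    · intro i
      rcases eq_or_ne i a with rfl | h
      · rw [Function.update_self]
        exact (contDiff_infty_iff_deriv.1 (hF i)).2
      · rw [Function.update_of_ne h]
        exact hF i

lemma pders_append (I J : List (Fin d)) (φ : E d → ℝ) :
    pders (I ++ J) φ = pders J (pders I φ) := by
  induction I generalizing φ with
  | nil => rfl
  | cons a I ih => simp only [List.cons_append, pders, ih]

lemma exists_abs_pders_prodFun_le {F : Fin d → ℝ → ℝ}
    (hF : ∀ i, ContDiff ℝ ((⊤ : ℕ∞) : WithTop ℕ∞) (F i))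
    (hb : ∀ i m, ∃ C : ℝ, ∀ t, |iteratedDeriv m (F i) t| ≤ C) (q : ℕ) :
    ∃ B : ℝ, 0 ≤ B ∧ ∀ J : List (Fin d), J.length ≤ q → ∀ x, |pders J (prodFun F) x| ≤ B := by
  choose C hC using hb
  have hC0 : ∀ i m, 0 ≤ C i m := fun i m => (abs_nonneg _).trans (hC i m 0)
  refine ⟨∏ i, ∑ m ∈ Finset.range (q + 1), C i m,
    Finset.prod_nonneg fun i _ => Finset.sum_nonneg fun m _ => hC0 i m, fun J hJ x => ?_⟩
  rw [pders_prodFun J hF, prodFun, Finset.abs_prod]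
  refine Finset.prod_le_prod (fun _ _ => abs_nonneg _) fun i _ => (hC i _ _).trans ?_
  refine Finset.single_le_sum (f := C i) (fun m _ => hC0 i m) (Finset.mem_range.2 ?_)
  exact Nat.lt_succ_of_le (List.count_le_length.trans hJ)

end ProductFunctions

/-! ### A smooth step function and its derivatives. -/

section SmoothStep

/-- The derivative of the smooth step, a bump function on `[0, 1]`. -/
noncomputable def stepDer : ℝ → ℝ := deriv Real.smoothTransition

lemma contDiff_stepDer : ContDiff ℝ ((⊤ : ℕ∞) : WithTop ℕ∞) stepDer :=
  (contDiff_infty_iff_deriv.1 Real.smoothTransition.contDiff).2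

lemma stepDer_nonneg (t : ℝ) : 0 ≤ stepDer t := Real.smoothTransition.monotone.deriv_nonneg

lemma stepDer_of_neg {t : ℝ} (ht : t < 0) : stepDer t = 0 := by
  have h : Real.smoothTransition =ᶠ[𝓝 t] fun _ => 0 := by
    filter_upwards [gt_mem_nhds ht] with x hx
    exact Real.smoothTransition.zero_of_nonpos hx.le
  rw [stepDer, h.deriv_eq, deriv_const]

lemma stepDer_of_one_lt {t : ℝ} (ht : 1 < t) : stepDer t = 0 := by
  have h : Real.smoothTransition =ᶠ[𝓝 t] fun _ => 1 := by
    filter_upwards [lt_mem_nhds ht] with x hx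
    exact Real.smoothTransition.one_of_one_le hx.le
  rw [stepDer, h.deriv_eq, deriv_const]

lemma integral_stepDer : ∫ t, stepDer t = 1 := by
  have h1 : ∫ t, stepDer t = ∫ t in (0 : ℝ)..1, stepDer t := by
    rw [intervalIntegral.integral_of_le zero_le_one, ← integral_Icc_eq_integral_Ioc]
    refine (setIntegral_eq_integral_of_forall_compl_eq_zero fun t ht => ?_).symm
    rcases not_and_or.1 ht with h | h
    · exact stepDer_of_neg (not_le.1 h)
    · exact stepDer_of_one_lt (not_le.1 h)
  rw [h1, stepDer, intervalIntegral.integral_deriv_eq_sub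
    (fun t _ => Real.smoothTransition.contDiff.differentiable (n := 1) (by simp) t)
    (contDiff_stepDer.continuous.intervalIntegrable 0 1)]
  simp

/-- The shifted and rescaled smooth step. -/
noncomputable def stepFun (ε y b : ℝ) (t : ℝ) : ℝ := Real.smoothTransition ((t - y) / ε) - b

lemma contDiff_stepFun (ε y b : ℝ) :
    ContDiff ℝ ((⊤ : ℕ∞) : WithTop ℕ∞) (stepFun ε y b) :=
  (Real.smoothTransition.contDiff.comp ((contDiff_id.sub contDiff_const).div_const ε)).sub
    contDiff_const

lemma deriv_stepFun (ε y b : ℝ) :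
    deriv (stepFun ε y b) = fun t => ε⁻¹ * stepDer ((t - y) / ε) := by
  ext t
  have h1 : HasDerivAt Real.smoothTransition (stepDer ((t - y) / ε)) ((t - y) / ε) :=
    (Real.smoothTransition.contDiff.differentiable (n := 1) (by simp) _).hasDerivAt
  have h2 : HasDerivAt (fun t : ℝ => (t - y) / ε) (1 / ε) t :=
    ((hasDerivAt_id t).sub_const y).div_const ε
  have h3 : HasDerivAt (stepFun ε y b) (stepDer ((t - y) / ε) * (1 / ε)) t :=
    (HasDerivAt.comp (h₂ := Real.smoothTransition) t h1 h2).sub_const b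
  rw [h3.deriv]
  ring

/-- The step itself is bounded, and its derivatives of positive order are continuous with compact
support. -/
lemma exists_abs_iteratedDeriv_stepFun_le {ε : ℝ} (hε : 0 < ε) (y b : ℝ) (m : ℕ) :
    ∃ C : ℝ, ∀ t, |iteratedDeriv m (stepFun ε y b) t| ≤ C := by
  rcases m with _ | m
  · refine ⟨1 + |b|, fun t => ?_⟩
    rw [iteratedDeriv_zero, stepFun]
    refine (abs_sub _ _).trans (add_le_add_left ?_ _)
    rw [abs_of_nonneg (Real.smoothTransition.nonneg _)]
    exact Real.smoothTransition.le_one _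
  · have hc : ∀ m, HasCompactSupport (iteratedDeriv (m + 1) (stepFun ε y b)) := fun m => by
      induction m with
      | zero =>
        rw [iteratedDeriv_succ, iteratedDeriv_zero, deriv_stepFun]
        refine HasCompactSupport.intro (isCompact_Icc (a := y) (b := y + ε)) fun t ht => ?_
        rcases not_and_or.1 ht with h | h
        · rw [stepDer_of_neg (div_neg_of_neg_of_pos (by linarith) hε), mul_zero]
        · rw [stepDer_of_one_lt (by rw [lt_div_iff₀ hε]; linarith), mul_zero]
      | succ m ih => rw [iteratedDeriv_succ]; exact ih.deriv
    obtain ⟨C, hC⟩ := (hc m).exists_bound_of_continuous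
      ((contDiff_stepFun ε y b).continuous_iteratedDeriv (m + 1) (by exact_mod_cast le_top))
    exact ⟨C, fun t => hC t⟩

end SmoothStep

/-! ### From integration by parts inequalities to Lipschitz densities. -/

section Mollifier

variable {d : ℕ}

/-- A bump function on `[0, ε]^d` with integral one. -/
noncomputable def moll (ε : ℝ) : E d → ℝ := prodFun fun _ t => ε⁻¹ * stepDer (t / ε)

lemma contDiff_moll (ε : ℝ) : ContDiff ℝ ((⊤ : ℕ∞) : WithTop ℕ∞) (moll (d := d) ε) :=
  contDiff_prodFun fun _ => contDiff_const.mul (contDiff_stepDer.comp (contDiff_id.div_const ε))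

lemma moll_nonneg {ε : ℝ} (hε : 0 < ε) (w : E d) : 0 ≤ moll ε w := by
  unfold moll prodFun
  exact Finset.prod_nonneg fun _ _ => mul_nonneg (inv_pos.2 hε).le (stepDer_nonneg _)

lemma norm_le_sum_abs (w : E d) : ‖w‖ ≤ ∑ i, |w i| := by
  refine abs_le_of_sq_le_sq' ?_ (Finset.sum_nonneg fun _ _ => abs_nonneg _) |>.2
  rw [EuclideanSpace.norm_sq_eq]
  simp only [Real.norm_eq_abs]
  exact Finset.sum_sq_le_sq_sum_of_nonneg fun _ _ => abs_nonneg _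

lemma norm_le_of_moll_ne_zero {ε : ℝ} (hε : 0 < ε) {w : E d} (hw : moll ε w ≠ 0) :
    ‖w‖ ≤ d * ε := by
  have h : ∀ i, |w i| ≤ ε := fun i => by
    have h1 : stepDer (w i / ε) ≠ 0 := fun h0 =>
      hw (Finset.prod_eq_zero (Finset.mem_univ i) (by simp [h0]))
    have h2 : 0 ≤ w i := by
      by_contra hcon
      exact h1 (stepDer_of_neg (div_neg_of_neg_of_pos (not_le.1 hcon) hε))
    have h3 : w i ≤ ε := by
      by_contra hcon
      exact h1 (stepDer_of_one_lt ((one_lt_div hε).2 (not_le.1 hcon)))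
    rwa [abs_of_nonneg h2]
  calc ‖w‖ ≤ ∑ i, |w i| := norm_le_sum_abs w
    _ ≤ ∑ _i : Fin d, ε := Finset.sum_le_sum fun i _ => h i
    _ = d * ε := by simp

lemma hasCompactSupport_moll {ε : ℝ} (hε : 0 < ε) : HasCompactSupport (moll (d := d) ε) :=
  HasCompactSupport.intro (isCompact_closedBall (0 : E d) (d * ε)) fun w hw => by
    by_contra h
    exact hw (mem_closedBall_zero_iff.2 (norm_le_of_moll_ne_zero hε h))

lemma integral_moll {ε : ℝ} (hε : 0 < ε) : ∫ w : E d, moll ε w = 1 := by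
  rw [← (PiLp.volume_preserving_toLp (Fin d)).integral_comp
    (MeasurableEquiv.toLp 2 (Fin d → ℝ)).measurableEmbedding]
  have h : ∀ w : Fin d → ℝ, moll ε (WithLp.toLp 2 w) = ∏ i, ε⁻¹ * stepDer (w i / ε) :=
    fun w => rfl
  simp only [h]
  rw [integral_fintype_prod_volume_eq_prod (fun (_ : Fin d) t => ε⁻¹ * stepDer (t / ε))]
  refine Finset.prod_eq_one fun i _ => ?_
  rw [integral_const_mul, Measure.integral_comp_div, integral_stepDer, abs_of_pos hε, smul_eq_mul,
    mul_one, inv_mul_cancel₀ hε.ne']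

lemma lintegral_moll {ε : ℝ} (hε : 0 < ε) : ∫⁻ w : E d, ENNReal.ofReal (moll ε w) = 1 := by
  rw [← ofReal_integral_eq_lintegral_ofReal
    ((contDiff_moll ε).continuous.integrable_of_hasCompactSupport (hasCompactSupport_moll hε))
    (Eventually.of_forall fun w => moll_nonneg hε w), integral_moll hε, ENNReal.ofReal_one]

lemma lintegral_moll_sub {ε : ℝ} (hε : 0 < ε) (x : E d) :
    ∫⁻ y : E d, ENNReal.ofReal (moll ε (x - y)) = 1 := by
  rw [lintegral_sub_left_eq_self (fun w : E d => ENNReal.ofReal (moll ε w)), lintegral_moll hε]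

/-- The regularised density of `μ`. -/
noncomputable def mollDensity (μ : Measure (E d)) (ε : ℝ) (y : E d) : ℝ := ∫ x, moll ε (x - y) ∂μ

variable {μ : Measure (E d)}

lemma mollDensity_nonneg {ε : ℝ} (hε : 0 < ε) (y : E d) : 0 ≤ mollDensity μ ε y :=
  integral_nonneg fun _ => moll_nonneg hε _

/-- The integration by parts inequality for a law on `ℝ^d`. -/
def IbpBound (μ : Measure (E d)) (A : ℝ≥0∞) (q : ℕ) : Prop :=
  ∀ (I : List (Fin d)), I.length = q → ∀ (φ : E d → ℝ),
    ContDiff ℝ ((⊤ : ℕ∞) : WithTop ℕ∞) φ → ∀ B : ℝ, 0 ≤ B →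
    (∀ J : List (Fin d), J.length ≤ q → ∀ x, |pders J φ x| ≤ B) →
    ‖∫ x, pders I φ x ∂μ‖ₑ ≤ A * (∫⁻ x, ENNReal.ofReal (φ x ^ 2) ∂μ) ^ (1 / 2 : ℝ)

/-- The test functions: products of smooth steps. -/
noncomputable def stepProd (ε : ℝ) (y : E d) (b : Fin d → ℝ) : E d → ℝ :=
  prodFun fun i => stepFun ε (y i) (b i)

/-- `List.finRange d` contains each coordinate once, so each step is differentiated once. The
constants b disappear, which leaves them free to be chosen in terms of y. -/
lemma pders_stepProd (ε : ℝ) (y : E d) (b : Fin d → ℝ) :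
    pders (List.finRange d) (stepProd ε y b) = fun x => moll ε (x - y) := by
  unfold stepProd
  rw [pders_prodFun _ fun i => contDiff_stepFun _ _ _]
  ext x
  unfold moll prodFun
  refine Finset.prod_congr rfl fun i _ => ?_
  simp only
  rw [List.count_eq_one_of_mem (List.nodup_finRange d) (List.mem_finRange i), iteratedDeriv_one,
    deriv_stepFun]
  rfl

lemma pders_stepProd_append (ε : ℝ) (y : E d) (b : Fin d → ℝ) (j : Fin d) :
    pders (List.finRange d ++ [j]) (stepProd ε y b) = fun x => pder j (moll ε) (x - y) := by
  rw [pders_append, pders_stepProd]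
  ext x
  simp only [pders, pder]
  rw [fderiv_comp_sub]

lemma abs_stepProd_le {ε : ℝ} (y : E d) {b : Fin d → ℝ} (hb : ∀ i, b i = 0 ∨ b i = 1) (x : E d) :
    |stepProd ε y b x| ≤ 1 := by
  unfold stepProd prodFun
  rw [Finset.abs_prod]
  refine Finset.prod_le_one (fun _ _ => abs_nonneg _) fun i _ => ?_
  simp only [stepFun]
  have h0 := Real.smoothTransition.nonneg ((x i - y i) / ε)
  have h1 := Real.smoothTransition.le_one ((x i - y i) / ε)
  rw [abs_le]
  rcases hb i with h | h <;> rw [h] <;> constructor <;> linarith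

lemma exists_bound_pders_stepProd {ε : ℝ} (hε : 0 < ε) (y : E d) (b : Fin d → ℝ) (q : ℕ) :
    ∃ B : ℝ, 0 ≤ B ∧ ∀ J : List (Fin d), J.length ≤ q → ∀ x, |pders J (stepProd ε y b) x| ≤ B :=
  exists_abs_pders_prodFun_le (fun _ => contDiff_stepFun _ _ _)
    (fun _ m => exists_abs_iteratedDeriv_stepFun_le hε _ _ m) q

/-- A derivative of the mollifier is a derivative of order d + 1 of a test function bounded by 1, so
the bound does not deteriorate as ε → 0. -/
lemma abs_integral_pder_moll_le {K : ℝ≥0} (hK : IbpBound μ K (d + 1)) (hμ : μ Set.univ ≤ 1)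
    {ε : ℝ} (hε : 0 < ε) (y : E d) (j : Fin d) :
    |∫ x, pder j (moll ε) (x - y) ∂μ| ≤ K := by
  obtain ⟨B, hB0, hB⟩ := exists_bound_pders_stepProd hε y (fun _ => 0) (d + 1)
  have h := hK (List.finRange d ++ [j]) (by simp) (stepProd ε y fun _ => 0)
    (contDiff_prodFun fun i => contDiff_stepFun _ _ _) B hB0 hB
  rw [pders_stepProd_append] at h
  have h1 : (∫⁻ x, ENNReal.ofReal (stepProd ε y (fun _ => 0) x ^ 2) ∂μ) ^ (1 / 2 : ℝ) ≤ 1 := by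
    refine ENNReal.rpow_le_one ?_ (by norm_num)
    calc ∫⁻ x, ENNReal.ofReal (stepProd ε y (fun _ => 0) x ^ 2) ∂μ ≤ ∫⁻ _, 1 ∂μ := by
          refine lintegral_mono fun x => ?_
          rw [← ENNReal.ofReal_one, ← sq_abs]
          exact ENNReal.ofReal_le_ofReal (pow_le_one₀ (abs_nonneg _)
            (abs_stepProd_le y (fun _ => Or.inl rfl) x))
      _ ≤ 1 := by simpa using hμ
  have h2 := h.trans (mul_le_mul_right h1 _)
  rw [mul_one, ← ofReal_norm, Real.norm_eq_abs] at h2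
  exact (ENNReal.ofReal_le_coe).1 h2

/-- The test function is bounded by 1 and, for a suitable b, vanishes outside a region slightly
larger than the orthant with corner y pointing away from the origin. -/
lemma ofReal_mollDensity_le {A : ℝ≥0∞} (hA : IbpBound μ A d) {ε : ℝ} (hε : 0 < ε) (y : E d) :
    ENNReal.ofReal (mollDensity μ ε y) ≤
      A * μ {x | ∀ i, if y i < 0 then x i ≤ y i + ε else y i ≤ x i} ^ (1 / 2 : ℝ) := by
  -- A step minus 1 vanishes to the right of its transition, a plain step to the left of it; the
  -- sign of y_i decides which side is discarded.
  set b : Fin d → ℝ := fun i => if y i < 0 then 1 else 0 with hbdef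
  have hb : ∀ i, b i = 0 ∨ b i = 1 := fun i => by
    simp only [hbdef]; split_ifs <;> simp
  obtain ⟨B, hB0, hB⟩ := exists_bound_pders_stepProd hε y b d
  have h := hA (List.finRange d) (by simp) (stepProd ε y b)
    (contDiff_prodFun fun i => contDiff_stepFun _ _ _) B hB0 hB
  rw [pders_stepProd] at h
  have e : ENNReal.ofReal (mollDensity μ ε y) = ‖∫ x, moll ε (x - y) ∂μ‖ₑ :=
    (Real.enorm_eq_ofReal (mollDensity_nonneg hε y)).symm
  rw [e]
  refine h.trans (mul_le_mul_right (ENNReal.rpow_le_rpow ?_ (by norm_num)) _)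
  have hm : MeasurableSet {x : E d | ∀ i, if y i < 0 then x i ≤ y i + ε else y i ≤ x i} := by
    rw [Set.ofPred_forall]
    refine MeasurableSet.iInter fun i => ?_
    split_ifs
    · exact measurableSet_le (by fun_prop) measurable_const
    · exact measurableSet_le measurable_const (by fun_prop)
  rw [← lintegral_indicator_one hm]
  refine lintegral_mono fun x => ?_
  by_cases hx : x ∈ {x : E d | ∀ i, if y i < 0 then x i ≤ y i + ε else y i ≤ x i}
  · rw [Set.indicator_of_mem hx, Pi.one_apply, ← ENNReal.ofReal_one]
    refine ENNReal.ofReal_le_ofReal ?_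
    rw [← sq_abs]
    exact pow_le_one₀ (abs_nonneg _) (abs_stepProd_le y hb x)
  · obtain ⟨i, hi⟩ := not_forall.1 hx
    have h0 : stepFun ε (y i) (b i) (x i) = 0 := by
      unfold stepFun
      simp only [hbdef]
      split_ifs at hi ⊢ with h
      · rw [Real.smoothTransition.one_of_one_le, sub_self]
        rw [le_div_iff₀ hε]
        linarith [not_le.1 hi]
      · rw [Real.smoothTransition.zero_of_nonpos, sub_self]
        exact div_nonpos_of_nonpos_of_nonneg (by linarith [not_le.1 hi]) hε.le
    have h1 : stepProd ε y b x = 0 := Finset.prod_eq_zero (Finset.mem_univ i) h0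
    simp [h1]

variable [IsFiniteMeasure μ]

lemma integrable_moll_sub {ε : ℝ} (hε : 0 < ε) (y : E d) :
    Integrable (fun x => moll ε (x - y)) μ := by
  obtain ⟨C, hC⟩ := (hasCompactSupport_moll (d := d) hε).exists_bound_of_continuous
    (contDiff_moll ε).continuous
  exact Integrable.of_bound ((contDiff_moll ε).continuous.comp
    (continuous_id.sub continuous_const)).aestronglyMeasurable C
    (Eventually.of_forall fun x => hC _)

lemma ofReal_mollDensity {ε : ℝ} (hε : 0 < ε) (y : E d) :
    ENNReal.ofReal (mollDensity μ ε y) = ∫⁻ x, ENNReal.ofReal (moll ε (x - y)) ∂μ :=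
  ofReal_integral_eq_lintegral_ofReal (integrable_moll_sub hε y)
    (Eventually.of_forall fun _ => moll_nonneg hε _)

lemma withDensity_mollDensity_apply {ε : ℝ} (hε : 0 < ε) {B : Set (E d)} (hB : MeasurableSet B) :
    (volume.withDensity fun y => ENNReal.ofReal (mollDensity μ ε y)) B =
      ∫⁻ x, (∫⁻ y in B, ENNReal.ofReal (moll ε (x - y))) ∂μ := by
  rw [withDensity_apply _ hB]
  simp only [ofReal_mollDensity hε]
  refine lintegral_lintegral_swap (Measurable.aemeasurable ?_)
  exact ((contDiff_moll ε).continuous.comp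
    (continuous_snd.sub continuous_fst)).measurable.ennreal_ofReal

/-- Mollification moves mass by at most dε, a bound for the norm on the support of the mollifier. -/
lemma levyProkhorovEDist_mollDensity_le {ε : ℝ} (hε : 0 < ε) :
    levyProkhorovEDist (volume.withDensity fun y => ENNReal.ofReal (mollDensity μ ε y)) μ ≤
      ENNReal.ofReal (d * ε) := by
  refine levyProkhorovEDist_le_of_forall _ _ _ fun δ B hδ hδ' hB => ?_
  have hlt : d * ε < δ.toReal := (ENNReal.ofReal_lt_iff_lt_toReal (by positivity) hδ'.ne).1 hδ
  have hz : ∀ x y : E d, δ.toReal ≤ dist x y → moll ε (x - y) = 0 := fun x y h => by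
    by_contra hne
    have := norm_le_of_moll_ne_zero hε hne
    rw [← dist_eq_norm] at this
    linarith
  have hmeas : MeasurableSet (Metric.thickening δ.toReal B) :=
    Metric.isOpen_thickening.measurableSet
  constructor
  · refine le_trans ?_ le_self_add
    rw [withDensity_mollDensity_apply hε hB, ← lintegral_indicator_one hmeas]
    refine lintegral_mono fun x => ?_
    by_cases hx : x ∈ Metric.thickening δ.toReal B
    · rw [Set.indicator_of_mem hx, Pi.one_apply, ← lintegral_moll_sub hε x]
      exact setLIntegral_le_lintegral _ _
    · refine (le_of_eq ?_).trans zero_le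
      refine setLIntegral_eq_zero hB fun y hy => ?_
      have h : δ.toReal ≤ dist x y := by
        by_contra hcon
        exact hx (Metric.mem_thickening_iff.2 ⟨y, hy, not_le.1 hcon⟩)
      simp [hz x y h]
  · refine le_trans ?_ le_self_add
    rw [withDensity_mollDensity_apply hε hmeas, ← lintegral_indicator_one hB]
    refine lintegral_mono fun x => ?_
    by_cases hx : x ∈ B
    · rw [Set.indicator_of_mem hx, Pi.one_apply, ← lintegral_moll_sub hε x]
      refine le_of_eq (setLIntegral_eq_of_support_subset fun y hy => ?_).symm
      by_contra hcon
      refine hy ?_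
      have h : δ.toReal ≤ dist x y := by
        by_contra hlt
        exact hcon (Metric.mem_thickening_iff.2 ⟨x, hx, by rw [dist_comm]; exact not_le.1 hlt⟩)
      simp [hz x y h]
    · simp [hx]

/-- Differentiating under the integral, every partial derivative of the mollified density is at most
K in absolute value; summing over the d coordinates of a direction gives dK. -/
lemma lipschitzWith_mollDensity {K : ℝ≥0} (hK : IbpBound μ K (d + 1)) (hμ : μ Set.univ ≤ 1)
    {ε : ℝ} (hε : 0 < ε) : LipschitzWith (d * K) (mollDensity μ ε) := by
  have hfc : Continuous (fderiv ℝ (moll (d := d) ε)) :=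
    (contDiff_moll ε).continuous_fderiv (by simp)
  obtain ⟨C, hC⟩ := ((hasCompactSupport_moll (d := d) hε).fderiv (𝕜 := ℝ)).exists_bound_of_continuous
    hfc
  have hint : ∀ y : E d, Integrable (fun x => -fderiv ℝ (moll ε) (x - y)) μ := fun y =>
    Integrable.of_bound (hfc.comp (continuous_id.sub continuous_const)).neg.aestronglyMeasurable C
      (Eventually.of_forall fun x => by rw [norm_neg]; exact hC _)
  have hder : ∀ y : E d, HasFDerivAt (mollDensity μ ε)
      (∫ x, -fderiv ℝ (moll ε) (x - y) ∂μ) y := fun y => by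
    refine hasFDerivAt_integral_of_dominated_of_fderiv_le (s := Set.univ)
      (F := fun y x => moll ε (x - y)) (F' := fun y x => -fderiv ℝ (moll ε) (x - y))
      (bound := fun _ => C) Filter.univ_mem
      (Eventually.of_forall fun y => (integrable_moll_sub hε y).aestronglyMeasurable)
      (integrable_moll_sub hε y) (hint y).aestronglyMeasurable
      (Eventually.of_forall fun x y _ => by rw [norm_neg]; exact hC _)
      (integrable_const _) (Eventually.of_forall fun x y _ => ?_)
    have h1 : HasFDerivAt (moll ε) (fderiv ℝ (moll ε) (x - y)) (x - y) :=
      ((contDiff_moll ε).differentiable (by simp) _).hasFDerivAt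
    have h2 : HasFDerivAt (fun y : E d => x - y) (-ContinuousLinearMap.id ℝ (E d)) y :=
      (hasFDerivAt_id y).const_sub x
    have h3 := h1.comp y h2
    rwa [ContinuousLinearMap.comp_neg, ContinuousLinearMap.comp_id] at h3
  refine lipschitzWith_of_nnnorm_fderiv_le (𝕜 := ℝ) (fun y => (hder y).differentiableAt)
    fun y => ?_
  rw [(hder y).fderiv, ← NNReal.coe_le_coe, coe_nnnorm]
  push_cast
  refine ContinuousLinearMap.opNorm_le_bound _ (by positivity) fun v => ?_
  rw [ContinuousLinearMap.integral_apply (hint y)]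
  have hv : ∀ x, (-fderiv ℝ (moll ε) (x - y)) v = ∑ j, -v j * pder j (moll ε) (x - y) := by
    intro x
    have e : v = ∑ j, v j • (EuclideanSpace.single j (1 : ℝ) : E d) := by
      have := (EuclideanSpace.basisFun (Fin d) ℝ).sum_repr v
      simpa using this.symm
    conv_lhs => rw [e]
    rw [map_sum]
    refine Finset.sum_congr rfl fun j _ => ?_
    rw [map_smul, smul_eq_mul, neg_apply, pder]
    ring
  have hintj : ∀ j : Fin d, Integrable (fun x => pder j (moll ε) (x - y)) μ := fun j => by
    have h := ((hint y).apply_continuousLinearMap (EuclideanSpace.single j (1 : ℝ))).neg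
    refine h.congr (Eventually.of_forall fun x => ?_)
    simp [pder]
  simp only [hv]
  rw [integral_finsetSum _ fun j _ => (hintj j).const_mul _]
  simp only [integral_const_mul]
  rw [Real.norm_eq_abs]
  calc |∑ j, -v j * ∫ x, pder j (moll ε) (x - y) ∂μ|
      ≤ ∑ j, |-v j * ∫ x, pder j (moll ε) (x - y) ∂μ| := Finset.abs_sum_le_sum_abs _ _
    _ ≤ ∑ _j : Fin d, ‖v‖ * K := by
        refine Finset.sum_le_sum fun j _ => ?_
        rw [abs_mul, abs_neg]
        refine mul_le_mul ?_ (abs_integral_pder_moll_le hK hμ hε y j) (abs_nonneg _)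
          (norm_nonneg _)
        simpa using PiLp.norm_apply_le v j
    _ = d * K * ‖v‖ := by simp; ring

/-- A law which satisfies the integration by parts inequalities of orders `d` and `d + 1` has a
bounded Lipschitz density. -/
lemma exists_lipschitz_density {A : ℝ≥0∞} (hAtop : A ≠ ∞) {K : ℝ≥0} (hA : IbpBound μ A d)
    (hK : IbpBound μ K (d + 1)) (hμ : μ Set.univ ≤ 1) :
    ∃ p : E d → ℝ, (∀ y, 0 ≤ p y) ∧ LipschitzWith (d * K) p ∧
      (μ = volume.withDensity fun y => ENNReal.ofReal (p y)) ∧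
      ∀ y, ENNReal.ofReal (p y) ≤ A * μ {x | ‖y‖ ≤ ‖x‖} ^ (1 / 2 : ℝ) := by
  set ε : ℕ → ℝ := fun k => 1 / ((k : ℝ) + 1) with hεdef
  have hε : ∀ k, 0 < ε k := fun k => Nat.one_div_pos_of_nat
  have hε0 : Tendsto ε atTop (𝓝 0) := tendsto_one_div_add_atTop_nhds_zero_nat
  have hanti : Antitone ε := fun a b hab => one_div_le_one_div_of_le (by positivity)
    (by gcongr)
  have hmass : ∀ k, (volume.withDensity fun y => ENNReal.ofReal (mollDensity μ (ε k) y))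
      Set.univ = μ Set.univ := fun k => by
    rw [withDensity_mollDensity_apply (hε k) MeasurableSet.univ]
    simp [lintegral_moll_sub (hε k)]
  have hfin : ∀ k, IsFiniteMeasure
      (volume.withDensity fun y => ENNReal.ofReal (mollDensity μ (ε k) y)) := fun k =>
    ⟨by rw [hmass]; exact measure_lt_top _ _⟩
  have hLP : Tendsto (fun k => levyProkhorovEDist
      (volume.withDensity fun y => ENNReal.ofReal (mollDensity μ (ε k) y)) μ) atTop (𝓝 0) := by
    have h0 : Tendsto (fun k => ENNReal.ofReal (d * ε k)) atTop (𝓝 0) := by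
      simpa using ENNReal.tendsto_ofReal (hε0.const_mul (d : ℝ))
    exact tendsto_of_tendsto_of_tendsto_of_le_of_le tendsto_const_nhds h0 (fun _ => zero_le)
      fun k => levyProkhorovEDist_mollDensity_le (hε k)
  -- The mollified densities share one Lipschitz constant and their laws converge to μ, so the
  -- general limit result removes the mollifier.
  obtain ⟨p, hp0, hpL, hμp, hunif⟩ := exists_density_of_tendsto (l := atTop)
    (fun k => (hmass k).le.trans hμ) (ps := fun k => mollDensity μ (ε k))
    (fun k y => mollDensity_nonneg (hε k) y) (fun k => lipschitzWith_mollDensity hK hμ (hε k))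
    (fun k => rfl) hLP
  refine ⟨p, hp0, hpL, hμp, fun y => ?_⟩
  set S : ℕ → Set (E d) := fun k => {x | ∀ i, if y i < 0 then x i ≤ y i + ε k else y i ≤ x i}
    with hS
  have hSm : ∀ k, MeasurableSet (S k) := fun k => by
    simp only [hS, Set.ofPred_forall]
    refine MeasurableSet.iInter fun i => ?_
    split_ifs
    · exact measurableSet_le (by fun_prop) measurable_const
    · exact measurableSet_le measurable_const (by fun_prop)
  have hSanti : Antitone S := fun a b hab x hx i => by
    have := hx i
    have hle := hanti hab
    split_ifs at this ⊢ <;> linarith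
  have hSlim : Tendsto (fun k => μ (S k)) atTop (𝓝 (μ (⋂ k, S k))) :=
    tendsto_measure_iInter_atTop (fun k => (hSm k).nullMeasurableSet) hSanti
      ⟨0, measure_ne_top _ _⟩
  have h1 : ENNReal.ofReal (p y) ≤ A * μ (⋂ k, S k) ^ (1 / 2 : ℝ) :=
    le_of_tendsto_of_tendsto' (ENNReal.tendsto_ofReal (hunif.tendsto_at y))
      (ENNReal.Tendsto.const_mul (hSlim.ennrpow_const _) (Or.inr hAtop))
      fun k => ofReal_mollDensity_le hA (hε k) y
  refine h1.trans (mul_le_mul_right (ENNReal.rpow_le_rpow (measure_mono fun x hx => ?_)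
    (by norm_num)) _)
  -- In the limit ε → 0 the sets shrink to the orthant with corner y that points away from the
  -- origin, and there every coordinate of x dominates that of y.
  have hx' : ∀ i, |y i| ≤ |x i| := fun i => by
    have hk : ∀ k, if y i < 0 then x i ≤ y i + ε k else y i ≤ x i := fun k =>
      Set.mem_iInter.1 hx k i
    by_cases hi : y i < 0
    · simp only [hi, if_true] at hk
      have h2 : x i ≤ y i := by
        have := ge_of_tendsto' (tendsto_const_nhds.add hε0) hk
        simpa using this
      rw [abs_of_neg hi, abs_of_nonpos (by linarith)]
      linarith
    · simp only [hi, if_false] at hk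
      have := hk 0
      rw [abs_of_nonneg (not_lt.1 hi), abs_of_nonneg (by linarith)]
      exact this
  show ‖y‖ ≤ ‖x‖
  rw [EuclideanSpace.norm_eq, EuclideanSpace.norm_eq]
  refine Real.sqrt_le_sqrt (Finset.sum_le_sum fun i _ => ?_)
  exact pow_le_pow_left₀ (norm_nonneg _) (hx' i) 2

end Mollifier

/-! ### Transfer to laws and convergence of the restricted laws. -/

section Conclusion

variable {d n : ℕ}

lemma IbpBound.mono {μ : Measure (E d)} {A A' : ℝ≥0∞} {q : ℕ} (h : IbpBound μ A q)
    (hA : A ≤ A') : IbpBound μ A' q := fun I hI φ hφ B hB0 hB =>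
  (h I hI φ hφ B hB0 hB).trans (mul_le_mul_left hA _)

lemma ibpBound_map {P : Measure (Omega d n)} {f : Omega d n → E d} (hf : Measurable f)
    {A : ℝ≥0∞} {q : ℕ}
    (h : ∀ (I : List (Fin d)), I.length = q → ∀ (φ : E d → ℝ),
      ContDiff ℝ ((⊤ : ℕ∞) : WithTop ℕ∞) φ → ∀ B : ℝ, 0 ≤ B →
      (∀ J : List (Fin d), J.length ≤ q → ∀ x, |pders J φ x| ≤ B) →
      ‖∫ ω, pders I φ (f ω) ∂P‖ₑ ≤
        A * (∫⁻ ω, ENNReal.ofReal (φ (f ω) ^ 2) ∂P) ^ (1 / 2 : ℝ)) :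
    IbpBound (P.map f) A q := fun I hI φ hφ B hB0 hB => by
  rw [integral_map hf.aemeasurable
    (contDiff_pders hφ I).continuous.measurable.aestronglyMeasurable,
    lintegral_map (hφ.continuous.measurable.pow_const 2).ennreal_ofReal hf]
  exact h I hI φ hφ B hB0 hB

/-- Triangle inequality through the unrestricted law: discarding the complement of Ξ costs at most 1
− P(Ξ). -/
lemma tendsto_levyProkhorovEDist_map_restrict {ι Ω' : Type*} {l : Filter ι} {Ω : ι → Type*}
    [∀ i, MeasurableSpace (Ω i)] [MeasurableSpace Ω'] {P : ∀ i, Measure (Ω i)}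
    [∀ i, IsProbabilityMeasure (P i)] {P' : Measure Ω'} [IsProbabilityMeasure P']
    {f : ∀ i, Ω i → E d} (hf : ∀ i, Measurable (f i)) {g : Ω' → E d}
    (h : TendstoInDistribution f l g P P') {Ξ : ∀ i, Set (Ω i)}
    (hΞ : Tendsto (fun i => P i (Ξ i)) l (𝓝 1)) :
    Tendsto (fun i => levyProkhorovEDist (((P i).restrict (Ξ i)).map (f i)) (P'.map g)) l
      (𝓝 0) := by
  have h1 : Tendsto (fun i => levyProkhorovEDist ((P i).map (f i)) (P'.map g)) l (𝓝 0) := by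
    have h2 := (LevyProkhorov.continuous_ofMeasure_probabilityMeasure.tendsto _).comp h.tendsto
    rw [tendsto_iff_edist_tendsto_0] at h2
    exact h2
  have h3 : Tendsto (fun i => 1 - P i (Ξ i)) l (𝓝 0) := by
    have := ENNReal.Tendsto.sub (tendsto_const_nhds (x := (1 : ℝ≥0∞))) hΞ
      (Or.inl ENNReal.one_ne_top)
    simpa using this
  have h4 := h3.add h1
  rw [add_zero] at h4
  refine tendsto_of_tendsto_of_tendsto_of_le_of_le tendsto_const_nhds h4 (fun _ => zero_le)
    fun i => ?_
  refine (levyProkhorovEDist_triangle _ ((P i).map (f i)) _).trans (add_le_add_left ?_ _)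
  refine levyProkhorovEDist_le_of_le (Measure.map_mono Measure.restrict_le_self (hf i)) ?_
  rw [Measure.map_apply (hf i) MeasurableSet.univ, Measure.map_apply (hf i) MeasurableSet.univ,
    Set.preimage_univ, measure_univ, Measure.restrict_apply_univ]
  exact le_add_tsub

end Conclusion

end PartialMalliavin

theorem mainTheorem3 (d : ℕ) (hd : 1 ≤ d) (z : E d) (r : ℝ) [Fact (0 < r)] :
    ∃ L₀ L₁ : ℝ≥0, 0 < L₀ ∧ 0 < L₁ ∧
    ∀ (α : unitInterval), 0 < α → α < 1 →
    ∀ (ν : Measure (E d)) [IsProbabilityMeasure ν]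
      (θ : ∀ n : ℕ+, (Fin n → E d) → ℝ)
      (_ : ∀ n, Measurable (θ n)) (_ : ∀ n x, θ n x ∈ Set.Icc (0 : ℝ) 1)
      (f : ∀ n : ℕ+, Omega d n → E d) (_ : ∀ n, Measurable (f n))
      (Ξ : ∀ n : ℕ+, Set (Omega d n)) (_ : ∀ n : ℕ+, MeasurableSet[sigmaEpsZeta d n] (Ξ n)),
    (∀ n : ℕ+, MemSobolevVec (law z r α ν n) (psi z r) (θ n) (f n)) →
    (∀ n, ∀ᵐ ω ∂(law z r α ν n), ω ∈ Ξ n →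
      0 < (malliavinMatrix (law z r α ν n) (psi z r) (θ n) (f n) ω).det) →
    (⨆ n : ℕ+, K (law z r α ν n) (psi z r) (θ n) L₁ (d + 1) (f n) (Ξ n)) < ∞ →
    ∃ p : ℕ+ → E d → ℝ,
      (∀ n, Measurable (p n) ∧ (∀ y, 0 ≤ p n y) ∧
        ((law z r α ν n).restrict (Ξ n)).map (f n) =
          volume.withDensity fun y => ENNReal.ofReal (p n y)) ∧
      (∀ n y, ENNReal.ofReal (p n y) ≤
        K (law z r α ν n) (psi z r) (θ n) L₀ d (f n) (Ξ n) *
          (law z r α ν n).restrict (Ξ n) {ω | ‖y‖ ≤ ‖f n ω‖} ^ (1 / 2 : ℝ)) ∧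
      (∀ n : ℕ+, LipschitzWith
        (d * (⨆ k : ℕ+, K (law z r α ν k) (psi z r) (θ k) L₁ (d + 1) (f k) (Ξ k)).toNNReal) (p n)) ∧
      ∀ (Ω' : Type u) [MeasurableSpace Ω'] (P' : Measure Ω') [IsProbabilityMeasure P']
        (g : Ω' → E d),
        TendstoInDistribution f atTop g (fun n : ℕ+ => law z r α ν n) P' →
        Tendsto (fun n : ℕ+ => law z r α ν n (Ξ n)) atTop (𝓝 1) →
        ∃ p₀ : E d → ℝ, Measurable p₀ ∧ (∀ y, 0 ≤ p₀ y) ∧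
          P'.map g = volume.withDensity (fun y => ENNReal.ofReal (p₀ y)) ∧
          TendstoUniformly p p₀ atTop := by
  obtain ⟨L₀, hL₀, hbound₀⟩ := exists_enorm_setIntegral_pders_le_K z r d d.le_succ
  obtain ⟨L₁, hL₁, hbound₁⟩ := exists_enorm_setIntegral_pders_le_K z r (d + 1) le_rfl
  refine ⟨L₀, L₁, hL₀, hL₁, fun α _ _ ν _ θ hθ hθ1 f hf Ξ hΞ hmem hdet hsup => ?_⟩
  set S : ℝ≥0 := (⨆ k : ℕ+, K (law z r α ν k) (psi z r) (θ k) L₁ (d + 1) (f k) (Ξ k)).toNNReal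
    with hS
  have hKS : ∀ n : ℕ+, K (law z r α ν n) (psi z r) (θ n) L₁ (d + 1) (f n) (Ξ n) ≤ S := fun n => by
    rw [hS, ENNReal.coe_toNNReal hsup.ne]
    exact le_iSup (fun k : ℕ+ => K (law z r α ν k) (psi z r) (θ k) L₁ (d + 1) (f k) (Ξ k)) n
  have hrho : ∀ n : ℕ+, ∫⁻ ω, maxNorm (rho (law z r α ν n) (psi z r) (θ n) (f n) (Ξ n) ω) ^
      (8 * (d + 1)) ∂(law z r α ν n) ≠ ∞ := fun n =>
    lintegral_rho_ne_top_of_K_ne_top hd (hmem n) (hdet n) d.succ_ne_zero hL₁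
      (ne_top_of_le_ne_top ENNReal.coe_ne_top (hKS n))
  -- Finiteness of K_{d+1} thus controls the lower moments of ϱ as well, so K_d is finite without
  -- being assumed so.
  have hrho₀ : ∀ n : ℕ+, ∫⁻ ω, maxNorm (rho (law z r α ν n) (psi z r) (θ n) (f n) (Ξ n) ω) ^
      (8 * d) ∂(law z r α ν n) ≠ ∞ := fun n =>
    lintegral_pow_ne_top_of_le (by omega) (hrho n)
  have hmass : ∀ n : ℕ+, ((law z r α ν n).restrict (Ξ n)).map (f n) Set.univ ≤ 1 := fun n => by
    rw [Measure.map_apply (hf n) MeasurableSet.univ, Set.preimage_univ,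
      Measure.restrict_apply_univ]
    exact prob_le_one
  have hdens : ∀ n : ℕ+, ∃ p : E d → ℝ, (∀ y, 0 ≤ p y) ∧ LipschitzWith (d * S) p ∧
      (((law z r α ν n).restrict (Ξ n)).map (f n) =
        volume.withDensity fun y => ENNReal.ofReal (p y)) ∧
      ∀ y, ENNReal.ofReal (p y) ≤ K (law z r α ν n) (psi z r) (θ n) L₀ d (f n) (Ξ n) *
        ((law z r α ν n).restrict (Ξ n)).map (f n) {x | ‖y‖ ≤ ‖x‖} ^ (1 / 2 : ℝ) := fun n => by
    refine exists_lipschitz_density (K_ne_top (hmem n) d.le_succ L₀ (hrho₀ n)) ?_ ?_ (hmass n)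
    · exact ibpBound_map (hf n) (hbound₀ α ν n (θ n) (hθ n) (hθ1 n) (f n) (hf n) (hmem n) (Ξ n)
        (hΞ n) (hdet n) (hrho₀ n))
    · exact (ibpBound_map (hf n) (hbound₁ α ν n (θ n) (hθ n) (hθ1 n) (f n) (hf n) (hmem n) (Ξ n)
        (hΞ n) (hdet n) (hrho n))).mono (hKS n)
  choose p hp0 hpL hpd hpb using hdens
  refine ⟨p, fun n => ⟨(hpL n).continuous.measurable, hp0 n, hpd n⟩, fun n y => ?_, hpL,
    fun Ω' _ P' _ g hg hΞ1 => ?_⟩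
  · have h := hpb n y
    rwa [Measure.map_apply (hf n) (measurableSet_le measurable_const measurable_norm)] at h
  · have : IsProbabilityMeasure (P'.map g) := Measure.isProbabilityMeasure_map hg.aemeasurable_limit
    -- The limit result that removed the mollifier is applied once more, now to the laws of f^n,
    -- whose densities share the Lipschitz constant of (b).
    obtain ⟨p₀, h0, hL, hμ, hu⟩ := exists_density_of_tendsto hmass hp0 hpL hpd
      (tendsto_levyProkhorovEDist_map_restrict hf hg hΞ1)
    exact ⟨p₀, hL.continuous.measurable, h0, hμ, hu⟩
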